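/- Let $n\ge 1$, let $dv$ be Lebesgue measure on $\mathbb C^n$, let $B_r(z)$ be the open Euclidean ball with centre $z$ and radius $r$, and let $Q_r(z)$ be the cube in $\mathbb C^n=\mathbb R^{2n}$ with centre $z$ and side length $r$. A weight is a non-negative locally integrable function $w$ on $\mathbb C^n$, and $w(E)=\int_E w\,dv$. For $1<p<\infty$ and $1/p+1/p'=1$, the class $A_p^{\rm restricted}$ consists of the weights $w$ with $w>0$ a.e. such that for some $r>0$ $$\sup_{z\in\mathbb C^n}\Big(\frac1{v(Q_r(z))}\int_{Q_r(z)}w\,dv\Big)\Big(\frac1{v(Q_r(z))}\int_{Q_r(z)}w^{-p'/p}\,dv\Big)^{p/p'}<\infty ,$$ the class $A_1^{\rm restricted}$ consists of the weights $w$ with $w>0$ a.e. such that for some $r>0$ $$\sup_{z\in\mathbb C^n}\frac{\int_{Q_r(z)}w\,dv}{v(Q_r(z))\,\operatorname{ess\,inf}_{Q_r(z)}w}<\infty ,$$ and $A_\infty^{\rm restricted}=\bigcup_{1\le p<\infty}A_p^{\rm restricted}$. For $0<p,\alpha<\infty$, let $F^p_{\alpha,w}$ be the space of entire functions $f$ on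 $\mathbb C^n$ with $$\|f\|_{F^p_{\alpha,w}}=\Big(\int_{\mathbb C^n}|f(z)|^pe^{-\frac{p\alpha}2|z|^2}w(z)\,dv(z)\Big)^{1/p}<\infty .$$ For $0<t,\alpha,\beta<\infty$ and a positive Borel measure $\mu$ on $\mathbb C^n$, put $$S^{t,\alpha,\beta}_\mu f(z)=\Big(\int_{\mathbb C^n}e^{-\frac\beta2|z-u|^2}|f(u)|^te^{-\frac{\alpha t}2|u|^2}\,d\mu(u)\Big)^{1/t}\in[0,\infty].$$ The operator $S^{t,\alpha,\beta}_\mu:F^p_{\alpha,w}\to L^q(w\,dv)$ is called bounded if there is $C>0$ with $\|S^{t,\alpha,\beta}_\mu f\|_{L^q(w\,dv)}\le C\|f\|_{F^p_{\alpha,w}}$ for all $f\in F^p_{\alpha,w}$; its norm is $\|S^{t,\alpha,\beta}_\mu\|=\sup_{\|f\|_{F^p_{\alpha,w}}\le1}\|S^{t,\alpha,\beta}_\mu f\|_{L^q(w\,dv)}\in[0,\infty]$; it is called compact if it maps $F^p_{\alpha,w}$ into $L^q(w\,dv)$ and every bounded subset of $F^p_{\alpha,w}$ to a relatively compact subset of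 $L^q(w\,dv)$, where $L^q(w\,dv)$ carries its usual metric ($\|f-g\|_{L^q(w\,dv)}$ if $q\ge1$, $\|f-g\|^q_{L^q(w\,dv)}$ if $q<1$). **Theorem.** Let $0<p,q,t,\alpha,\beta<\infty$ and $w\in A_\infty^{\rm restricted}$. For a positive Borel measure $\mu$ on $\mathbb C^n$ put $$G_\mu(z)=\frac{\mu(B_1(z))^{1/t}}{w(B_1(z))^{\frac1p-\frac1q}}\in[0,\infty],\qquad z\in\mathbb C^n.$$ Below, $X\asymp Y$ means $C^{-1}X\le Y\le CX$ with a constant $0<C<\infty$ that does not depend on $\mu$ (it may depend on $n,p,q,t,\alpha,\beta,w$); it includes the case that both sides are infinite. 1. Suppose $p\le q$. For every positive Borel measure $\mu$: (i) $S^{t,\alpha,\beta}_\mu:F^p_{\alpha,w}\to L^q(w\,dv)$ is bounded if and only if $G_\mu$ is bounded on $\mathbb C^n$, and $\|S^{t,\alpha,\beta}_\mu\|\asymp\sup_{z\in\mathbb C^n}G_\mu(z)$; (ii) if $\mu$ is finite on compact subsets of $\mathbb C^n$, then $S^{t,\alpha,\beta}_\mu:F^p_{\alpha,w}\to L^q(w\,dv)$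 is compact if and only if $\lim_{|z|\to\infty}G_\mu(z)=0$. 2. Suppose $p>q$. For every positive Borel measure $\mu$ the following are equivalent: (i) $S^{t,\alpha,\beta}_\mu:F^p_{\alpha,w}\to L^q(w\,dv)$ is bounded; (ii) $S^{t,\alpha,\beta}_\mu:F^p_{\alpha,w}\to L^q(w\,dv)$ is compact; (iii) $G_\mu\in L^{\frac{pq}{p-q}}(dv)$. Moreover, $\|S^{t,\alpha,\beta}_\mu\|\asymp\|G_\mu\|_{L^{\frac{pq}{p-q}}(dv)}$. -/

import Mathlib

open MeasureTheory Filter Topology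
open scoped ENNReal NNReal

noncomputable section

/-- The space `ℂⁿ` with its Euclidean norm. Its `volume` is Lebesgue measure `dv` on `ℂⁿ = ℝ²ⁿ`. -/
abbrev Cn (n : ℕ) : Type := EuclideanSpace ℂ (Fin n)

/-- The cube `Q_r(z)` in `ℂⁿ = ℝ²ⁿ` with centre `z` and side length `r`. -/
def cube {n : ℕ} (z : Cn n) (r : ℝ) : Set (Cn n) :=
  {u | ∀ i, |(u i - z i).re| ≤ r / 2 ∧ |(u i - z i).im| ≤ r / 2}

/-- A weight on `ℂⁿ`: a non-negative locally integrable function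
(measurability is part of `LocallyIntegrable`). -/
def IsWeight {n : ℕ} (w : Cn n → ℝ) : Prop :=
  (∀ z, 0 ≤ w z) ∧ LocallyIntegrable w volume

/-- The measure `w dv`. In particular `w(E) = weightMeasure w E` is the integral of `w` over `E`. -/
def weightMeasure {n : ℕ} (w : Cn n → ℝ) : Measure (Cn n) :=
  volume.withDensity fun z => ENNReal.ofReal (w z)

/-- The class `A_p^restricted` for `1 < p < ∞`; here `p' / p` and `p / p'` are written with
the conjugate exponent `p' = p / (p - 1)`. -/
def IsApRestricted {n : ℕ} (p : ℝ) (w : Cn n → ℝ) : Prop :=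
  IsWeight w ∧ (∀ᵐ z, 0 < w z) ∧ ∃ r : ℝ, 0 < r ∧
    (⨆ z : Cn n,
      ((volume (cube z r))⁻¹ * ∫⁻ u in cube z r, ENNReal.ofReal (w u)) *
      ((volume (cube z r))⁻¹ *
        ∫⁻ u in cube z r, ENNReal.ofReal (w u ^ (-(p.conjExponent / p)))) ^
          (p / p.conjExponent)) < ∞

/-- The class `A_1^restricted`. -/
def IsA1Restricted {n : ℕ} (w : Cn n → ℝ) : Prop :=
  IsWeight w ∧ (∀ᵐ z, 0 < w z) ∧ ∃ r : ℝ, 0 < r ∧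
    (⨆ z : Cn n,
      (∫⁻ u in cube z r, ENNReal.ofReal (w u)) /
        (volume (cube z r) *
          essInf (fun u => ENNReal.ofReal (w u)) (volume.restrict (cube z r)))) < ∞

/-- The class `A_∞^restricted`, the union of all `A_p^restricted` with `1 ≤ p < ∞`. -/
def IsAInftyRestricted {n : ℕ} (w : Cn n → ℝ) : Prop :=
  IsA1Restricted w ∨ ∃ p : ℝ, 1 < p ∧ IsApRestricted p w

/-- The (quasi-)norm of `L^p_{α,w}`, with value `∞` outside of that space. -/
def fockNorm {n : ℕ} (p α : ℝ) (w : Cn n → ℝ) (f : Cn n → ℂ) : ℝ≥0∞ :=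
  (∫⁻ z, ENNReal.ofReal (‖f z‖ ^ p * Real.exp (-(p * α / 2) * ‖z‖ ^ 2)) ∂weightMeasure w) ^ (1 / p)

/-- The weighted Fock space `F^p_{α,w}`: the entire functions with finite (quasi-)norm. -/
def fockSpace {n : ℕ} (p α : ℝ) (w : Cn n → ℝ) : Set (Cn n → ℂ) :=
  {f | Differentiable ℂ f ∧ fockNorm p α w f < ∞}

/-- The Berezin-type operator `S_μ^{t,α,β}`, with values in `[0, ∞]`. -/
def berezinOp {n : ℕ} (t α β : ℝ) (μ : Measure (Cn n)) (f : Cn n → ℂ) (z : Cn n) : ℝ≥0∞ :=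
  (∫⁻ u, ENNReal.ofReal (Real.exp (-(β / 2) * ‖z - u‖ ^ 2) * ‖f u‖ ^ t *
    Real.exp (-(α * t / 2) * ‖u‖ ^ 2)) ∂μ) ^ (1 / t)

/-- The (quasi-)norm of `S_μ^{t,α,β} f` in `L^q(w dv)`. -/
def berezinNorm {n : ℕ} (q t α β : ℝ) (w : Cn n → ℝ) (μ : Measure (Cn n)) (f : Cn n → ℂ) : ℝ≥0∞ :=
  eLpNorm (berezinOp t α β μ f) (ENNReal.ofReal q) (weightMeasure w)

/-- `S_μ^{t,α,β} : F^p_{α,w} → L^q(w dv)` is bounded. -/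
def BerezinBounded {n : ℕ} (p q t α β : ℝ) (w : Cn n → ℝ) (μ : Measure (Cn n)) : Prop :=
  ∃ C : ℝ≥0, 0 < C ∧ ∀ f ∈ fockSpace p α w,
    berezinNorm q t α β w μ f ≤ C * fockNorm p α w f

/-- The norm of `S_μ^{t,α,β} : F^p_{α,w} → L^q(w dv)`. -/
def berezinOpNorm {n : ℕ} (p q t α β : ℝ) (w : Cn n → ℝ) (μ : Measure (Cn n)) : ℝ≥0∞ :=
  ⨆ f ∈ {f ∈ fockSpace p α w | fockNorm p α w f ≤ 1}, berezinNorm q t α β w μ f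

/-- The usual metric of `L^q(ν)` for every `0 < q < ∞`: it is `‖f - g‖_q` if `q ≥ 1`,
and `‖f - g‖_q ^ q` if `q < 1`. -/
@[reducible] def lqMetric {X : Type*} [MeasurableSpace X] (q : ℝ) (hq : 0 < q) (ν : Measure X) :
    PseudoEMetricSpace (Lp ℝ (ENNReal.ofReal q) ν) where
  edist f g := eLpNorm (⇑f - ⇑g) (ENNReal.ofReal q) ν ^ min 1 q
  edist_self f := by
    rw [sub_self, eLpNorm_zero]
    exact ENNReal.zero_rpow_of_pos (lt_min one_pos hq)
  edist_comm f g := by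
    rw [eLpNorm_sub_comm]
  edist_triangle f g h := by
    have hf := Lp.aestronglyMeasurable f
    have hg := Lp.aestronglyMeasurable g
    have hh := Lp.aestronglyMeasurable h
    have e : (⇑f - ⇑h : X → ℝ) = (⇑f - ⇑g) + (⇑g - ⇑h) := by abel
    rcases le_total 1 q with h1 | h1
    · rw [min_eq_left h1, ENNReal.rpow_one, ENNReal.rpow_one, ENNReal.rpow_one, e]
      exact eLpNorm_add_le (hf.sub hg) (hg.sub hh) (by simpa using h1)
    · have key : ∀ φ : X → ℝ,
          eLpNorm φ (ENNReal.ofReal q) ν ^ q = ∫⁻ x, ‖φ x‖ₑ ^ q ∂ν := by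
        intro φ
        rw [eLpNorm_eq_lintegral_rpow_enorm_toReal (by simpa using hq) ENNReal.ofReal_ne_top,
          ENNReal.toReal_ofReal hq.le, ← ENNReal.rpow_mul, one_div, inv_mul_cancel₀ hq.ne',
          ENNReal.rpow_one]
      rw [min_eq_right h1, key, key, key, ← lintegral_add_left' ((hf.sub hg).enorm.pow_const q), e]
      refine lintegral_mono fun x => ?_
      exact (ENNReal.rpow_le_rpow (enorm_add_le _ _) hq.le).trans
        (ENNReal.rpow_add_le_add_rpow _ _ hq.le h1)

/-- `S_μ^{t,α,β} : F^p_{α,w} → L^q(w dv)` is compact: it maps `F^p_{α,w}` into `L^q(w dv)`, and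
the image of every bounded subset of `F^p_{α,w}` has compact closure in `L^q(w dv)`. -/
def BerezinCompact {n : ℕ} (p q : ℝ) (hq : 0 < q) (t α β : ℝ) (w : Cn n → ℝ)
    (μ : Measure (Cn n)) : Prop :=
  letI := lqMetric q hq (weightMeasure w)
  (∀ f ∈ fockSpace p α w, MemLp (berezinOp t α β μ f) (ENNReal.ofReal q) (weightMeasure w)) ∧
  ∀ A ⊆ fockSpace p α w, (∃ M : ℝ≥0, ∀ f ∈ A, fockNorm p α w f ≤ M) →
    IsCompact (closure {g : Lp ℝ (ENNReal.ofReal q) (weightMeasure w) |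
      ∃ f ∈ A, ⇑g =ᵐ[weightMeasure w] fun z => (berezinOp t α β μ f z).toReal})

/-- The function `G_μ(z) = μ(B_1(z))^{1/t} / w(B_1(z))^{1/p - 1/q}`, with values in `[0, ∞]`. -/
def Gfun {n : ℕ} (p q t : ℝ) (w : Cn n → ℝ) (μ : Measure (Cn n)) (z : Cn n) : ℝ≥0∞ :=
  μ (Metric.ball z 1) ^ (1 / t) / weightMeasure w (Metric.ball z 1) ^ (1 / p - 1 / q)

end

/-! At unit scale both the weight and the weighted modulus |f|e^{-α|·|²/2} of an entire function are
under control, and the operator is nearly local. The class of w enters only through `IsFockRegular`: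
w(B_1(u)) and w(B_1(v)) differ by at most a factor C e^{A|u-v|}, and |f|e^{-α|·|²/2} at z is bounded
by its L^s(w dv) mean over B_1(z), for every s > 0. Both follow from `HasReverseBound`, which is
Hölder's inequality combined with the A_p condition on cubes of one size. The exponential growth is
harmless: Gaussians beat every exponential, so all kernels are replaced by e^{-γ|x-y|} with γ as
large as needed.

Upper bounds. Over a lattice of small cells, `exists_lintegral_berezinOp_le` bounds the q-th power
of the norm of Sf by Σ N_k^{q/p} G_k^q, where N_k is the local mass of f and G_k a discrete form of
G. For p ≤ q one takes out sup G and uses ℓ¹ ⊂ ℓ^{q/p}; for q < p one applies Hölder with exponents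
p/q and p/(p-q).

Lower bounds. The normalized kernel at a has a Gaussian modulus centred at a, and testing on it
gives G(a) ≲ ‖S‖ (`exists_Gfun_le`). For q < p many kernels are tested at once. Cancellation is
excluded without random signs: the coefficients are replaced by a slowly varying majorant of
comparable norm (`exists_slowly_varying`), and on a sparse lattice each kernel then dominates the
others near its centre (`exists_le_fockAbs_latticeSum`). Extremal coefficients yield X ≤ T ‖S‖^q
X^{q/p} for X = Σ G^κ, κ = pq/(p-q), on every shift of the lattice; integration over the shifts
gives the L^κ norm (`exists_eLpNorm_Gfun_le`).

Compactness. Bounded sets of the Fock space are locally bounded, so sequences in them have pointwise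
convergent subsequences. Dominated convergence handles the part of μ in a ball; the rest is small
because the upper bounds are uniform in the measure and may be applied to μ outside the ball
(`berezinCompact_of_tail`). Conversely, a finite net of the image has little mass far away, whereas
the image of the normalized kernel at a has mass ≳ G(a)^q on B_1(a). For q < p boundedness already
puts G in L^κ, whose tail is small, so bounded and compact coincide. -/

noncomputable section

/-! ### Sub-mean value inequalities -/

/-- The sub-mean value property of `|g|^s` over the unit circle. -/
theorem norm_rpow_le_integral_circle {g : ℂ → ℂ} (hg : Differentiable ℂ g) {s : ℝ} (hs : 0 < s) :
    2 * Real.pi * ‖g 0‖ ^ s ≤ ∫ θ in (0 : ℝ)..2 * Real.pi, ‖g (circleMap 0 1 θ)‖ ^ s := by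
  have hcont : Continuous fun z => ‖g z‖ ^ s :=
    (hg.continuous.norm).rpow_const fun _ => Or.inr hs.le
  by_cases h0 : g 0 = 0
  · rw [h0, norm_zero, Real.zero_rpow hs.ne', mul_zero]
    exact intervalIntegral.integral_nonneg Real.two_pi_pos.le fun θ _ => by positivity
  have ha : 0 < ‖g 0‖ := norm_pos_iff.2 h0
  have hana : AnalyticOnNhd ℂ g Set.univ := fun z _ => hg.analyticAt z
  have hz := hana.preimage_zero_mem_codiscrete h0
  have hz' : ∀ᶠ z in codiscreteWithin (Metric.sphere (0 : ℂ) |1|), g z ≠ 0 := by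
    have := (codiscreteWithin_mono (Set.subset_univ (Metric.sphere (0 : ℂ) |1|))) hz
    filter_upwards [this] with z hz using by simpa using hz
  -- Jensen's formula: a zero u in the closed unit disc contributes its multiplicity times log
  -- (1/|u|) ≥ 0.
  have hlog : Real.log ‖g 0‖ ≤ Real.circleAverage (fun z => Real.log ‖g z‖) 0 1 := by
    rw [AnalyticOnNhd.circleAverage_log_norm one_ne_zero (hana.mono (Set.subset_univ _)) h0]
    have : 0 ≤ ∑ᶠ u, MeromorphicOn.divisor g (Metric.closedBall 0 |1|) u *
        Real.log (1 * ‖0 - u‖⁻¹) := by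
      refine finsum_nonneg fun u => ?_
      by_cases hu : u ∈ Metric.closedBall (0 : ℂ) |1|
      · refine mul_nonneg ?_ ?_
        · exact_mod_cast MeromorphicOn.AnalyticOnNhd.divisor_nonneg
            (hana.mono (Set.subset_univ (Metric.closedBall (0 : ℂ) |1|))) u
        · by_cases hu0 : u = 0
          · simp [hu0]
          refine Real.log_nonneg ?_
          have : ‖u‖ ≤ 1 := by simpa using hu
          simpa using (one_le_inv₀ (norm_pos_iff.2 hu0)).2 this
      · simp [Function.locallyFinsuppWithin.apply_eq_zero_of_notMem _ hu]
    linarith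
  have hint : CircleIntegrable (fun z => Real.log ‖g z‖) 0 1 :=
    MeromorphicOn.circleIntegrable_log_norm
      (hana.mono (Set.subset_univ _)).meromorphicOn
  set c := ‖g 0‖ ^ s with hc
  have hcpos : 0 < c := by positivity
  -- Passage from log |g| to |g|^s by e^x ≥ 1 + x at x = s (log |g z| - log |g 0|); by `hlog` the
  -- average of the left side is at least c.
  have hmono : Real.circleAverage (fun z => c * (1 + s * (Real.log ‖g z‖ - Real.log ‖g 0‖))) 0 1 ≤
      Real.circleAverage (fun z => ‖g z‖ ^ s) 0 1 := by
    -- Since `Real.log 0 = 0`, the tangent inequality may fail at zeros of g on the circle. Taking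
    -- the minimum repairs it and changes nothing on a codiscrete set, hence not the average.
    have e : Real.circleAverage (fun z => c * (1 + s * (Real.log ‖g z‖ - Real.log ‖g 0‖))) 0 1 =
        Real.circleAverage (fun z => min (‖g z‖ ^ s)
          (c * (1 + s * (Real.log ‖g z‖ - Real.log ‖g 0‖)))) 0 1 := by
      refine Real.circleAverage_congr_codiscreteWithin ?_ one_ne_zero
      filter_upwards [hz'] with z hz
      refine (min_eq_right ?_).symm
      have hgz : 0 < ‖g z‖ := norm_pos_iff.2 hz
      have h1 := Real.add_one_le_exp (s * (Real.log ‖g z‖ - Real.log ‖g 0‖))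
      have h2 : ‖g z‖ ^ s = c * Real.exp (s * (Real.log ‖g z‖ - Real.log ‖g 0‖)) := by
        rw [hc, Real.rpow_def_of_pos hgz, Real.rpow_def_of_pos ha, ← Real.exp_add]
        ring_nf
      rw [h2]
      gcongr
      linarith
    rw [e]
    have i1 : CircleIntegrable (fun z => c * (1 + s * (Real.log ‖g z‖ - Real.log ‖g 0‖))) 0 1 := by
      have := ((circleIntegrable_const (1 : ℝ) 0 1).add
        ((hint.sub (circleIntegrable_const (Real.log ‖g 0‖) 0 1)).const_fun_smul (a := s))).const_fun_smul (a := c)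
      simpa [smul_eq_mul] using this
    have i2 : CircleIntegrable (fun z => ‖g z‖ ^ s) 0 1 := hcont.continuousOn.circleIntegrable'
    refine Real.circleAverage_mono ?_ i2 fun z _ => min_le_left _ _
    exact ⟨i2.1.inf i1.1, i2.2.inf i1.2⟩
  have hlin : Real.circleAverage (fun z => c * (1 + s * (Real.log ‖g z‖ - Real.log ‖g 0‖))) 0 1 =
      c * (1 + s * (Real.circleAverage (fun z => Real.log ‖g z‖) 0 1 - Real.log ‖g 0‖)) := by
    have h1 := Real.circleAverage_fun_smul (c := (0:ℂ)) (R := 1) (a := c)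
      (f := fun z => (1 + s * (Real.log ‖g z‖ - Real.log ‖g 0‖)))
    have h2 := Real.circleAverage_fun_smul (c := (0:ℂ)) (R := 1) (a := s)
      (f := fun z => (Real.log ‖g z‖ - Real.log ‖g 0‖))
    have i3 := hint.sub (circleIntegrable_const (Real.log ‖g 0‖) 0 1)
    simp only [smul_eq_mul] at h1 h2
    rw [h1, Real.circleAverage_fun_add (circleIntegrable_const (1 : ℝ) 0 1) (by
      simpa using i3.const_fun_smul (a := s)), h2,
      Real.circleAverage_fun_sub hint (circleIntegrable_const _ 0 1),
      Real.circleAverage_const, Real.circleAverage_const]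
  have hfin : c ≤ Real.circleAverage (fun z => ‖g z‖ ^ s) 0 1 := by
    refine le_trans ?_ (hlin ▸ hmono)
    have : 0 ≤ s * (Real.circleAverage (fun z => Real.log ‖g z‖) 0 1 - Real.log ‖g 0‖) :=
      mul_nonneg hs.le (by linarith)
    nlinarith
  rw [Real.circleAverage_def, smul_eq_mul] at hfin
  rw [inv_mul_eq_div, le_div_iff₀ Real.two_pi_pos] at hfin
  linarith

theorem enorm_rpow_le_lintegral_circle {g : ℂ → ℂ} (hg : Differentiable ℂ g) {s : ℝ} (hs : 0 < s) :
    ENNReal.ofReal (2 * Real.pi) * ‖g 0‖ₑ ^ s ≤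
      ∫⁻ θ in Set.Ioc 0 (2 * Real.pi), ‖g (circleMap 0 1 θ)‖ₑ ^ s := by
  have h := norm_rpow_le_integral_circle hg hs
  have hcont : Continuous fun θ => ‖g (circleMap 0 1 θ)‖ ^ s :=
    ((hg.continuous.comp (by fun_prop)).norm).rpow_const fun _ => Or.inr hs.le
  rw [intervalIntegral.integral_of_le Real.two_pi_pos.le] at h
  have h2 := ENNReal.ofReal_le_ofReal h
  rw [ofReal_integral_eq_lintegral_ofReal
    ((hcont.intervalIntegrable 0 (2 * Real.pi)).1) (ae_of_all _ fun θ => by positivity),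
    ENNReal.ofReal_mul Real.two_pi_pos.le] at h2
  simpa only [← ENNReal.ofReal_rpow_of_nonneg (norm_nonneg _) hs.le, ofReal_norm] using h2

variable {n : ℕ}

/-- The sub-mean value property of `|f|^s` over Euclidean balls of `ℂⁿ`. -/
theorem volume_ball_mul_enorm_rpow_le {f : Cn n → ℂ} (hf : Differentiable ℂ f) {s : ℝ} (hs : 0 < s)
    (z : Cn n) (ρ : ℝ) :
    volume (Metric.ball (0 : Cn n) ρ) * ‖f z‖ₑ ^ s ≤
      ∫⁻ u in Metric.ball z ρ, ‖f u‖ₑ ^ s := by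
  have hm : Measurable fun u => ‖f u‖ₑ ^ s := hf.continuous.measurable.enorm.pow_const s
  -- Multiplication by a unimodular number is a real-linear isometry, so it preserves the ball and
  -- Lebesgue measure.
  have hrot : ∀ θ : ℝ, ∫⁻ u in Metric.ball (0 : Cn n) ρ, ‖f (z + circleMap 0 1 θ • u)‖ₑ ^ s =
      ∫⁻ u in Metric.ball z ρ, ‖f u‖ₑ ^ s := by
    intro θ
    have hc : ‖circleMap 0 1 θ‖ = 1 := by simp
    have hc0 : circleMap 0 1 θ ≠ 0 := by
      intro h; simp [h] at hc
    let e : Cn n ≃ₗᵢ[ℝ] Cn n :=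
      { toLinearEquiv := (LinearEquiv.smulOfNeZero ℂ (Cn n) _ hc0).restrictScalars ℝ
        norm_map' := fun u => by
          change ‖circleMap 0 1 θ • u‖ = ‖u‖
          rw [norm_smul, hc, one_mul] }
    have he : MeasurePreserving (fun u => z + e u) volume volume :=
      (measurePreserving_add_left volume z).comp e.measurePreserving
    have hemb : MeasurableEmbedding (fun u => z + e u) :=
      (measurableEmbedding_addLeft z).comp e.toHomeomorph.measurableEmbedding
    rw [← he.setLIntegral_comp_preimage_emb hemb _ (Metric.ball z ρ)]
    have hpre : (fun u => z + e u) ⁻¹' Metric.ball z ρ = Metric.ball 0 ρ := by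
      ext u
      simp
    rw [hpre]
    rfl
  -- The one-variable inequality on the complex line l ↦ z + l u. After integration over u in the
  -- ball and Tonelli, every θ contributes the same ball integral.
  have h1 : ∀ u, ENNReal.ofReal (2 * Real.pi) * ‖f z‖ₑ ^ s ≤
      ∫⁻ θ in Set.Ioc 0 (2 * Real.pi), ‖f (z + circleMap 0 1 θ • u)‖ₑ ^ s := by
    intro u
    have hg : Differentiable ℂ fun l : ℂ => f (z + l • u) := by fun_prop
    simpa using enorm_rpow_le_lintegral_circle hg hs
  have h2 : ENNReal.ofReal (2 * Real.pi) * (volume (Metric.ball (0 : Cn n) ρ) * ‖f z‖ₑ ^ s) ≤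
      ENNReal.ofReal (2 * Real.pi) * ∫⁻ u in Metric.ball z ρ, ‖f u‖ₑ ^ s := by
    calc _ = ∫⁻ _ in Metric.ball (0 : Cn n) ρ, ENNReal.ofReal (2 * Real.pi) * ‖f z‖ₑ ^ s := by
          rw [setLIntegral_const]; ring
      _ ≤ ∫⁻ u in Metric.ball (0 : Cn n) ρ, ∫⁻ θ in Set.Ioc 0 (2 * Real.pi),
            ‖f (z + circleMap 0 1 θ • u)‖ₑ ^ s := lintegral_mono h1
      _ = ∫⁻ θ in Set.Ioc 0 (2 * Real.pi), ∫⁻ u in Metric.ball (0 : Cn n) ρ,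
            ‖f (z + circleMap 0 1 θ • u)‖ₑ ^ s := by
          refine lintegral_lintegral_swap ?_
          refine (hm.comp ?_).aemeasurable
          have : Continuous fun x : Cn n × ℝ => z + circleMap 0 1 x.2 • x.1 := by fun_prop
          exact this.measurable
      _ = _ := by
          simp_rw [hrot]
          rw [setLIntegral_const, Real.volume_Ioc, sub_zero, mul_comm]
  have h0 : ENNReal.ofReal (2 * Real.pi) ≠ 0 := by simp [Real.pi_pos]
  exact (ENNReal.mul_le_mul_iff_right h0 ENNReal.ofReal_ne_top).1 h2

/-- The weighted modulus `|f(u)| e^{-α|u|²/2}` of an entire function. -/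
def fockAbs (α : ℝ) (f : Cn n → ℂ) (u : Cn n) : ℝ≥0∞ :=
  ENNReal.ofReal (‖f u‖ * Real.exp (-(α / 2) * ‖u‖ ^ 2))

theorem fockAbs_rpow {α s : ℝ} (hs : 0 ≤ s) (f : Cn n → ℂ) (u : Cn n) :
    fockAbs α f u ^ s = ENNReal.ofReal (‖f u‖ ^ s * Real.exp (-(s * α / 2) * ‖u‖ ^ 2)) := by
  rw [fockAbs, ENNReal.ofReal_rpow_of_nonneg (by positivity) hs,
    Real.mul_rpow (norm_nonneg _) (Real.exp_pos _).le, ← Real.exp_mul]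
  ring_nf

theorem continuous_fockAbs {α : ℝ} {f : Cn n → ℂ} (hf : Continuous f) :
    Continuous (fockAbs α f) := by
  refine ENNReal.continuous_ofReal.comp ?_
  fun_prop

theorem fockNorm_eq {p α : ℝ} (hp : 0 < p) (w : Cn n → ℝ) (f : Cn n → ℂ) :
    fockNorm p α w f = (∫⁻ z, fockAbs α f z ^ p ∂weightMeasure w) ^ (1 / p) := by
  simp only [fockNorm, fockAbs_rpow hp.le]

/-- The zero-free holomorphic factor e^{-α⟨z,u⟩} recentres the Gaussian: it turns e^{-α|u|²/2} into
a constant times e^{-α|u-z|²/2}, which is bounded below on the ball. Hence the constant depends on ρ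
but not on z. -/
theorem fockAbs_rpow_le {α : ℝ} (hα : 0 < α) {f : Cn n → ℂ} (hf : Differentiable ℂ f) {s : ℝ}
    (hs : 0 < s) (z : Cn n) (ρ : ℝ) :
    volume (Metric.ball (0 : Cn n) ρ) * fockAbs α f z ^ s ≤
      ENNReal.ofReal (Real.exp (s * α * ρ ^ 2 / 2)) *
        ∫⁻ u in Metric.ball z ρ, fockAbs α f u ^ s := by
  set h : Cn n → ℂ := fun u => f u * Complex.exp (-α * innerSL ℂ z u) with hh
  have hd : Differentiable ℂ h := by
    refine hf.mul (Complex.differentiable_exp.comp ?_)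
    exact (innerSL ℂ z).differentiable.const_mul _
  have key : ∀ u, fockAbs α f u ^ s = ‖h u‖ₑ ^ s *
      (ENNReal.ofReal (Real.exp (s * α / 2 * ‖z‖ ^ 2)) *
        ENNReal.ofReal (Real.exp (-(s * α / 2) * ‖u - z‖ ^ 2))) := by
    intro u
    rw [fockAbs_rpow hs.le, ← ofReal_norm (h u), ENNReal.ofReal_rpow_of_nonneg (norm_nonneg _) hs.le,
      ← ENNReal.ofReal_mul (Real.exp_pos _).le, ← ENNReal.ofReal_mul (by positivity), hh]
    congr 1
    simp only [norm_mul, Complex.norm_exp]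
    rw [Real.mul_rpow (norm_nonneg _) (Real.exp_pos _).le, ← Real.exp_mul, ← Real.exp_add,
      mul_assoc, ← Real.exp_add, @norm_sub_sq ℂ]
    congr 2
    have : (-(α : ℂ) * (innerSL ℂ z) u).re = -α * RCLike.re (inner ℂ u z) := by
      rw [inner_re_symm]
      simp
    rw [this]
    ring
  have hmv := volume_ball_mul_enorm_rpow_le hd hs z ρ
  have e1 : fockAbs α f z ^ s = ‖h z‖ₑ ^ s * ENNReal.ofReal (Real.exp (s * α / 2 * ‖z‖ ^ 2)) := by
    rw [key]; simp
  rw [e1, ← mul_assoc]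
  calc _ ≤ (∫⁻ u in Metric.ball z ρ, ‖h u‖ₑ ^ s) *
        ENNReal.ofReal (Real.exp (s * α / 2 * ‖z‖ ^ 2)) := by gcongr
    _ = ∫⁻ u in Metric.ball z ρ, ‖h u‖ₑ ^ s *
        ENNReal.ofReal (Real.exp (s * α / 2 * ‖z‖ ^ 2)) := by
        rw [lintegral_mul_const' _ _ ENNReal.ofReal_ne_top]
    _ ≤ ∫⁻ u in Metric.ball z ρ, ENNReal.ofReal (Real.exp (s * α * ρ ^ 2 / 2)) *
          fockAbs α f u ^ s := by
        refine setLIntegral_mono' measurableSet_ball fun u hu => ?_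
        rw [key]
        have : 1 ≤ ENNReal.ofReal (Real.exp (s * α * ρ ^ 2 / 2)) *
            ENNReal.ofReal (Real.exp (-(s * α / 2) * ‖u - z‖ ^ 2)) := by
          rw [← ENNReal.ofReal_mul (Real.exp_pos _).le, ← Real.exp_add, ENNReal.one_le_ofReal]
          refine Real.one_le_exp ?_
          have : ‖u - z‖ ≤ ρ := (mem_ball_iff_norm.1 hu).le
          have h3 : ‖u - z‖ ^ 2 ≤ ρ ^ 2 := by gcongr
          have h4 : 0 ≤ s * α / 2 := by positivity
          nlinarith [mul_le_mul_of_nonneg_left h3 h4]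
        calc _ = ‖h u‖ₑ ^ s * ENNReal.ofReal (Real.exp (s * α / 2 * ‖z‖ ^ 2)) * 1 := by rw [mul_one]
          _ ≤ ‖h u‖ₑ ^ s * ENNReal.ofReal (Real.exp (s * α / 2 * ‖z‖ ^ 2)) *
            (ENNReal.ofReal (Real.exp (s * α * ρ ^ 2 / 2)) *
            ENNReal.ofReal (Real.exp (-(s * α / 2) * ‖u - z‖ ^ 2))) := by gcongr
          _ = _ := by ring
    _ = _ := by rw [lintegral_const_mul' _ _ ENNReal.ofReal_ne_top]

/-! ### Regularity of the measures `w dv` -/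

theorem norm_le_sum_norm (x : Cn n) : ‖x‖ ≤ ∑ i, ‖x i‖ := by
  rw [EuclideanSpace.norm_eq]
  refine Real.sqrt_le_iff.2 ⟨Finset.sum_nonneg fun i _ => norm_nonneg _, ?_⟩
  exact Finset.sum_sq_le_sq_sum_of_nonneg fun i _ => norm_nonneg _

theorem ball_subset_cube (z : Cn n) (r : ℝ) : Metric.ball z (r / 2) ⊆ cube z r := by
  intro u hu i
  have h : ‖u i - z i‖ ≤ r / 2 := by
    have := PiLp.norm_apply_le (u - z) i
    exact this.trans (mem_ball_iff_norm.1 hu).le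
  exact ⟨(Complex.abs_re_le_norm _).trans h, (Complex.abs_im_le_norm _).trans h⟩

theorem cube_subset_closedBall (z : Cn n) (r : ℝ) : cube z r ⊆ Metric.closedBall z (n * r) := by
  intro u hu
  rw [mem_closedBall_iff_norm]
  refine (norm_le_sum_norm _).trans ?_
  have : ∀ i ∈ Finset.univ, ‖(u - z) i‖ ≤ r := fun i _ => by
    have h := hu i
    have := Complex.norm_le_abs_re_add_abs_im (u i - z i)
    simp only [PiLp.sub_apply]
    linarith [h.1, h.2]
  simpa using Finset.sum_le_card_nsmul _ _ _ this

theorem measurableSet_cube (z : Cn n) (r : ℝ) : MeasurableSet (cube z r) := by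
  have : cube z r = ⋂ i, {u : Cn n | |(u i - z i).re| ≤ r / 2 ∧ |(u i - z i).im| ≤ r / 2} := by
    ext u; simp [cube]
  rw [this]
  refine MeasurableSet.iInter fun i => ?_
  refine (IsClosed.and ?_ ?_).measurableSet
  · exact isClosed_le (by fun_prop) continuous_const
  · exact isClosed_le (by fun_prop) continuous_const

theorem volume_cube_ne_top (z : Cn n) (r : ℝ) : volume (cube z r) ≠ ∞ :=
  ((measure_mono (cube_subset_closedBall z r)).trans_lt
    (isCompact_closedBall z _).measure_lt_top).ne

theorem volume_cube_ne_zero (z : Cn n) {r : ℝ} (hr : 0 < r) : volume (cube z r) ≠ 0 :=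
  ((Metric.measure_ball_pos volume z (half_pos hr)).trans_le
    (measure_mono (ball_subset_cube z r))).ne'

theorem volume_cube (z : Cn n) (r : ℝ) : volume (cube z r) = volume (cube (0 : Cn n) r) := by
  have : (fun u => u + -z) ⁻¹' cube (0 : Cn n) r = cube z r := by
    ext u; simp [cube, sub_eq_add_neg]
  rw [← this, measure_preimage_add_right]

theorem IsWeight.aemeasurable {w : Cn n → ℝ} (hw : IsWeight w) :
    AEMeasurable (fun z => ENNReal.ofReal (w z)) volume :=
  hw.2.aestronglyMeasurable.aemeasurable.ennreal_ofReal

theorem IsWeight.setLIntegral {w : Cn n → ℝ} (hw : IsWeight w) {s : Set (Cn n)}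
    (hs : MeasurableSet s) {g : Cn n → ℝ≥0∞} (hg : Measurable g) :
    ∫⁻ u in s, g u ∂weightMeasure w = ∫⁻ u in s, ENNReal.ofReal (w u) * g u := by
  rw [weightMeasure, restrict_withDensity hs,
    lintegral_withDensity_eq_lintegral_mul₀ hw.aemeasurable.restrict hg.aemeasurable]
  rfl

theorem IsWeight.measure_lt_top {w : Cn n → ℝ} (hw : IsWeight w) (z : Cn n) (r : ℝ) :
    weightMeasure w (Metric.ball z r) < ∞ := by
  refine (measure_mono Metric.ball_subset_closedBall).trans_lt ?_
  rw [weightMeasure, withDensity_apply _ Metric.isClosed_closedBall.measurableSet]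
  have h := (hw.2.integrableOn_isCompact (isCompact_closedBall z r)).2
  refine lt_of_le_of_lt (lintegral_mono fun u => ?_) h
  exact Real.ofReal_le_enorm _

/-- `(∫_Q g)^P w(Q) ≤ C ∫_Q g^P w` for the cubes of one size. -/
def HasReverseBound (w : Cn n → ℝ) (r P : ℝ) (C : ℝ≥0∞) : Prop :=
  ∀ z : Cn n, ∀ g : Cn n → ℝ≥0∞, Measurable g →
    (∫⁻ u in cube z r, g u) ^ P * weightMeasure w (cube z r) ≤
      C * ∫⁻ u in cube z r, g u ^ P ∂weightMeasure w

/-- The A_1 condition says w(Q) ≤ S |Q| w(u) for almost every u in Q; multiply by g(u) and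
integrate. -/
theorem IsA1Restricted.hasReverseBound {w : Cn n → ℝ} (hw : IsA1Restricted w) :
    ∃ r > 0, ∃ C ≠ ∞, HasReverseBound w r 1 C := by
  obtain ⟨hwt, -, r, hr, hsup⟩ := hw
  set S := ⨆ z : Cn n, (∫⁻ u in cube z r, ENNReal.ofReal (w u)) / (volume (cube z r) *
          essInf (fun u => ENNReal.ofReal (w u)) (volume.restrict (cube z r))) with hS
  -- A nonzero constant permits clearing the denominator in [0, ∞] without knowing that it is
  -- finite, hence S + 1.
  refine ⟨r, hr, (S + 1) * volume (cube (0 : Cn n) r),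
    ENNReal.mul_ne_top (by finiteness) (volume_cube_ne_top 0 r), fun z g hg => ?_⟩
  simp only [ENNReal.rpow_one]
  have h1 : weightMeasure w (cube z r) ≤ (S + 1) * (volume (cube (0 : Cn n) r) *
      essInf (fun u => ENNReal.ofReal (w u)) (volume.restrict (cube z r))) := by
    rw [weightMeasure, withDensity_apply _ (measurableSet_cube z r), ← volume_cube z r]
    refine (ENNReal.div_le_iff_le_mul (Or.inr (by finiteness)) (Or.inr (by simp))).1 ?_
    exact (le_iSup (fun z : Cn n => (∫⁻ u in cube z r, ENNReal.ofReal (w u)) / (volume (cube z r) *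
          essInf (fun u => ENNReal.ofReal (w u)) (volume.restrict (cube z r)))) z).trans le_self_add
  have h2 : ∀ᵐ u ∂volume.restrict (cube z r), weightMeasure w (cube z r) ≤
      (S + 1) * volume (cube (0 : Cn n) r) * ENNReal.ofReal (w u) := by
    filter_upwards [ae_essInf_le (f := fun u => ENNReal.ofReal (w u))
      (μ := volume.restrict (cube z r))] with u hu
    refine h1.trans ?_
    rw [mul_assoc]
    gcongr
  rw [hwt.setLIntegral (measurableSet_cube z r) hg, ← lintegral_mul_const _ hg,
    ← lintegral_const_mul' _ _ (ENNReal.mul_ne_top (by finiteness) (volume_cube_ne_top 0 r))]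
  refine lintegral_mono_ae ?_
  filter_upwards [h2] with u hu
  calc g u * weightMeasure w (cube z r) ≤ g u * ((S + 1) * volume (cube (0 : Cn n) r) *
        ENNReal.ofReal (w u)) := by gcongr
    _ = _ := by ring

/-- Hölder's inequality for g = (g w^{1/P}) · w^{-1/P}; the A_P condition controls the second factor
together with w(Q). -/
theorem IsApRestricted.hasReverseBound {w : Cn n → ℝ} {P : ℝ} (hP : 1 < P)
    (hw : IsApRestricted P w) : ∃ r > 0, ∃ C ≠ ∞, HasReverseBound w r P C := by
  obtain ⟨hwt, hpos, r, hr, hsup⟩ := hw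
  set a := P / P.conjExponent with ha
  have hconj : P.HolderConjugate P.conjExponent := .conjExponent hP
  have hP0 : 0 < P := hconj.pos
  have hP0' : 0 < P.conjExponent := hconj.symm.pos
  have ha0 : 0 < a := div_pos hP0 hP0'
  set S := ⨆ z : Cn n, ((volume (cube z r))⁻¹ * ∫⁻ u in cube z r, ENNReal.ofReal (w u)) *
      ((volume (cube z r))⁻¹ *
        ∫⁻ u in cube z r, ENNReal.ofReal (w u ^ (-(P.conjExponent / P)))) ^ a with hS
  set V := volume (cube (0 : Cn n) r) with hV
  have hV0 : V ≠ 0 := volume_cube_ne_zero 0 hr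
  have hVt : V ≠ ∞ := volume_cube_ne_top 0 r
  refine ⟨r, hr, V * V ^ a * S, ?_, fun z g hg => ?_⟩
  · have : V ^ a ≠ ∞ := ENNReal.rpow_ne_top_of_nonneg ha0.le hVt
    finiteness
  set X := ∫⁻ u in cube z r, ENNReal.ofReal (w u) with hX
  set Y := ∫⁻ u in cube z r, ENNReal.ofReal (w u ^ (-(P.conjExponent / P))) with hY
  have hXY : X * Y ^ a ≤ V * V ^ a * S := by
    have h := le_iSup (fun z : Cn n => ((volume (cube z r))⁻¹ *
      ∫⁻ u in cube z r, ENNReal.ofReal (w u)) * ((volume (cube z r))⁻¹ *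
        ∫⁻ u in cube z r, ENNReal.ofReal (w u ^ (-(P.conjExponent / P)))) ^ a) z
    simp only [volume_cube z r, ← hS, ← hX, ← hY, ← hV] at h
    calc X * Y ^ a = (V * V⁻¹) * (V * V⁻¹) ^ a * (X * Y ^ a) := by
          rw [ENNReal.mul_inv_cancel hV0 hVt]; simp
      _ = V * V ^ a * ((V⁻¹ * X) * (V⁻¹ * Y) ^ a) := by
          rw [ENNReal.mul_rpow_of_nonneg _ _ ha0.le, ENNReal.mul_rpow_of_nonneg _ _ ha0.le]
          ring
      _ ≤ _ := by gcongr
  have hm : AEMeasurable (fun z => ENNReal.ofReal (w z)) (volume.restrict (cube z r)) :=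
    hwt.aemeasurable.restrict
  have hpos' : ∀ᵐ u ∂volume.restrict (cube z r), 0 < w u := ae_restrict_of_ae hpos
  have hH := ENNReal.lintegral_mul_le_Lp_mul_Lq (volume.restrict (cube z r)) hconj
    (f := fun u => g u * ENNReal.ofReal (w u) ^ (1 / P))
    (g := fun u => ENNReal.ofReal (w u) ^ (-(1 / P))) (hg.aemeasurable.mul (hm.pow_const _))
    (hm.pow_const _)
  have e1 : ∫⁻ u in cube z r, ((fun u => g u * ENNReal.ofReal (w u) ^ (1 / P)) *
      fun u => ENNReal.ofReal (w u) ^ (-(1 / P))) u = ∫⁻ u in cube z r, g u := by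
    refine lintegral_congr_ae ?_
    filter_upwards [hpos'] with u hu
    simp only [Pi.mul_apply]
    rw [mul_assoc, ← ENNReal.rpow_add _ _ (by simpa using hu) ENNReal.ofReal_ne_top]
    simp
  have e2 : ∫⁻ u in cube z r, (g u * ENNReal.ofReal (w u) ^ (1 / P)) ^ P =
      ∫⁻ u in cube z r, g u ^ P ∂weightMeasure w := by
    rw [hwt.setLIntegral (measurableSet_cube z r) (hg.pow_const P)]
    refine lintegral_congr fun u => ?_
    rw [ENNReal.mul_rpow_of_nonneg _ _ hP0.le, ← ENNReal.rpow_mul, one_div_mul_cancel hP0.ne',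
      ENNReal.rpow_one, mul_comm]
  have e3 : ∫⁻ u in cube z r, (ENNReal.ofReal (w u) ^ (-(1 / P))) ^ P.conjExponent = Y := by
    refine lintegral_congr_ae ?_
    filter_upwards [hpos'] with u hu
    rw [← ENNReal.rpow_mul, ENNReal.ofReal_rpow_of_pos hu]
    congr 2
    ring
  rw [e1, e2, e3] at hH
  have hWX : weightMeasure w (cube z r) = X := by
    rw [weightMeasure, withDensity_apply _ (measurableSet_cube z r)]
  rw [hWX]
  calc _ ≤ ((∫⁻ u in cube z r, g u ^ P ∂weightMeasure w) ^ (1 / P) *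
        Y ^ (1 / P.conjExponent)) ^ P * X := by gcongr
    _ = (∫⁻ u in cube z r, g u ^ P ∂weightMeasure w) * Y ^ a * X := by
        rw [ENNReal.mul_rpow_of_nonneg _ _ hP0.le, ← ENNReal.rpow_mul, ← ENNReal.rpow_mul,
          one_div_mul_cancel hP0.ne', ENNReal.rpow_one, ha]
        congr 3
        ring
    _ = (X * Y ^ a) * ∫⁻ u in cube z r, g u ^ P ∂weightMeasure w := by ring
    _ ≤ _ := by gcongr

/-- What the proof uses of the measure `w dv` for a weight `w` of class `A_∞^restricted`. -/
structure IsFockRegular (W : Measure (Cn n)) : Prop where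
  absolutelyContinuous : volume ≪ W
  measure_ball_lt_top : ∀ z, W (Metric.ball z 1) < ∞
  measure_ball_pos : ∀ z, 0 < W (Metric.ball z 1)
  growth : ∃ C : ℝ≥0, ∃ A : ℝ, 0 ≤ A ∧ ∀ u v, W (Metric.ball u 1) ≤
    C * ENNReal.ofReal (Real.exp (A * ‖u - v‖)) * W (Metric.ball v 1)
  pointwise : ∀ α > (0 : ℝ), ∀ s > (0 : ℝ), ∃ C : ℝ≥0, ∀ f : Cn n → ℂ, Differentiable ℂ f → ∀ z,
    fockAbs α f z ^ s * W (Metric.ball z 1) ≤ C * ∫⁻ u in Metric.ball z 1, fockAbs α f u ^ s ∂W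

/-- The bound tested on the indicator of a small ball compares neighbouring balls, and chains of
balls give exponential growth. Tested on a power of the weighted modulus it turns the sub-mean value
inequality for dv into one for w dv. -/
theorem isFockRegular_of_hasReverseBound {w : Cn n → ℝ} (hwt : IsWeight w)
    (hpos : ∀ᵐ z, 0 < w z) {r P : ℝ} (hr : 0 < r) (hP : 1 ≤ P) {C : ℝ≥0∞} (hC : C ≠ ∞)
    (h : HasReverseBound w r P C) : IsFockRegular (weightMeasure w) := by
  set W := weightMeasure w with hW
  have hP0 : 0 < P := by linarith
  have hac : volume ≪ W := withDensity_absolutelyContinuous' hwt.aemeasurable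
      (hpos.mono fun z hz => by simpa using hz)
  -- 2ρ ≤ r/2 keeps a ρ-ball with centre within ρ of z inside the cube at z; ρ ≤ 1 keeps it inside
  -- the unit ball with the same centre.
  obtain ⟨ρ, hρ, hρ1, hρr⟩ : ∃ ρ > 0, ρ ≤ 1 ∧ 2 * ρ ≤ r / 2 :=
    ⟨min 1 (r / 4), by positivity, min_le_left _ _, by linarith [min_le_right 1 (r / 4)]⟩
  set b := volume (Metric.ball (0 : Cn n) ρ) with hb
  have hb0 : b ≠ 0 := (Metric.measure_ball_pos volume _ hρ).ne'
  have hbt : b ≠ ∞ := measure_ball_lt_top.ne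
  have hbP0 : b ^ P ≠ 0 := by simp [hb0, hbt]
  have hbPt : b ^ P ≠ ∞ := ENNReal.rpow_ne_top_of_nonneg hP0.le hbt
  -- comparison of the cube with small balls inside
  have hcube : ∀ z z' : Cn n, ‖z - z'‖ ≤ ρ → b ^ P * W (cube z r) ≤ C * W (Metric.ball z' ρ) := by
    intro z z' hz
    have hsub : Metric.ball z' ρ ⊆ cube z r := by
      refine subset_trans (fun u hu => ?_) (ball_subset_cube z r)
      rw [mem_ball_iff_norm] at hu ⊢
      have : u - z = (u - z') - (z - z') := by abel
      rw [this]
      exact (norm_sub_le _ _).trans_lt (by linarith)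
    have := h z ((Metric.ball z' ρ).indicator 1) (measurable_one.indicator measurableSet_ball)
    rw [lintegral_indicator_one measurableSet_ball, Measure.restrict_apply measurableSet_ball,
      Set.inter_eq_left.2 hsub, Measure.addHaar_ball_center] at this
    refine this.trans ?_
    gcongr
    calc _ = ∫⁻ u in cube z r, (Metric.ball z' ρ).indicator 1 u ∂W := by
          refine lintegral_congr fun u => ?_
          by_cases hu : u ∈ Metric.ball z' ρ <;> simp [hu, hP0]
      _ ≤ ∫⁻ u, (Metric.ball z' ρ).indicator 1 u ∂W := setLIntegral_le_lintegral _ _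
      _ = _ := lintegral_indicator_one measurableSet_ball
  -- D ≥ 1 makes D^x increasing and the growth rate log D / ρ nonnegative.
  obtain ⟨D, hD1, hD⟩ : ∃ D : ℝ≥0, 1 ≤ D ∧ C / b ^ P ≤ D := by
    have : C / b ^ P ≠ ∞ := ENNReal.div_ne_top hC hbP0
    lift C / b ^ P to ℝ≥0 using this with D
    exact ⟨max 1 D, le_max_left _ _, by exact_mod_cast le_max_right _ _⟩
  have hcube' : ∀ z z' : Cn n, ‖z - z'‖ ≤ ρ → W (cube z r) ≤ D * W (Metric.ball z' ρ) := by
    intro z z' hz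
    refine le_trans ?_ (mul_le_mul_left hD _)
    rw [ENNReal.div_eq_inv_mul, mul_assoc]
    rw [← ENNReal.div_eq_inv_mul, ENNReal.le_div_iff_mul_le (Or.inl hbP0) (Or.inl hbPt), mul_comm]
    exact hcube z z' hz
  have hballcube : ∀ z : Cn n, Metric.ball z ρ ⊆ cube z r := fun z =>
    (Metric.ball_subset_ball (by linarith)).trans (ball_subset_cube z r)
  -- Walk from z to z' in N steps of length at most ρ, each costing a factor D.
  have hchain : ∀ (N : ℕ) (z z' : Cn n), ‖z - z'‖ ≤ N * ρ →
      W (Metric.ball z ρ) ≤ (D : ℝ≥0∞) ^ N * W (Metric.ball z' ρ) := by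
    intro N
    induction N with
    | zero =>
      intro z z' hz
      have : z = z' := by simpa [sub_eq_zero] using hz
      simp [this]
    | succ N ih =>
      intro z z' hz
      have hd : dist z z' ≤ N * ρ + ρ := by
        rw [dist_eq_norm]; push_cast at hz; linarith
      obtain ⟨y, hy1, hy2⟩ := exists_dist_le_le hρ.le (by positivity : (0 : ℝ) ≤ N * ρ) hd
      rw [dist_eq_norm] at hy1 hy2
      calc W (Metric.ball z ρ) ≤ W (cube z r) := measure_mono (hballcube z)
        _ ≤ D * W (Metric.ball y ρ) := hcube' z y hy1
        _ ≤ D * ((D : ℝ≥0∞) ^ N * W (Metric.ball z' ρ)) := by gcongr; exact ih y z' hy2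
        _ = _ := by ring
  -- A unit ball is covered by a fixed number of ρ-balls with centres in the closed unit ball around
  -- z, each reached by a chain of bounded length.
  obtain ⟨K, hK⟩ : ∃ K : ℝ≥0, ∀ z, W (Metric.ball z 1) ≤ K * W (Metric.ball z ρ) := by
    obtain ⟨T, hT1, hT2, hT3⟩ := (isCompact_closedBall (0 : Cn n) 1).finite_cover_balls hρ
    refine ⟨hT2.toFinset.card * D ^ (⌈1 / ρ⌉₊), fun z => ?_⟩
    calc W (Metric.ball z 1) ≤ W (⋃ y ∈ hT2.toFinset, Metric.ball (z + y) ρ) := by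
          refine measure_mono fun u hu => ?_
          have : u - z ∈ Metric.closedBall (0 : Cn n) 1 := by
            simpa using (mem_ball_iff_norm.1 hu).le
          obtain ⟨y, hy, hy2⟩ := Set.mem_iUnion₂.1 (hT3 this)
          refine Set.mem_iUnion₂.2 ⟨y, by simpa using hy, ?_⟩
          rw [mem_ball_iff_norm] at hy2 ⊢
          rwa [← sub_sub]
      _ ≤ ∑ y ∈ hT2.toFinset, W (Metric.ball (z + y) ρ) := measure_biUnion_finset_le _ _
      _ ≤ ∑ y ∈ hT2.toFinset, (D : ℝ≥0∞) ^ (⌈1 / ρ⌉₊) * W (Metric.ball z ρ) := by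
          refine Finset.sum_le_sum fun y hy => hchain _ _ _ ?_
          have h1 : ‖y‖ ≤ 1 := by simpa using hT1 ((Set.Finite.mem_toFinset hT2).1 hy)
          rw [add_sub_cancel_left]
          have h2 := Nat.le_ceil (1 / ρ)
          rw [div_le_iff₀ hρ] at h2
          exact h1.trans h2
      _ = _ := by
        rw [Finset.sum_const, nsmul_eq_mul]
        push_cast
        ring
  refine ⟨hac, fun z => hwt.measure_lt_top z 1, fun z => ?_, ?_, ?_⟩
  · rw [pos_iff_ne_zero]
    exact fun h0 => (Metric.measure_ball_pos volume z one_pos).ne' (hac h0)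
  -- D^{⌈x/ρ⌉} ≤ D · e^{(log D / ρ) x}; the extra D pays for rounding up.
  · refine ⟨K * D, Real.log D / ρ, div_nonneg (Real.log_nonneg (by exact_mod_cast hD1)) hρ.le,
      fun u v => ?_⟩
    have hpow : (D : ℝ≥0∞) ^ (⌈‖u - v‖ / ρ⌉₊) ≤
        D * ENNReal.ofReal (Real.exp (Real.log D / ρ * ‖u - v‖)) := by
      have hDpos : (0 : ℝ) < D := by exact_mod_cast one_pos.trans_le hD1
      rw [← ENNReal.ofReal_coe_nnreal, ← ENNReal.ofReal_pow D.coe_nonneg, ← ENNReal.ofReal_mul D.coe_nonneg]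
      refine ENNReal.ofReal_le_ofReal ?_
      rw [← Real.rpow_natCast]
      calc (D : ℝ) ^ ((⌈‖u - v‖ / ρ⌉₊ : ℕ) : ℝ) ≤ (D : ℝ) ^ (1 + ‖u - v‖ / ρ) := by
            refine Real.rpow_le_rpow_of_exponent_le (by exact_mod_cast hD1) ?_
            have := Nat.ceil_lt_add_one (by positivity : 0 ≤ ‖u - v‖ / ρ)
            linarith
        _ = _ := by
          rw [Real.rpow_add hDpos, Real.rpow_one, Real.rpow_def_of_pos hDpos]
          congr 2
          ring
    calc W (Metric.ball u 1) ≤ K * W (Metric.ball u ρ) := hK u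
      _ ≤ K * ((D : ℝ≥0∞) ^ (⌈‖u - v‖ / ρ⌉₊) * W (Metric.ball v ρ)) := by
          gcongr
          refine hchain _ _ _ ?_
          have := Nat.le_ceil (‖u - v‖ / ρ)
          rwa [div_le_iff₀ hρ] at this
      _ ≤ K * ((D * ENNReal.ofReal (Real.exp (Real.log D / ρ * ‖u - v‖))) *
            W (Metric.ball v 1)) := by
          gcongr
      _ = _ := by push_cast; ring
  · intro α hα s hs
    set E := ENNReal.ofReal (Real.exp (s / P * α * ρ ^ 2 / 2)) with hE
    have hEP : E ^ P ≠ ∞ := ENNReal.rpow_ne_top_of_nonneg hP0.le ENNReal.ofReal_ne_top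
    have hfin : K * (E ^ P * C / b ^ P) ≠ ∞ :=
      ENNReal.mul_ne_top ENNReal.coe_ne_top
        (ENNReal.div_ne_top (ENNReal.mul_ne_top hEP hC) hbP0)
    refine ⟨(K * (E ^ P * C / b ^ P)).toNNReal, fun f hf z => ?_⟩
    rw [ENNReal.coe_toNNReal hfin]
    have hm : Measurable (fockAbs α f) := (continuous_fockAbs hf.continuous).measurable
    -- The mean value inequality is used with exponent s/P, since the reverse bound raises to the
    -- power P.
    have h1 := fockAbs_rpow_le hα hf (s := s / P) (div_pos hs hP0) z ρ
    have h2 := h z ((Metric.ball z ρ).indicator fun u => fockAbs α f u ^ (s / P))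
      ((hm.pow_const _).indicator measurableSet_ball)
    have e1 : ∫⁻ u in cube z r, (Metric.ball z ρ).indicator (fun u => fockAbs α f u ^ (s / P)) u =
        ∫⁻ u in Metric.ball z ρ, fockAbs α f u ^ (s / P) := by
      rw [lintegral_indicator measurableSet_ball, Measure.restrict_restrict measurableSet_ball,
        Set.inter_eq_left.2 (hballcube z)]
    have e2 : ∫⁻ u in cube z r, (Metric.ball z ρ).indicator
        (fun u => fockAbs α f u ^ (s / P)) u ^ P ∂W ≤
        ∫⁻ u in Metric.ball z 1, fockAbs α f u ^ s ∂W := by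
      calc _ = ∫⁻ u in cube z r, (Metric.ball z ρ).indicator (fun u => fockAbs α f u ^ s) u ∂W := by
            refine lintegral_congr fun u => ?_
            by_cases hu : u ∈ Metric.ball z ρ
            · simp only [Set.indicator_of_mem hu]
              rw [← ENNReal.rpow_mul, div_mul_cancel₀ _ hP0.ne']
            · simp [Set.indicator_of_notMem hu, hP0]
        _ = ∫⁻ u in Metric.ball z ρ, fockAbs α f u ^ s ∂W := by
            rw [lintegral_indicator measurableSet_ball, Measure.restrict_restrict measurableSet_ball,
              Set.inter_eq_left.2 (hballcube z)]
        _ ≤ _ := lintegral_mono_set (Metric.ball_subset_ball hρ1)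
    rw [e1] at h2
    have h3 : b ^ P * (fockAbs α f z ^ s * W (Metric.ball z ρ)) ≤
        E ^ P * C * ∫⁻ u in Metric.ball z 1, fockAbs α f u ^ s ∂W := by
      calc _ = (b * fockAbs α f z ^ (s / P)) ^ P * W (Metric.ball z ρ) := by
            rw [ENNReal.mul_rpow_of_nonneg _ _ hP0.le, ← ENNReal.rpow_mul,
              div_mul_cancel₀ _ hP0.ne', mul_assoc]
        _ ≤ (E * ∫⁻ u in Metric.ball z ρ, fockAbs α f u ^ (s / P)) ^ P * W (cube z r) := by
            gcongr
            exact hballcube z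
        _ = E ^ P * ((∫⁻ u in Metric.ball z ρ, fockAbs α f u ^ (s / P)) ^ P * W (cube z r)) := by
            rw [ENNReal.mul_rpow_of_nonneg _ _ hP0.le, mul_assoc]
        _ ≤ E ^ P * (C * ∫⁻ u in Metric.ball z 1, fockAbs α f u ^ s ∂W) := by
            exact mul_le_mul' le_rfl (h2.trans (mul_le_mul' le_rfl e2))
        _ = _ := by ring
    calc fockAbs α f z ^ s * W (Metric.ball z 1)
        ≤ fockAbs α f z ^ s * (K * W (Metric.ball z ρ)) := by gcongr; exact hK z
      _ = K * (fockAbs α f z ^ s * W (Metric.ball z ρ)) := by ring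
      _ ≤ K * ((E ^ P * C * ∫⁻ u in Metric.ball z 1, fockAbs α f u ^ s ∂W) / b ^ P) := by
          gcongr
          rw [ENNReal.le_div_iff_mul_le (Or.inl hbP0) (Or.inl hbPt), mul_comm]
          exact h3
      _ = _ := by
        simp only [div_eq_mul_inv]
        ring

theorem IsAInftyRestricted.isFockRegular {w : Cn n → ℝ} (hw : IsAInftyRestricted w) :
    IsFockRegular (weightMeasure w) := by
  rcases hw with hw | ⟨P, hP, hw⟩
  · obtain ⟨r, hr, C, hC, h⟩ := hw.hasReverseBound
    exact isFockRegular_of_hasReverseBound hw.1 hw.2.1 hr le_rfl hC h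
  · obtain ⟨r, hr, C, hC, h⟩ := hw.hasReverseBound hP
    exact isFockRegular_of_hasReverseBound hw.1 hw.2.1 hr hP.le hC h

/-! ### Sums, exponential kernels and lattices -/

section Sums

variable {ι : Type*}

theorem tsum_rpow_le_of_sum_rpow_le {a : ι → ℝ≥0∞} {s : ℝ} (hs : 0 < s) {B : ℝ≥0∞}
    (h : ∀ F : Finset ι, (∑ i ∈ F, a i) ^ s ≤ B) : (∑' i, a i) ^ s ≤ B := by
  rw [← ENNReal.le_rpow_inv_iff hs, ENNReal.tsum_eq_iSup_sum]
  exact iSup_le fun F => (ENNReal.le_rpow_inv_iff hs).2 (h F)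

theorem sum_rpow_le_sum_rpow (F : Finset ι) (a : ι → ℝ≥0∞) {s : ℝ} (hs : 0 < s) (hs1 : s ≤ 1) :
    (∑ i ∈ F, a i) ^ s ≤ ∑ i ∈ F, a i ^ s := by
  classical
  induction F using Finset.induction_on with
  | empty => simp [hs]
  | insert i F hi ih =>
    rw [Finset.sum_insert hi, Finset.sum_insert hi]
    exact (ENNReal.rpow_add_le_add_rpow _ _ hs.le hs1).trans (by gcongr)

theorem tsum_rpow_le_tsum_rpow (a : ι → ℝ≥0∞) {s : ℝ} (hs : 0 < s) (hs1 : s ≤ 1) :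
    (∑' i, a i) ^ s ≤ ∑' i, a i ^ s :=
  tsum_rpow_le_of_sum_rpow_le hs fun F =>
    (sum_rpow_le_sum_rpow F a hs hs1).trans (ENNReal.sum_le_tsum F)

theorem tsum_rpow_le_rpow_tsum (a : ι → ℝ≥0∞) {s : ℝ} (hs1 : 1 ≤ s) :
    ∑' i, a i ^ s ≤ (∑' i, a i) ^ s := by
  have hs : 0 < s := by linarith
  have h := tsum_rpow_le_tsum_rpow (fun i => a i ^ s) (inv_pos.2 hs) (inv_le_one_of_one_le₀ hs1)
  simp only [ENNReal.rpow_rpow_inv hs.ne'] at h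
  rwa [← ENNReal.rpow_inv_le_iff hs]

/-- Jensen's inequality for the weights a; as they are not normalized, their total mass appears to
the power s - 1. -/
theorem tsum_mul_rpow_le (a x : ι → ℝ≥0∞) {s : ℝ} (hs1 : 1 ≤ s) :
    (∑' i, a i * x i) ^ s ≤ (∑' i, a i) ^ (s - 1) * ∑' i, a i * x i ^ s := by
  have hs : 0 < s := by linarith
  refine tsum_rpow_le_of_sum_rpow_le hs fun F => ?_
  have h := ENNReal.inner_le_weight_mul_Lp_of_nonneg F hs1 a x
  calc (∑ i ∈ F, a i * x i) ^ s
      ≤ ((∑ i ∈ F, a i) ^ (1 - s⁻¹) * (∑ i ∈ F, a i * x i ^ s) ^ s⁻¹) ^ s := by gcongr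
    _ = (∑ i ∈ F, a i) ^ (s - 1) * ∑ i ∈ F, a i * x i ^ s := by
        rw [ENNReal.mul_rpow_of_nonneg _ _ hs.le, ENNReal.rpow_inv_rpow hs.ne', ← ENNReal.rpow_mul,
          sub_mul, inv_mul_cancel₀ hs.ne', one_mul]
    _ ≤ _ := by
        gcongr
        · exact ENNReal.sum_le_tsum F
        · exact ENNReal.sum_le_tsum F

theorem tsum_mul_le_rpow_mul_rpow (x y : ι → ℝ≥0∞) {a b : ℝ} (h : a.HolderConjugate b) :
    ∑' i, x i * y i ≤ (∑' i, x i ^ a) ^ (1 / a) * (∑' i, y i ^ b) ^ (1 / b) := by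
  rw [ENNReal.tsum_eq_iSup_sum]
  refine iSup_le fun F => (ENNReal.inner_le_Lp_mul_Lq F x y h).trans ?_
  have ha := h.pos
  have hb := h.symm.pos
  gcongr
  · exact ENNReal.sum_le_tsum F
  · exact ENNReal.sum_le_tsum F

end Sums

/-- The kernel `e^{-γ|x - y|}`. -/
def expKer (γ : ℝ) (x y : Cn n) : ℝ≥0∞ := ENNReal.ofReal (Real.exp (-γ * ‖x - y‖))

theorem expKer_comm (γ : ℝ) (x y : Cn n) : expKer γ x y = expKer γ y x := by
  rw [expKer, expKer, norm_sub_rev]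

theorem expKer_ne_top (γ : ℝ) (x y : Cn n) : expKer γ x y ≠ ∞ := ENNReal.ofReal_ne_top

theorem expKer_anti {γ γ' : ℝ} (h : γ ≤ γ') (x y : Cn n) : expKer γ' x y ≤ expKer γ x y := by
  refine ENNReal.ofReal_le_ofReal (Real.exp_le_exp.2 ?_)
  nlinarith [norm_nonneg (x - y)]

theorem expKer_rpow (γ : ℝ) {s : ℝ} (hs : 0 ≤ s) (x y : Cn n) :
    expKer γ x y ^ s = expKer (γ * s) x y := by
  rw [expKer, expKer, ENNReal.ofReal_rpow_of_nonneg (Real.exp_pos _).le hs, ← Real.exp_mul]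
  ring_nf

theorem expKer_add (γ δ : ℝ) (x y : Cn n) : expKer (γ + δ) x y = expKer γ x y * expKer δ x y := by
  rw [expKer, expKer, expKer, ← ENNReal.ofReal_mul (Real.exp_pos _).le, ← Real.exp_add]
  ring_nf

theorem expKer_shift {γ : ℝ} (hγ : 0 ≤ γ) (x : Cn n) {y z : Cn n} {d : ℝ} (h : ‖y - z‖ ≤ d) :
    expKer γ x y ≤ ENNReal.ofReal (Real.exp (γ * d)) * expKer γ x z := by
  rw [expKer, expKer, ← ENNReal.ofReal_mul (Real.exp_pos _).le, ← Real.exp_add]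
  refine ENNReal.ofReal_le_ofReal (Real.exp_le_exp.2 ?_)
  have : ‖x - z‖ ≤ ‖x - y‖ + d := by
    have : x - z = (x - y) + (y - z) := by abel
    rw [this]
    exact (norm_add_le _ _).trans (by gcongr)
  nlinarith

theorem expKer_mul_expKer_le {γ : ℝ} (hγ : 0 ≤ γ) (x y z : Cn n) :
    expKer γ x y * expKer γ y z ≤ expKer γ x z := by
  rw [expKer, expKer, expKer, ← ENNReal.ofReal_mul (Real.exp_pos _).le, ← Real.exp_add]
  refine ENNReal.ofReal_le_ofReal (Real.exp_le_exp.2 ?_)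
  nlinarith [norm_sub_le_norm_sub_add_norm_sub x y z]

theorem continuous_expKer (γ : ℝ) : Continuous fun x : Cn n × Cn n => expKer γ x.1 x.2 :=
  ENNReal.continuous_ofReal.comp (by fun_prop)

theorem measurable_expKer_left (γ : ℝ) (y : Cn n) : Measurable fun x => expKer γ x y :=
  ((continuous_expKer γ).comp (by fun_prop : Continuous fun x => (x, y))).measurable

/-- Gaussian kernels are dominated by all exponential kernels. -/
theorem exists_gaussian_le {β : ℝ} (hβ : 0 < β) (γ : ℝ) : ∃ C : ℝ≥0, ∀ x y : Cn n,
    ENNReal.ofReal (Real.exp (-β * ‖x - y‖ ^ 2)) ≤ C * expKer γ x y := by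
  -- The constant comes from completing the square: -βx² + γx ≤ γ²/(4β).
  refine ⟨(Real.exp (γ ^ 2 / (4 * β))).toNNReal, fun x y => ?_⟩
  rw [expKer, ← ENNReal.ofReal, ← ENNReal.ofReal_mul (Real.exp_pos _).le, ← Real.exp_add]
  refine ENNReal.ofReal_le_ofReal (Real.exp_le_exp.2 ?_)
  have : 0 ≤ β * (‖x - y‖ - γ / (2 * β)) ^ 2 := by positivity
  have e : β * (‖x - y‖ - γ / (2 * β)) ^ 2 =
      β * ‖x - y‖ ^ 2 - γ * ‖x - y‖ + γ ^ 2 / (4 * β) := by field_simp; ring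
  linarith

/-- The exponential decays faster than (1 + |x|)^{-(d+1)}, d the real dimension, which is
integrable; translation invariance makes the bound independent of z. -/
theorem exists_lintegral_expKer_le (n : ℕ) {γ : ℝ} (hγ : 0 < γ) :
    ∃ C : ℝ≥0, ∀ z : Cn n, ∫⁻ u, expKer γ z u ≤ C := by
  obtain ⟨C, hC⟩ : ∃ C : ℝ≥0, ∀ x : ℝ, 0 ≤ x → Real.exp (-γ * x) ≤
      C * (1 + x) ^ (-((Module.finrank ℝ (Cn n) : ℝ) + 1)) := by
    set m := Module.finrank ℝ (Cn n) + 1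
    refine ⟨(Real.exp γ * (m.factorial / γ ^ m)).toNNReal, fun x hx => ?_⟩
    rw [Real.coe_toNNReal _ (by positivity)]
    have h1 : (γ * (1 + x)) ^ m / m.factorial ≤ Real.exp (γ * (1 + x)) :=
      Real.pow_div_factorial_le_exp _ (by positivity) m
    have h2 : (1 + x) ^ (-((Module.finrank ℝ (Cn n) : ℝ) + 1)) = ((1 + x) ^ m)⁻¹ := by
      rw [Real.rpow_neg (by positivity), ← Real.rpow_natCast]
      simp [m]
    rw [h2, ← div_eq_mul_inv, le_div_iff₀ (by positivity)]
    have h3 : Real.exp (-γ * x) = Real.exp γ / Real.exp (γ * (1 + x)) := by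
      rw [← Real.exp_sub]; ring_nf
    rw [h3, div_mul_eq_mul_div, div_le_iff₀ (Real.exp_pos _), mul_assoc]
    gcongr
    rw [mul_pow, div_le_iff₀ (by positivity)] at h1
    rw [div_mul_eq_mul_div, le_div_iff₀ (by positivity)]
    linarith
  have hfin := finite_integral_one_add_norm (E := Cn n) (μ := volume)
    (r := (Module.finrank ℝ (Cn n) : ℝ) + 1) (by linarith)
  have h0 : ∫⁻ u : Cn n, expKer γ 0 u ≤ C * ∫⁻ x : Cn n,
      ENNReal.ofReal ((1 + ‖x‖) ^ (-((Module.finrank ℝ (Cn n) : ℝ) + 1))) := by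
    rw [← lintegral_const_mul' _ _ ENNReal.coe_ne_top]
    refine lintegral_mono fun u => ?_
    rw [← ENNReal.ofReal_coe_nnreal, ← ENNReal.ofReal_mul C.coe_nonneg]
    refine ENNReal.ofReal_le_ofReal ?_
    simpa using hC ‖u‖ (norm_nonneg u)
  have hne : ∫⁻ u : Cn n, expKer γ 0 u ≠ ∞ :=
    (h0.trans_lt (ENNReal.mul_lt_top ENNReal.coe_lt_top hfin)).ne
  refine ⟨(∫⁻ u : Cn n, expKer γ 0 u).toNNReal, fun z => ?_⟩
  rw [ENNReal.coe_toNNReal hne]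
  refine le_of_eq ?_
  rw [← lintegral_add_right_eq_self (μ := volume) (fun u => expKer γ z u) z]
  refine lintegral_congr fun u => ?_
  simp [expKer]

/-- The points of the lattice `D ℤ²ⁿ` in `ℂⁿ`. -/
def latt (D : ℝ) (k : Fin n → ℤ × ℤ) : Cn n := WithLp.toLp 2 fun i => ⟨D * (k i).1, D * (k i).2⟩

/-- The half-open cube with side `D` and lowest corner `latt D k`. -/
def cell (D : ℝ) (k : Fin n → ℤ × ℤ) : Set (Cn n) :=
  (fun z i => (⌊(z i).re / D⌋, ⌊(z i).im / D⌋)) ⁻¹' {k}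

theorem measurableSet_cell (D : ℝ) (k : Fin n → ℤ × ℤ) : MeasurableSet (cell D k) := by
  have : Measurable fun (z : Cn n) i => (⌊(z i).re / D⌋, ⌊(z i).im / D⌋) := by
    refine measurable_pi_lambda _ fun i => Measurable.prodMk ?_ ?_
    · have : Measurable fun z : Cn n => (z i).re / D :=
        (by fun_prop : Continuous fun z : Cn n => (z i).re / D).measurable
      exact Int.measurable_floor.comp this
    · have : Measurable fun z : Cn n => (z i).im / D :=
        (by fun_prop : Continuous fun z : Cn n => (z i).im / D).measurable
      exact Int.measurable_floor.comp this
  exact this (measurableSet_singleton k)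

theorem lintegral_eq_tsum_cell (D : ℝ) (μ : Measure (Cn n)) (f : Cn n → ℝ≥0∞) :
    ∫⁻ z, f z ∂μ = ∑' k, ∫⁻ z in cell D k, f z ∂μ := by
  have hU : ⋃ k, cell (n := n) D k = Set.univ := by
    ext z; simp [cell]
  rw [← setLIntegral_univ, ← hU, lintegral_iUnion (measurableSet_cell D)]
  intro k j hkj
  exact Disjoint.preimage _ (Set.disjoint_singleton.2 hkj)

theorem norm_sub_latt_le {D : ℝ} (hD : 0 < D) {k : Fin n → ℤ × ℤ} {z : Cn n} (hz : z ∈ cell D k) :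
    ‖z - latt D k‖ ≤ 2 * n * D := by
  refine (norm_le_sum_norm _).trans ?_
  have h1 : ∀ (x : ℝ) (m : ℤ), ⌊x / D⌋ = m → |x - D * m| ≤ D := by
    intro x m h
    have h1 := Int.floor_eq_iff.1 h
    rw [le_div_iff₀ hD, div_lt_iff₀ hD] at h1
    rw [abs_le]
    constructor <;> nlinarith
  have : ∀ i ∈ Finset.univ, ‖(z - latt D k) i‖ ≤ 2 * D := fun i _ => by
    have hi : (⌊(z i).re / D⌋, ⌊(z i).im / D⌋) = k i := congrFun hz i
    have := Complex.norm_le_abs_re_add_abs_im ((z - latt D k) i)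
    have ha := h1 _ _ (congrArg Prod.fst hi)
    have hb := h1 _ _ (congrArg Prod.snd hi)
    simp only [PiLp.sub_apply, Complex.sub_re, Complex.sub_im, latt] at this ⊢
    linarith
  refine (Finset.sum_le_card_nsmul _ _ _ this).trans (le_of_eq ?_)
  simp
  ring

theorem le_norm_latt_sub_latt {D : ℝ} (hD : 0 < D) {k j : Fin n → ℤ × ℤ} (h : k ≠ j) :
    D ≤ ‖latt D k - latt D j‖ := by
  obtain ⟨i, hi⟩ := Function.ne_iff.1 h
  refine le_trans ?_ (PiLp.norm_apply_le (latt D k - latt D j) i)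
  have h1 : ∀ a b : ℤ, a ≠ b → D ≤ |D * a - D * b| := by
    intro a b hab
    rw [← mul_sub, abs_mul, abs_of_pos hD]
    have : (1 : ℝ) ≤ |(a : ℝ) - b| := by
      exact_mod_cast Int.one_le_abs (sub_ne_zero.2 hab)
    nlinarith
  by_cases h2 : (k i).1 = (j i).1
  · have h3 : (k i).2 ≠ (j i).2 := fun h3 => hi (Prod.ext h2 h3)
    exact (h1 _ _ h3).trans (by simpa [latt] using Complex.abs_im_le_norm ((latt D k - latt D j) i))
  · exact (h1 _ _ h2).trans (by simpa [latt] using Complex.abs_re_le_norm ((latt D k - latt D j) i))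

theorem add_latt_mem_cell {D : ℝ} (hD : 0 < D) (k : Fin n → ℤ × ℤ) (z : Cn n) :
    z + latt D k ∈ cell D k ↔ z ∈ cell D 0 := by
  simp only [cell, Set.mem_preimage, Set.mem_singleton_iff, funext_iff, Prod.ext_iff]
  refine forall_congr' fun i => ?_
  simp [latt, add_div, hD.ne', mul_div_cancel_left₀]

theorem setLIntegral_cell {D : ℝ} (hD : 0 < D) (k : Fin n → ℤ × ℤ) (f : Cn n → ℝ≥0∞) :
    ∫⁻ z in cell D k, f z = ∫⁻ z in cell D 0, f (z + latt D k) := by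
  rw [← (measurePreserving_add_right volume (latt D k)).setLIntegral_comp_preimage_emb
    (measurableEmbedding_addRight _) f (cell D k)]
  congr 2
  ext z
  exact add_latt_mem_cell hD k z

theorem volume_cell {D : ℝ} (hD : 0 < D) (k : Fin n → ℤ × ℤ) :
    volume (cell D k) = volume (cell (n := n) D 0) := by
  simpa using setLIntegral_cell hD k 1

theorem volume_cell_ne_zero {D : ℝ} (hD : 0 < D) (k : Fin n → ℤ × ℤ) : volume (cell D k) ≠ 0 := by
  intro h0
  have h := lintegral_eq_tsum_cell D (volume : Measure (Cn n)) 1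
  simp only [Pi.one_apply, lintegral_const, one_mul, MeasurableSet.univ, Measure.restrict_apply,
    Set.univ_inter] at h
  simp_rw [fun j => volume_cell (n := n) hD j, ← volume_cell hD k, h0] at h
  simp only [tsum_zero, Measure.measure_univ_eq_zero] at h
  exact NeZero.ne (volume : Measure (Cn n)) h

theorem cell_subset_closedBall {D : ℝ} (hD : 0 < D) (k : Fin n → ℤ × ℤ) :
    cell D k ⊆ Metric.closedBall (latt D k) (2 * n * D) := fun _ hz =>
  mem_closedBall_iff_norm.2 (norm_sub_latt_le hD hz)

theorem volume_cell_ne_top {D : ℝ} (hD : 0 < D) (k : Fin n → ℤ × ℤ) : volume (cell D k) ≠ ∞ :=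
  ((measure_mono (cell_subset_closedBall hD k)).trans_lt
    (isCompact_closedBall _ _).measure_lt_top).ne

/-- On a cell the kernel varies by a bounded factor, so the sum is comparable to the integral
divided by the volume of a cell. -/
theorem exists_tsum_expKer_le (n : ℕ) {D γ : ℝ} (hD : 0 < D) (hγ : 0 < γ) :
    ∃ C : ℝ≥0, ∀ z : Cn n, ∑' k, expKer γ z (latt D k) ≤ C := by
  obtain ⟨C, hC⟩ := exists_lintegral_expKer_le n hγ
  set V := volume (cell (n := n) D 0) with hV
  have hV0 : V ≠ 0 := volume_cell_ne_zero hD 0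
  have hVt : V ≠ ∞ := volume_cell_ne_top hD 0
  set E := ENNReal.ofReal (Real.exp (γ * (2 * n * D)))
  have hfin : V⁻¹ * (E * C) ≠ ∞ := by finiteness
  refine ⟨(V⁻¹ * (E * C)).toNNReal, fun z => ?_⟩
  rw [ENNReal.coe_toNNReal hfin, ← ENNReal.div_eq_inv_mul,
    ENNReal.le_div_iff_mul_le (Or.inl hV0) (Or.inl hVt), ← ENNReal.tsum_mul_right]
  calc ∑' k, expKer γ z (latt D k) * V = ∑' k, ∫⁻ _ in cell D k, expKer γ z (latt D k) := by
        refine tsum_congr fun k => ?_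
        rw [setLIntegral_const, volume_cell hD]
    _ ≤ ∑' k, ∫⁻ u in cell D k, E * expKer γ z u := by
        refine ENNReal.tsum_le_tsum fun k => ?_
        refine setLIntegral_mono' (measurableSet_cell D k) fun u hu => ?_
        refine expKer_shift hγ.le z ?_
        rw [norm_sub_rev]
        exact norm_sub_latt_le hD hu
    _ = ∫⁻ u, E * expKer γ z u := (lintegral_eq_tsum_cell D _ _).symm
    _ ≤ E * C := by
        rw [lintegral_const_mul' _ _ ENNReal.ofReal_ne_top]
        gcongr
        exact hC z

/-- Powers of sums against the exponential kernel over a shifted lattice. -/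
theorem exists_tsum_expKer_mul_rpow_le (n : ℕ) {D γ s : ℝ} (hD : 0 < D) (hγ : 0 < γ) (hs : 0 < s) :
    ∃ C : ℝ≥0, ∀ (b z : Cn n) (x : (Fin n → ℤ × ℤ) → ℝ≥0∞),
      (∑' k, expKer γ z (b + latt D k) * x k) ^ s ≤
        C * ∑' k, expKer (γ * min 1 s) z (b + latt D k) * x k ^ s := by
  obtain ⟨C, hC⟩ := exists_tsum_expKer_le n hD hγ
  have hC' : ∀ b z : Cn n, ∑' k, expKer γ z (b + latt D k) ≤ C := fun b z => by
    refine le_trans (le_of_eq ?_) (hC (z - b))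
    simp [expKer, sub_sub]
  rcases le_total 1 s with h1 | h1
  · refine ⟨C ^ (s - 1), fun b z x => ?_⟩
    rw [min_eq_left h1, mul_one, ENNReal.coe_rpow_of_nonneg _ (by linarith)]
    refine (tsum_mul_rpow_le _ _ h1).trans ?_
    have : 0 ≤ s - 1 := by linarith
    gcongr
    exact hC' b z
  -- For s ≤ 1 subadditivity raises the kernel itself to the power s. This is the loss `min 1 s` in
  -- the rate.
  · refine ⟨1, fun b z x => ?_⟩
    rw [min_eq_right h1, ENNReal.coe_one, one_mul]
    refine (tsum_rpow_le_tsum_rpow _ hs h1).trans (le_of_eq ?_)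
    refine tsum_congr fun k => ?_
    rw [ENNReal.mul_rpow_of_nonneg _ _ hs.le, expKer_rpow _ hs.le]

/-- A side length for which cells are small compared to unit balls. -/
def meshSize (n : ℕ) : ℝ := 1 / (4 * (n + 1))

theorem meshSize_pos (n : ℕ) : 0 < meshSize n := by unfold meshSize; positivity

theorem two_mul_meshSize_lt (n : ℕ) : 2 * n * meshSize n < 1 / 2 := by
  unfold meshSize
  rw [mul_one_div, div_lt_div_iff₀ (by positivity) (by positivity)]
  linarith

theorem norm_sub_latt_lt {k : Fin n → ℤ × ℤ} {z : Cn n} (hz : z ∈ cell (meshSize n) k) :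
    ‖z - latt (meshSize n) k‖ < 1 / 2 :=
  (norm_sub_latt_le (meshSize_pos n) hz).trans_lt (two_mul_meshSize_lt n)

theorem cell_subset_ball_latt (k : Fin n → ℤ × ℤ) :
    cell (meshSize n) k ⊆ Metric.ball (latt (meshSize n) k) 1 := fun _ hz =>
  mem_ball_iff_norm.2 ((norm_sub_latt_lt hz).trans (by norm_num))

theorem cell_subset_ball {k : Fin n → ℤ × ℤ} {z : Cn n} (hz : z ∈ cell (meshSize n) k) :
    cell (meshSize n) k ⊆ Metric.ball z 1 := fun u hu => by
  rw [mem_ball_iff_norm]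
  have e : u - z = (u - latt (meshSize n) k) - (z - latt (meshSize n) k) := by abel
  rw [e]
  refine (norm_sub_le _ _).trans_lt ?_
  linarith [norm_sub_latt_lt hu, norm_sub_latt_lt hz]

namespace IsFockRegular

variable {W : Measure (Cn n)}

/-- The kernel form of the growth condition, together with the bounds for sums and integrals of
exponential kernels against `W` which follow from it. -/
theorem exists_growth (hW : IsFockRegular W) : ∃ γ : ℝ, 0 < γ ∧ ∃ C : ℝ≥0, 0 < C ∧
    (∀ u v, expKer γ u v * W (Metric.ball u 1) ≤ C * W (Metric.ball v 1)) ∧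
    (∀ u, ∫⁻ z, expKer γ z u ∂W ≤ C * W (Metric.ball u 1)) := by
  obtain ⟨C, A, hA, hg⟩ := hW.growth
  obtain ⟨S, hS⟩ := exists_tsum_expKer_le n (meshSize_pos n) one_pos
  have h1 : ∀ u v, expKer A u v * W (Metric.ball u 1) ≤ C * W (Metric.ball v 1) := by
    intro u v
    calc _ ≤ expKer A u v * (C * ENNReal.ofReal (Real.exp (A * ‖u - v‖)) * W (Metric.ball v 1)) := by
          gcongr; exact hg u v
      _ = (expKer A u v * ENNReal.ofReal (Real.exp (A * ‖u - v‖))) * (C * W (Metric.ball v 1)) := by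
          ring
      _ = _ := by
          rw [expKer, ← ENNReal.ofReal_mul (Real.exp_pos _).le, ← Real.exp_add]
          simp
  set E := (Real.exp ((A + 1) * (2 * n * meshSize n))).toNNReal
  -- Of the rate A + 1, the part A absorbs the growth of W and the remaining 1 makes the lattice sum
  -- converge.
  refine ⟨A + 1, by positivity, C + E * C * S + 1, by positivity, fun u v => ?_, fun u => ?_⟩
  · calc _ ≤ expKer A u v * W (Metric.ball u 1) := by gcongr; exact expKer_anti (by linarith) _ _
      _ ≤ C * W (Metric.ball v 1) := h1 u v
      _ ≤ _ := by
        gcongr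
        rw [add_assoc]
        exact le_self_add
  · calc ∫⁻ z, expKer (A + 1) z u ∂W
        = ∑' k, ∫⁻ z in cell (meshSize n) k, expKer (A + 1) z u ∂W :=
          lintegral_eq_tsum_cell _ _ _
      _ ≤ ∑' k, ∫⁻ _ in cell (meshSize n) k, E * expKer (A + 1) u (latt (meshSize n) k) ∂W := by
          refine ENNReal.tsum_le_tsum fun k => ?_
          refine setLIntegral_mono' (measurableSet_cell _ k) fun z hz => ?_
          rw [expKer_comm]
          exact expKer_shift (by positivity) u (norm_sub_latt_le (meshSize_pos n) hz)
      _ ≤ ∑' k, E * (expKer 1 u (latt (meshSize n) k) * (C * W (Metric.ball u 1))) := by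
          refine ENNReal.tsum_le_tsum fun k => ?_
          rw [setLIntegral_const, mul_assoc, add_comm, expKer_add, mul_assoc]
          refine mul_le_mul' le_rfl (mul_le_mul' le_rfl ?_)
          rw [expKer_comm]
          refine le_trans ?_ (h1 (latt (meshSize n) k) u)
          gcongr
          exact cell_subset_ball_latt k
      _ = (∑' k, expKer 1 u (latt (meshSize n) k)) * (E * C * W (Metric.ball u 1)) := by
          rw [← ENNReal.tsum_mul_right]
          refine tsum_congr fun k => ?_
          ring
      _ ≤ S * (E * C * W (Metric.ball u 1)) := by gcongr; exact hS u
      _ = (E * C * S) * W (Metric.ball u 1) := by ring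
      _ ≤ _ := by
        gcongr
        push_cast
        rw [add_comm (C : ℝ≥0∞), add_assoc]
        exact le_self_add

end IsFockRegular

/-! ### Upper bounds for the operator -/

theorem berezinOp_eq {t : ℝ} (ht : 0 < t) (α β : ℝ) (μ : Measure (Cn n)) (f : Cn n → ℂ) (z : Cn n) :
    berezinOp t α β μ f z =
      (∫⁻ u, ENNReal.ofReal (Real.exp (-(β / 2) * ‖z - u‖ ^ 2)) * fockAbs α f u ^ t ∂μ) ^ (1 / t) := by
  unfold berezinOp
  congr 1
  refine lintegral_congr fun u => ?_
  rw [fockAbs_rpow ht.le, ← ENNReal.ofReal_mul (Real.exp_pos _).le]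
  congr 1
  ring_nf

theorem eLpNorm_ennreal {X : Type*} [MeasurableSpace X] {q : ℝ} (hq : 0 < q) (ν : Measure X)
    (g : X → ℝ≥0∞) : eLpNorm g (ENNReal.ofReal q) ν = (∫⁻ z, g z ^ q ∂ν) ^ (1 / q) := by
  rw [eLpNorm_eq_lintegral_rpow_enorm_toReal (by simpa using hq) ENNReal.ofReal_ne_top,
    ENNReal.toReal_ofReal hq.le]
  rfl

theorem berezinNorm_eq {q : ℝ} (hq : 0 < q) (t α β : ℝ) (w : Cn n → ℝ) (μ : Measure (Cn n))
    (f : Cn n → ℂ) : berezinNorm q t α β w μ f =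
      (∫⁻ z, berezinOp t α β μ f z ^ q ∂weightMeasure w) ^ (1 / q) :=
  eLpNorm_ennreal hq _ _

namespace IsFockRegular

variable {w : Cn n → ℝ}

/-- Unit balls around the points of a cell have comparable measure. -/
theorem exists_measure_latt_le {W : Measure (Cn n)} (hW : IsFockRegular W) :
    ∃ C : ℝ≥0, ∀ k, ∀ z ∈ cell (meshSize n) k,
      W (Metric.ball (latt (meshSize n) k) 1) ≤ C * W (Metric.ball z 1) := by
  obtain ⟨C, A, hA, hg⟩ := hW.growth
  refine ⟨C * (Real.exp A).toNNReal, fun k z hz => (hg _ z).trans ?_⟩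
  push_cast
  gcongr
  rw [← ENNReal.ofReal]
  refine ENNReal.ofReal_le_ofReal (Real.exp_le_exp.2 ?_)
  rw [norm_sub_rev]
  nlinarith [norm_sub_latt_lt hz]

/-- The discrete upper bound of the operator. -/
theorem exists_lintegral_berezinOp_le (hW : IsFockRegular (weightMeasure w)) {p q t α β : ℝ}
    (hp : 0 < p) (hq : 0 < q) (ht : 0 < t) (hα : 0 < α) (hβ : 0 < β) :
    ∃ C : ℝ≥0, ∀ (μ : Measure (Cn n)) (f : Cn n → ℂ), Differentiable ℂ f →
      ∫⁻ z, berezinOp t α β μ f z ^ q ∂weightMeasure w ≤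
        C * ∑' k, (∫⁻ u in Metric.ball (latt (meshSize n) k) 2,
            fockAbs α f u ^ p ∂weightMeasure w) ^ (q / p) *
          (μ (cell (meshSize n) k) ^ (1 / t) /
            weightMeasure w (Metric.ball (latt (meshSize n) k) 1) ^ (1 / p - 1 / q)) ^ q := by
  set W := weightMeasure w with hWdef
  set D := meshSize n
  have hqt : 0 < q / t := div_pos hq ht
  obtain ⟨γ₀, hγ₀, C₀, -, -, hint⟩ := hW.exists_growth
  obtain ⟨Cl, hCl⟩ := hW.exists_measure_latt_le
  obtain ⟨Cp, hCp⟩ := hW.pointwise α hα p hp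
  have hm : 0 < min 1 (q / t) := lt_min one_pos hqt
  -- Chosen so that the rate is still γ₀ after raising the sum to the power q/t; at that rate the
  -- kernel integrates against W to O(W(B_1)).
  set γ := γ₀ / min 1 (q / t)
  have hγ : 0 < γ := div_pos hγ₀ hm
  have hγm : γ * min 1 (q / t) = γ₀ := div_mul_cancel₀ _ hm.ne'
  obtain ⟨Cg, hCg⟩ := exists_gaussian_le (n := n) (half_pos hβ) γ
  obtain ⟨Cs, hCs⟩ := exists_tsum_expKer_mul_rpow_le n (meshSize_pos n) hγ hqt
  rw [hγm] at hCs
  set E := (Real.exp (γ * (2 * n * D))).toNNReal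
  set K := Cl * Cp
  refine ⟨(Cg * E) ^ (q / t) * Cs * C₀ * K ^ (q / p), fun μ f hf => ?_⟩
  set Wk : (Fin n → ℤ × ℤ) → ℝ≥0∞ := fun k => W (Metric.ball (latt D k) 1)
  have hWk0 : ∀ k, Wk k ≠ 0 := fun k => (hW.measure_ball_pos _).ne'
  have hWkt : ∀ k, Wk k ≠ ∞ := fun k => (hW.measure_ball_lt_top _).ne
  set N : (Fin n → ℤ × ℤ) → ℝ≥0∞ := fun k =>
    ∫⁻ u in Metric.ball (latt D k) 2, fockAbs α f u ^ p ∂W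
  set M : (Fin n → ℤ × ℤ) → ℝ≥0∞ := fun k => (K * N k / Wk k) ^ (1 / p)
  -- The pointwise estimate on unit balls centred in the cell; all of these lie in the ball of
  -- radius 2 around the lattice point.
  have hM : ∀ k, ∀ u ∈ cell D k, fockAbs α f u ≤ M k := by
    intro k u hu
    rw [show M k = (K * N k / Wk k) ^ (1 / p) from rfl, one_div, ENNReal.le_rpow_inv_iff hp,
      ENNReal.le_div_iff_mul_le (Or.inl (hWk0 k)) (Or.inl (hWkt k))]
    calc fockAbs α f u ^ p * Wk k ≤ fockAbs α f u ^ p * (Cl * W (Metric.ball u 1)) := by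
          gcongr; exact hCl k u hu
      _ = Cl * (fockAbs α f u ^ p * W (Metric.ball u 1)) := by ring
      _ ≤ Cl * (Cp * ∫⁻ u in Metric.ball u 1, fockAbs α f u ^ p ∂W) := by
          exact mul_le_mul' le_rfl (hCp f hf u)
      _ ≤ Cl * (Cp * N k) := by
          gcongr
          refine lintegral_mono_set (Metric.ball_subset_ball' ?_)
          rw [dist_eq_norm]
          linarith [norm_sub_latt_lt hu]
      _ = _ := by simp only [K]; push_cast; ring
  clear_value K
  set x : (Fin n → ℤ × ℤ) → ℝ≥0∞ := fun k => M k ^ t * μ (cell D k)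
  have hT : ∀ z, berezinOp t α β μ f z ^ q ≤
      ((Cg * E) ^ (q / t) * Cs : ℝ≥0) * ∑' k, expKer γ₀ z (latt D k) * x k ^ (q / t) := by
    intro z
    have h1 : ∫⁻ u, ENNReal.ofReal (Real.exp (-(β / 2) * ‖z - u‖ ^ 2)) * fockAbs α f u ^ t ∂μ ≤
        (Cg * E : ℝ≥0) * ∑' k, expKer γ z (latt D k) * x k := by
      rw [lintegral_eq_tsum_cell D, ← ENNReal.tsum_mul_left]
      refine ENNReal.tsum_le_tsum fun k => ?_
      calc _ ≤ ∫⁻ _ in cell D k, Cg * (E * expKer γ z (latt D k)) * M k ^ t ∂μ := by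
            refine setLIntegral_mono' (measurableSet_cell D k) fun u hu => ?_
            gcongr
            · refine (hCg z u).trans ?_
              gcongr
              exact expKer_shift hγ.le z (norm_sub_latt_le (meshSize_pos n) hu)
            · exact hM k u hu
        _ = _ := by
            rw [setLIntegral_const]
            simp only [x]
            push_cast
            ring
    rw [berezinOp_eq ht, ← ENNReal.rpow_mul, one_div_mul_eq_div]
    calc _ ≤ ((Cg * E : ℝ≥0) * ∑' k, expKer γ z (latt D k) * x k) ^ (q / t) := by gcongr
      _ = (Cg * E : ℝ≥0) ^ (q / t) * (∑' k, expKer γ z (0 + latt D k) * x k) ^ (q / t) := by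
          rw [ENNReal.mul_rpow_of_nonneg _ _ hqt.le]; simp only [zero_add]
      _ ≤ (Cg * E : ℝ≥0) ^ (q / t) * (Cs * ∑' k, expKer γ₀ z (0 + latt D k) * x k ^ (q / t)) := by
          gcongr
          exact hCs 0 z x
      _ = _ := by
          rw [ENNReal.coe_mul ((Cg * E) ^ (q / t)), ENNReal.coe_rpow_of_nonneg _ hqt.le]
          simp only [zero_add, mul_assoc]
  calc _ ≤ ∫⁻ z, ((Cg * E) ^ (q / t) * Cs : ℝ≥0) *
        ∑' k, expKer γ₀ z (latt D k) * x k ^ (q / t) ∂W := lintegral_mono hT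
    _ = ((Cg * E) ^ (q / t) * Cs : ℝ≥0) *
        ∑' k, (∫⁻ z, expKer γ₀ z (latt D k) ∂W) * x k ^ (q / t) := by
        rw [lintegral_const_mul' _ _ ENNReal.coe_ne_top, lintegral_tsum]
        · congr 1
          refine tsum_congr fun k => ?_
          rw [lintegral_mul_const _ (measurable_expKer_left _ _)]
        · exact fun k => ((measurable_expKer_left _ _).mul_const _).aemeasurable
    _ ≤ ((Cg * E) ^ (q / t) * Cs : ℝ≥0) * ∑' k, (C₀ * Wk k) * x k ^ (q / t) := by
        gcongr with k
        exact hint _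
    _ = ((Cg * E) ^ (q / t) * Cs : ℝ≥0) * ∑' k, (C₀ * K ^ (q / p) : ℝ≥0) * (N k ^ (q / p) *
          (μ (cell D k) ^ (1 / t) / Wk k ^ (1 / p - 1 / q)) ^ q) := by
        congr 1
        refine tsum_congr fun k => ?_
        have hqp : 0 < q / p := div_pos hq hp
        have e1 : x k ^ (q / t) = (K : ℝ≥0∞) ^ (q / p) * N k ^ (q / p) * Wk k ^ (-(q / p)) *
            μ (cell D k) ^ (q / t) := by
          simp only [x, M]
          rw [ENNReal.mul_rpow_of_nonneg _ _ hqt.le, ← ENNReal.rpow_mul, ← ENNReal.rpow_mul,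
            show 1 / p * (t * (q / t)) = q / p by field_simp, div_eq_mul_inv,
            ENNReal.mul_rpow_of_nonneg _ _ hqp.le, ENNReal.mul_rpow_of_nonneg _ _ hqp.le,
            ENNReal.inv_rpow, ENNReal.rpow_neg]
        -- The factor W_k from integrating the kernel and W_k^{-q/p} from the pointwise estimate
        -- combine to the power -(1/p - 1/q)q.
        have e2 : (μ (cell D k) ^ (1 / t) / Wk k ^ (1 / p - 1 / q)) ^ q =
            μ (cell D k) ^ (q / t) * (Wk k * Wk k ^ (-(q / p))) := by
          rw [div_eq_mul_inv, ENNReal.mul_rpow_of_nonneg _ _ hq.le, ← ENNReal.rpow_mul,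
            one_div_mul_eq_div, ← ENNReal.rpow_neg, ← ENNReal.rpow_mul]
          congr 1
          nth_rewrite 2 [← ENNReal.rpow_one (Wk k)]
          rw [← ENNReal.rpow_add _ _ (hWk0 k) (hWkt k)]
          congr 1
          field_simp
          ring
        rw [e1, e2, ENNReal.coe_mul, ENNReal.coe_rpow_of_nonneg _ hqp.le]
        ring
    _ = _ := by
        rw [ENNReal.tsum_mul_left, ← mul_assoc, ← ENNReal.coe_mul]
        congr 2
        ring

/-- The balls of radius 2 around the lattice points have bounded overlap. -/
theorem exists_tsum_lintegral_ball_le (n : ℕ) : ∃ C : ℝ≥0, ∀ (W : Measure (Cn n))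
    (g : Cn n → ℝ≥0∞), Measurable g →
      ∑' k, ∫⁻ u in Metric.ball (latt (meshSize n) k) 2, g u ∂W ≤ C * ∫⁻ u, g u ∂W := by
  obtain ⟨S, hS⟩ := exists_tsum_expKer_le n (meshSize_pos n) one_pos
  -- The indicator of a ball of radius 2 is at most e² e^{-|u-a|}, and these kernels have bounded
  -- sum over the lattice.
  set E := (Real.exp 2).toNNReal
  refine ⟨E * S, fun W g hg => ?_⟩
  calc _ ≤ ∑' k, ∫⁻ u, (E * expKer 1 u (latt (meshSize n) k)) * g u ∂W := by
        refine ENNReal.tsum_le_tsum fun k => ?_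
        rw [← lintegral_indicator measurableSet_ball]
        refine lintegral_mono fun u => ?_
        by_cases hu : u ∈ Metric.ball (latt (meshSize n) k) 2
        · rw [Set.indicator_of_mem hu]
          have : 1 ≤ E * expKer 1 u (latt (meshSize n) k) := by
            rw [expKer, ← ENNReal.ofReal, ← ENNReal.ofReal_mul (Real.exp_pos _).le, ← Real.exp_add,
              ENNReal.one_le_ofReal]
            refine Real.one_le_exp ?_
            linarith [mem_ball_iff_norm.1 hu]
          calc g u = 1 * g u := (one_mul _).symm
            _ ≤ _ := by gcongr
        · simp [Set.indicator_of_notMem hu]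
    _ = ∫⁻ u, ∑' k, (E * expKer 1 u (latt (meshSize n) k)) * g u ∂W := by
        rw [lintegral_tsum]
        exact fun k => (((measurable_expKer_left _ _).const_mul _).mul hg).aemeasurable
    _ ≤ ∫⁻ u, (E * S : ℝ≥0) * g u ∂W := by
        refine lintegral_mono fun u => ?_
        rw [ENNReal.tsum_mul_right, ENNReal.tsum_mul_left]
        push_cast
        gcongr
        exact hS u
    _ = _ := lintegral_const_mul' _ _ ENNReal.coe_ne_top

/-- In the discrete bound every factor containing μ is at most sup G. What remains is Σ N_k^{q/p} ≤
(Σ N_k)^{q/p}, valid as q/p ≥ 1, and bounded overlap. -/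
theorem exists_berezinNorm_le_iSup (hW : IsFockRegular (weightMeasure w)) {p q t α β : ℝ}
    (hp : 0 < p) (hpq : p ≤ q) (ht : 0 < t) (hα : 0 < α) (hβ : 0 < β) :
    ∃ C : ℝ≥0, 0 < C ∧ ∀ (μ : Measure (Cn n)) (f : Cn n → ℂ), Differentiable ℂ f →
      berezinNorm q t α β w μ f ≤ C * (⨆ z, Gfun p q t w μ z) * fockNorm p α w f := by
  have hq : 0 < q := hp.trans_le hpq
  have hqp : 0 < q / p := div_pos hq hp
  obtain ⟨C, hC⟩ := hW.exists_lintegral_berezinOp_le hp hq ht hα hβ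
  obtain ⟨K, hK⟩ := exists_tsum_lintegral_ball_le n
  -- The summand 1 only makes the constant positive.
  refine ⟨(C * K ^ (q / p)) ^ (1 / q) + 1, by positivity, fun μ f hf => ?_⟩
  have hm : Measurable (fockAbs α f) := (continuous_fockAbs hf.continuous).measurable
  rw [berezinNorm_eq hq, fockNorm_eq hp]
  set X := ∫⁻ z, fockAbs α f z ^ p ∂weightMeasure w
  set G := ⨆ z, Gfun p q t w μ z
  calc _ ≤ (C * ∑' k, (∫⁻ u in Metric.ball (latt (meshSize n) k) 2,
            fockAbs α f u ^ p ∂weightMeasure w) ^ (q / p) * G ^ q) ^ (1 / q) := by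
        gcongr
        refine (hC μ f hf).trans ?_
        gcongr with k
        refine le_trans ?_ (le_iSup _ (latt (meshSize n) k))
        unfold Gfun
        gcongr
        exact cell_subset_ball_latt k
    _ ≤ (C * ((K * X) ^ (q / p) * G ^ q)) ^ (1 / q) := by
        rw [ENNReal.tsum_mul_right]
        gcongr
        refine (tsum_rpow_le_rpow_tsum _ ((one_le_div hp).2 hpq)).trans ?_
        gcongr
        exact hK _ _ (hm.pow_const p)
    _ = ((C * K ^ (q / p)) ^ (1 / q) : ℝ≥0) * G * X ^ (1 / p) := by
        have hq' : 0 ≤ 1 / q := by positivity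
        rw [ENNReal.coe_rpow_of_nonneg _ hq', ENNReal.coe_mul, ENNReal.coe_rpow_of_nonneg _ hqp.le]
        simp only [ENNReal.mul_rpow_of_nonneg _ _ hq', ENNReal.mul_rpow_of_nonneg _ _ hqp.le,
          ← ENNReal.rpow_mul, mul_one_div_cancel hq.ne', ENNReal.rpow_one]
        rw [show q / p * (1 / q) = 1 / p by field_simp]
        ring
    _ ≤ _ := by
        gcongr
        exact le_self_add

/-- Hölder for the discrete bound turns the factors G_k^q into Σ G_k^κ. Unit balls around points of
a cell contain the cell, so this sum is dominated cell by cell by the integral of G^κ. -/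
theorem exists_berezinNorm_le_eLpNorm (hW : IsFockRegular (weightMeasure w)) {p q t α β : ℝ}
    (hq : 0 < q) (hqp : q < p) (ht : 0 < t) (hα : 0 < α) (hβ : 0 < β) :
    ∃ C : ℝ≥0, 0 < C ∧ ∀ (μ : Measure (Cn n)) (f : Cn n → ℂ), Differentiable ℂ f →
      berezinNorm q t α β w μ f ≤
        C * eLpNorm (Gfun p q t w μ) (ENNReal.ofReal (p * q / (p - q))) volume *
          fockNorm p α w f := by
  have hp : 0 < p := hq.trans hqp
  have hpq : 0 < p - q := sub_pos.2 hqp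
  set κ := p * q / (p - q) with hκdef
  have hκ : 0 < κ := by positivity
  obtain ⟨C, hC⟩ := hW.exists_lintegral_berezinOp_le hp hq ht hα hβ
  obtain ⟨K, hK⟩ := exists_tsum_lintegral_ball_le n
  obtain ⟨Cl, hCl⟩ := hW.exists_measure_latt_le
  set V := volume (cell (n := n) (meshSize n) 0) with hV
  have hV0 : V ≠ 0 := volume_cell_ne_zero (meshSize_pos n) 0
  have hVt : V ≠ ∞ := volume_cell_ne_top (meshSize_pos n) 0
  -- For q < p the weight stands in the numerator of G, so an upper bound for W at the lattice point
  -- suffices.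
  have he : 0 ≤ -(1 / p - 1 / q) := by
    rw [neg_sub, sub_nonneg]
    exact one_div_le_one_div_of_le hq hqp.le
  set L : ℝ≥0 := (Cl ^ (-(1 / p - 1 / q))) ^ κ * V⁻¹.toNNReal with hL
  have hV' : (V⁻¹.toNNReal : ℝ≥0∞) = V⁻¹ := ENNReal.coe_toNNReal (ENNReal.inv_ne_top.2 hV0)
  refine ⟨(C * (K ^ (q / p) * L ^ (q / κ))) ^ (1 / q) + 1, by positivity, fun μ f hf => ?_⟩
  have hm : Measurable (fockAbs α f) := (continuous_fockAbs hf.continuous).measurable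
  rw [berezinNorm_eq hq, fockNorm_eq hp, eLpNorm_ennreal hκ]
  set X := ∫⁻ z, fockAbs α f z ^ p ∂weightMeasure w
  set Y := ∫⁻ z, Gfun p q t w μ z ^ κ
  set g : (Fin n → ℤ × ℤ) → ℝ≥0∞ := fun k => μ (cell (meshSize n) k) ^ (1 / t) /
    weightMeasure w (Metric.ball (latt (meshSize n) k) 1) ^ (1 / p - 1 / q)
  have hg : ∀ k, ∀ z ∈ cell (meshSize n) k,
      g k ≤ (Cl ^ (-(1 / p - 1 / q)) : ℝ≥0) * Gfun p q t w μ z := by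
    intro k z hz
    simp only [g, Gfun, div_eq_mul_inv _ (_ ^ (1 / p - 1 / q)), ← ENNReal.rpow_neg]
    calc _ ≤ μ (Metric.ball z 1) ^ (1 / t) *
          (Cl * weightMeasure w (Metric.ball z 1)) ^ (-(1 / p - 1 / q)) := by
          gcongr
          · exact cell_subset_ball hz
          · exact hCl k z hz
      _ = _ := by
          rw [ENNReal.mul_rpow_of_nonneg _ _ he, ENNReal.coe_rpow_of_nonneg _ he]
          ring
  have hsum : ∑' k, g k ^ κ ≤ L * Y := by
    have h1 : ∀ k, g k ^ κ ≤ L * ∫⁻ z in cell (meshSize n) k, Gfun p q t w μ z ^ κ := by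
      intro k
      rw [hL, ENNReal.coe_mul, hV', mul_comm (_ : ℝ≥0∞) V⁻¹, mul_assoc,
        ← ENNReal.div_eq_inv_mul, ENNReal.le_div_iff_mul_le (Or.inl hV0) (Or.inl hVt),
        hV, ← volume_cell (meshSize_pos n) k, ← setLIntegral_const,
        ← lintegral_const_mul' _ _ ENNReal.coe_ne_top]
      refine setLIntegral_mono' (measurableSet_cell _ k) fun z hz => ?_
      rw [ENNReal.coe_rpow_of_nonneg _ hκ.le, ← ENNReal.mul_rpow_of_nonneg _ _ hκ.le]
      gcongr
      exact hg k z hz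
    refine (ENNReal.tsum_le_tsum h1).trans (le_of_eq ?_)
    rw [ENNReal.tsum_mul_left, ← lintegral_eq_tsum_cell]
  clear_value L
  -- With these exponents N_k^{q/p} is raised back to N_k and g_k^q to g_k^κ, as q · p/(p-q) = κ.
  have hconj : (p / q).HolderConjugate (p / (p - q)) := by
    rw [Real.holderConjugate_iff]
    refine ⟨(one_lt_div hq).2 hqp, ?_⟩
    field_simp
    ring
  have hH := tsum_mul_le_rpow_mul_rpow (fun k => (∫⁻ u in Metric.ball (latt (meshSize n) k) 2,
    fockAbs α f u ^ p ∂weightMeasure w) ^ (q / p)) (fun k => g k ^ q) hconj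
  simp only [← ENNReal.rpow_mul] at hH
  rw [show q / p * (p / q) = 1 by field_simp, show q * (p / (p - q)) = κ by rw [hκdef]; ring,
    show 1 / (p / q) = q / p by field_simp, show 1 / (p / (p - q)) = q / κ by
      rw [hκdef]; field_simp] at hH
  simp only [ENNReal.rpow_one] at hH
  have hqp' : 0 ≤ q / p := by positivity
  have hqκ : 0 ≤ q / κ := by positivity
  have hq' : 0 ≤ 1 / q := by positivity
  calc _ ≤ (C * ((K * X) ^ (q / p) * (L * Y) ^ (q / κ))) ^ (1 / q) := by
        gcongr
        refine (hC μ f hf).trans ?_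
        gcongr
        refine hH.trans ?_
        gcongr
        exact hK _ _ (hm.pow_const p)
    _ = ((C * (K ^ (q / p) * L ^ (q / κ))) ^ (1 / q) : ℝ≥0) * Y ^ (1 / κ) * X ^ (1 / p) := by
        rw [ENNReal.coe_rpow_of_nonneg _ hq', ENNReal.coe_mul, ENNReal.coe_mul,
          ENNReal.coe_rpow_of_nonneg _ hqp', ENNReal.coe_rpow_of_nonneg _ hqκ]
        simp only [ENNReal.mul_rpow_of_nonneg _ _ hq', ENNReal.mul_rpow_of_nonneg _ _ hqp',
          ENNReal.mul_rpow_of_nonneg _ _ hqκ, ← ENNReal.rpow_mul]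
        rw [show q / p * (1 / q) = 1 / p by field_simp, show q / κ * (1 / q) = 1 / κ by field_simp]
        ring
    _ ≤ _ := by
        gcongr
        exact le_self_add

end IsFockRegular

/-! ### Homogeneity and the operator norm -/

theorem fockAbs_smul (α : ℝ) (c : ℂ) (f : Cn n → ℂ) (u : Cn n) :
    fockAbs α (c • f) u = ‖c‖ₑ * fockAbs α f u := by
  rw [fockAbs, fockAbs, ← ofReal_norm c, ← ENNReal.ofReal_mul (norm_nonneg _)]
  simp [mul_assoc]

theorem fockNorm_smul {p α : ℝ} (hp : 0 < p) (w : Cn n → ℝ) (c : ℂ) (f : Cn n → ℂ) :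
    fockNorm p α w (c • f) = ‖c‖ₑ * fockNorm p α w f := by
  rw [fockNorm_eq hp, fockNorm_eq hp]
  simp_rw [fockAbs_smul, ENNReal.mul_rpow_of_nonneg _ _ hp.le]
  rw [lintegral_const_mul' _ _ (ENNReal.rpow_ne_top_of_nonneg hp.le enorm_ne_top),
    ENNReal.mul_rpow_of_nonneg _ _ (by positivity : 0 ≤ 1 / p), ← ENNReal.rpow_mul,
    mul_one_div_cancel hp.ne', ENNReal.rpow_one]

theorem berezinOp_smul {t : ℝ} (ht : 0 < t) (α β : ℝ) (μ : Measure (Cn n)) (c : ℂ) (f : Cn n → ℂ)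
    (z : Cn n) : berezinOp t α β μ (c • f) z = ‖c‖ₑ * berezinOp t α β μ f z := by
  rw [berezinOp_eq ht, berezinOp_eq ht]
  simp_rw [fockAbs_smul, ENNReal.mul_rpow_of_nonneg _ _ ht.le, mul_left_comm _ (‖c‖ₑ ^ t)]
  rw [lintegral_const_mul' _ _ (ENNReal.rpow_ne_top_of_nonneg ht.le enorm_ne_top),
    ENNReal.mul_rpow_of_nonneg _ _ (by positivity : 0 ≤ 1 / t), ← ENNReal.rpow_mul,
    mul_one_div_cancel ht.ne', ENNReal.rpow_one]

theorem berezinNorm_smul {q t : ℝ} (hq : 0 < q) (ht : 0 < t) (α β : ℝ) (w : Cn n → ℝ)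
    (μ : Measure (Cn n)) (c : ℂ) (f : Cn n → ℂ) :
    berezinNorm q t α β w μ (c • f) = ‖c‖ₑ * berezinNorm q t α β w μ f := by
  rw [berezinNorm_eq hq, berezinNorm_eq hq]
  simp_rw [berezinOp_smul ht, ENNReal.mul_rpow_of_nonneg _ _ hq.le]
  rw [lintegral_const_mul' _ _ (ENNReal.rpow_ne_top_of_nonneg hq.le enorm_ne_top),
    ENNReal.mul_rpow_of_nonneg _ _ (by positivity : 0 ≤ 1 / q), ← ENNReal.rpow_mul,
    mul_one_div_cancel hq.ne', ENNReal.rpow_one]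

theorem berezinNorm_zero {q t : ℝ} (hq : 0 < q) (ht : 0 < t) (α β : ℝ) (w : Cn n → ℝ)
    (μ : Measure (Cn n)) : berezinNorm q t α β w μ 0 = 0 := by
  have := berezinNorm_smul hq ht α β w μ 0 0
  simpa using this

theorem smul_mem_fockSpace {p α : ℝ} (hp : 0 < p) {w : Cn n → ℝ} {f : Cn n → ℂ}
    (hf : f ∈ fockSpace p α w) (c : ℂ) : c • f ∈ fockSpace p α w := by
  refine ⟨hf.1.const_smul c, ?_⟩
  rw [fockNorm_smul hp]
  exact ENNReal.mul_lt_top enorm_lt_top hf.2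

theorem measurable_fockAbs {α : ℝ} {f : Cn n → ℂ} (hf : Differentiable ℂ f) :
    Measurable (fockAbs α f) := (continuous_fockAbs hf.continuous).measurable

namespace IsFockRegular

variable {w : Cn n → ℝ}

/-- Vanishing W-almost everywhere implies vanishing dv-almost everywhere, hence everywhere by
continuity. This allows division by the norm. -/
theorem eq_zero_of_fockNorm_eq_zero (hW : IsFockRegular (weightMeasure w)) {p α : ℝ} (hp : 0 < p)
    {f : Cn n → ℂ} (hf : Differentiable ℂ f) (h : fockNorm p α w f = 0) : f = 0 := by
  rw [fockNorm_eq hp, ENNReal.rpow_eq_zero_iff_of_pos (by positivity),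
    lintegral_eq_zero_iff ((measurable_fockAbs hf).pow_const p)] at h
  have h2 : f =ᵐ[volume] 0 := by
    filter_upwards [hW.absolutelyContinuous.ae_le h] with z hz
    have h3 : fockAbs α f z = 0 := by simpa [hp, hp.not_gt] using hz
    rw [fockAbs, ENNReal.ofReal_eq_zero] at h3
    have h4 : ‖f z‖ ≤ 0 := nonpos_of_mul_nonpos_left h3 (Real.exp_pos _)
    simpa using h4
  exact (Continuous.ae_eq_iff_eq volume hf.continuous continuous_const).1 h2

theorem berezinNorm_le_opNorm_mul (hW : IsFockRegular (weightMeasure w)) {p q t α β : ℝ}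
    (hp : 0 < p) (hq : 0 < q) (ht : 0 < t) (μ : Measure (Cn n)) {f : Cn n → ℂ}
    (hf : f ∈ fockSpace p α w) :
    berezinNorm q t α β w μ f ≤ berezinOpNorm p q t α β w μ * fockNorm p α w f := by
  -- A separate case, because the right side is 0 here even when the operator norm is infinite.
  by_cases h0 : fockNorm p α w f = 0
  · rw [hW.eq_zero_of_fockNorm_eq_zero hp hf.1 h0, berezinNorm_zero hq ht]
    exact zero_le
  set N := fockNorm p α w f
  have hNt : N ≠ ∞ := hf.2.ne
  set c : ℂ := ((N.toReal⁻¹ : ℝ) : ℂ)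
  have hc : ‖c‖ₑ = N⁻¹ := by
    rw [← ofReal_norm, Complex.norm_real, Real.norm_of_nonneg (by positivity),
      ← ENNReal.toReal_inv, ENNReal.ofReal_toReal (ENNReal.inv_ne_top.2 h0)]
  have h1 : berezinNorm q t α β w μ (c • f) ≤ berezinOpNorm p q t α β w μ := by
    refine le_iSup₂_of_le (c • f) ⟨smul_mem_fockSpace hp hf c, ?_⟩ le_rfl
    rw [fockNorm_smul hp, hc, ENNReal.inv_mul_cancel h0 hNt]
  rw [berezinNorm_smul hq ht, hc, ← ENNReal.div_eq_inv_mul,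
    ENNReal.div_le_iff_le_mul (Or.inl h0) (Or.inl hNt)] at h1
  exact h1

theorem berezinBounded_iff (hW : IsFockRegular (weightMeasure w)) {p q t α β : ℝ}
    (hp : 0 < p) (hq : 0 < q) (ht : 0 < t) (μ : Measure (Cn n)) :
    BerezinBounded p q t α β w μ ↔ berezinOpNorm p q t α β w μ ≠ ∞ := by
  constructor
  · rintro ⟨C, -, h⟩
    refine ((iSup₂_le fun f hf => ?_ : _ ≤ (C : ℝ≥0∞)).trans_lt ENNReal.coe_lt_top).ne
    exact (h f hf.1).trans ((mul_le_mul' le_rfl hf.2).trans (mul_one _).le)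
  · intro h
    refine ⟨(berezinOpNorm p q t α β w μ).toNNReal + 1, by positivity, fun f hf => ?_⟩
    refine (hW.berezinNorm_le_opNorm_mul hp hq ht μ hf).trans ?_
    gcongr
    rw [ENNReal.coe_add, ENNReal.coe_toNNReal h]
    exact le_self_add

end IsFockRegular

/-! ### Test functions -/

/-- The normalized reproducing kernel of the classical Fock space. -/
def fockKer (α : ℝ) (a u : Cn n) : ℂ :=
  Complex.exp (α * innerSL ℂ a u - ((α / 2 * ‖a‖ ^ 2 : ℝ) : ℂ))

theorem differentiable_fockKer (α : ℝ) (a : Cn n) : Differentiable ℂ (fockKer α a) :=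
  Complex.differentiable_exp.comp
    (((innerSL ℂ a).differentiable.const_mul _).sub (differentiable_const _))

/-- Completing the square: the weighted modulus of a normalized kernel is a Gaussian bump at its
centre. -/
theorem norm_fockKer (α : ℝ) (a u : Cn n) : ‖fockKer α a u‖ * Real.exp (-(α / 2) * ‖u‖ ^ 2) =
    Real.exp (-(α / 2) * ‖u - a‖ ^ 2) := by
  rw [fockKer, Complex.norm_exp, ← Real.exp_add, @norm_sub_sq ℂ]
  congr 1
  have : ((α : ℂ) * innerSL ℂ a u).re = α * RCLike.re (inner ℂ u a) := by
    rw [inner_re_symm]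
    simp
  rw [Complex.sub_re, this, Complex.ofReal_re]
  ring

/-- A finite combination of normalized kernels centred at points of a shifted lattice. -/
def latticeSum (α D : ℝ) (b : Cn n) (F : Finset (Fin n → ℤ × ℤ)) (c : (Fin n → ℤ × ℤ) → ℝ≥0)
    (u : Cn n) : ℂ := ∑ k ∈ F, (((c k : ℝ) : ℂ) * fockKer α (b + latt D k) u)

theorem differentiable_latticeSum (α D : ℝ) (b : Cn n) (F : Finset (Fin n → ℤ × ℤ))
    (c : (Fin n → ℤ × ℤ) → ℝ≥0) : Differentiable ℂ (latticeSum α D b F c) := by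
  unfold latticeSum
  exact Differentiable.fun_sum fun k _ => (differentiable_fockKer α _).const_mul _

theorem fockAbs_sum_le {ι : Type*} (α : ℝ) (F : Finset ι) (f : ι → Cn n → ℂ) (u : Cn n) :
    fockAbs α (fun u => ∑ k ∈ F, f k u) u ≤ ∑ k ∈ F, fockAbs α (f k) u := by
  simp only [fockAbs]
  rw [← ENNReal.ofReal_sum_of_nonneg fun k _ => by positivity, ← Finset.sum_mul]
  refine ENNReal.ofReal_le_ofReal ?_
  gcongr
  exact norm_sum_le _ _

theorem fockAbs_coe_mul_fockKer (α : ℝ) (c : ℝ≥0) (a u : Cn n) :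
    fockAbs α (fun u => ((c : ℝ) : ℂ) * fockKer α a u) u =
      c * ENNReal.ofReal (Real.exp (-(α / 2) * ‖u - a‖ ^ 2)) := by
  rw [fockAbs, ← norm_fockKer, ← ENNReal.ofReal_coe_nnreal, ← ENNReal.ofReal_mul c.coe_nonneg]
  simp [mul_assoc]

theorem exists_fockAbs_latticeSum_le {α : ℝ} (hα : 0 < α) (γ : ℝ) : ∃ C : ℝ≥0,
    ∀ (D : ℝ) (b : Cn n) (F : Finset (Fin n → ℤ × ℤ)) (c : (Fin n → ℤ × ℤ) → ℝ≥0) (u : Cn n),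
      fockAbs α (latticeSum α D b F c) u ≤ C * ∑ k ∈ F, expKer γ u (b + latt D k) * c k := by
  obtain ⟨C, hC⟩ := exists_gaussian_le (n := n) (half_pos hα) γ
  refine ⟨C, fun D b F c u => (fockAbs_sum_le α F _ u).trans ?_⟩
  rw [Finset.mul_sum]
  refine Finset.sum_le_sum fun k _ => ?_
  rw [fockAbs_coe_mul_fockKer]
  calc _ ≤ c k * (C * expKer γ u (b + latt D k)) := by gcongr; exact hC _ _
    _ = _ := by ring

/-- Lets the estimates for full lattice sums be applied to finite combinations, by extending the
coefficients by zero. -/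
theorem sum_rpow_eq_tsum {ι : Type*} {s : ℝ} (hs : 0 < s) (F : Finset ι) (c : ι → ℝ≥0∞)
    (a : ι → ℝ≥0∞) : ∑ k ∈ F, a k * c k ^ s =
      ∑' k, a k * (F : Set ι).indicator c k ^ s := by
  rw [tsum_eq_sum (s := F)]
  · exact Finset.sum_congr rfl fun k hk => by simp [hk]
  · intro k hk
    simp [hk, hs]

namespace IsFockRegular

variable {w : Cn n → ℝ}

/-- The bumps are dominated by exponential kernels, and the p-th power of their sum by a sum of
kernels of rate γ₀; each integrates to O(W(B_1)) at its centre. Uniformity in the shift b is needed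
for the later averaging over shifts. -/
theorem exists_lintegral_latticeSum_le (hW : IsFockRegular (weightMeasure w)) {p α : ℝ}
    (hp : 0 < p) (hα : 0 < α) {D : ℝ} (hD : 0 < D) : ∃ C : ℝ≥0,
      ∀ (b : Cn n) (F : Finset (Fin n → ℤ × ℤ)) (c : (Fin n → ℤ × ℤ) → ℝ≥0),
        ∫⁻ u, fockAbs α (latticeSum α D b F c) u ^ p ∂weightMeasure w ≤
          C * ∑ k ∈ F, weightMeasure w (Metric.ball (b + latt D k) 1) * (c k : ℝ≥0∞) ^ p := by
  obtain ⟨γ₀, hγ₀, C₀, -, -, hint⟩ := hW.exists_growth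
  have hm : 0 < min 1 p := lt_min one_pos hp
  obtain ⟨Cg, hCg⟩ := exists_fockAbs_latticeSum_le (n := n) hα (γ₀ / min 1 p)
  obtain ⟨Cs, hCs⟩ := exists_tsum_expKer_mul_rpow_le n hD (div_pos hγ₀ hm) hp
  rw [div_mul_cancel₀ _ hm.ne'] at hCs
  refine ⟨Cg ^ p * Cs * C₀, fun b F c => ?_⟩
  set x := (F : Set (Fin n → ℤ × ℤ)).indicator (fun k => (c k : ℝ≥0∞))
  have h1 : ∀ u, fockAbs α (latticeSum α D b F c) u ^ p ≤
      (Cg ^ p * Cs : ℝ≥0) * ∑' k, expKer γ₀ u (b + latt D k) * x k ^ p := by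
    intro u
    calc _ ≤ (Cg * ∑ k ∈ F, expKer (γ₀ / min 1 p) u (b + latt D k) * c k) ^ p := by
          gcongr
          exact hCg D b F c u
      _ = (Cg : ℝ≥0∞) ^ p * (∑' k, expKer (γ₀ / min 1 p) u (b + latt D k) * x k) ^ p := by
          rw [ENNReal.mul_rpow_of_nonneg _ _ hp.le]
          congr 2
          simpa using sum_rpow_eq_tsum one_pos F (fun k => (c k : ℝ≥0∞))
            (fun k => expKer (γ₀ / min 1 p) u (b + latt D k))
      _ ≤ (Cg : ℝ≥0∞) ^ p * (Cs * ∑' k, expKer γ₀ u (b + latt D k) * x k ^ p) := by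
          gcongr
          exact hCs b u x
      _ = _ := by
          rw [ENNReal.coe_mul, ENNReal.coe_rpow_of_nonneg _ hp.le, mul_assoc]
  calc _ ≤ ∫⁻ u, (Cg ^ p * Cs : ℝ≥0) * ∑' k, expKer γ₀ u (b + latt D k) * x k ^ p
          ∂weightMeasure w := lintegral_mono h1
    _ = (Cg ^ p * Cs : ℝ≥0) *
        ∑' k, (∫⁻ u, expKer γ₀ u (b + latt D k) ∂weightMeasure w) * x k ^ p := by
        rw [lintegral_const_mul' _ _ ENNReal.coe_ne_top, lintegral_tsum]
        · congr 1
          refine tsum_congr fun k => ?_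
          rw [lintegral_mul_const _ (measurable_expKer_left _ _)]
        · exact fun k => ((measurable_expKer_left _ _).mul_const _).aemeasurable
    _ ≤ (Cg ^ p * Cs : ℝ≥0) *
        ∑' k, (C₀ * weightMeasure w (Metric.ball (b + latt D k) 1)) * x k ^ p := by
        gcongr with k
        exact hint _
    _ = _ := by
        rw [sum_rpow_eq_tsum hp]
        simp_rw [mul_assoc (C₀ : ℝ≥0∞)]
        rw [ENNReal.tsum_mul_left, ENNReal.coe_mul _ C₀, mul_assoc]

theorem latticeSum_mem_fockSpace (hW : IsFockRegular (weightMeasure w)) {p α : ℝ}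
    (hp : 0 < p) (hα : 0 < α) {D : ℝ} (hD : 0 < D) (b : Cn n) (F : Finset (Fin n → ℤ × ℤ))
    (c : (Fin n → ℤ × ℤ) → ℝ≥0) : latticeSum α D b F c ∈ fockSpace p α w := by
  refine ⟨differentiable_latticeSum _ _ _ _ _, ?_⟩
  obtain ⟨C, hC⟩ := hW.exists_lintegral_latticeSum_le hp hα hD
  rw [fockNorm_eq hp]
  refine ENNReal.rpow_lt_top_of_nonneg (by positivity) ((hC b F c).trans_lt ?_).ne
  refine ENNReal.mul_lt_top ENNReal.coe_lt_top (ENNReal.sum_lt_top.2 fun k _ => ?_)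
  exact ENNReal.mul_lt_top (hW.measure_ball_lt_top _)
    (ENNReal.rpow_lt_top_of_nonneg hp.le ENNReal.coe_ne_top)

end IsFockRegular

/-- Two points of a unit ball are at distance at most 2, so the Gaussian is at least e^{-2β}; the
factor is its t-th root. -/
theorem le_berezinOp_of_le {t β : ℝ} (ht : 0 < t) (hβ : 0 < β) {α : ℝ} (μ : Measure (Cn n))
    {f : Cn n → ℂ} {a : Cn n} {c : ℝ≥0∞} (h : ∀ u ∈ Metric.ball a 1, c ≤ fockAbs α f u) {z : Cn n}
    (hz : z ∈ Metric.ball a 1) :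
    ENNReal.ofReal (Real.exp (-(2 * β / t))) * c * μ (Metric.ball a 1) ^ (1 / t) ≤
      berezinOp t α β μ f z := by
  rw [berezinOp_eq ht, one_div, ENNReal.le_rpow_inv_iff ht, ENNReal.mul_rpow_of_nonneg _ _ ht.le,
    ENNReal.rpow_inv_rpow ht.ne', ← setLIntegral_const]
  refine le_trans ?_ (setLIntegral_le_lintegral (Metric.ball a 1) _)
  refine setLIntegral_mono' measurableSet_ball fun u hu => ?_
  rw [ENNReal.mul_rpow_of_nonneg _ _ ht.le]
  gcongr
  · rw [ENNReal.ofReal_rpow_of_nonneg (Real.exp_pos _).le ht.le, ← Real.exp_mul]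
    refine ENNReal.ofReal_le_ofReal (Real.exp_le_exp.2 ?_)
    have h1 : ‖z - u‖ ≤ 2 := by
      have e : z - u = (z - a) - (u - a) := by abel
      rw [e]
      refine (norm_sub_le _ _).trans ?_
      linarith [mem_ball_iff_norm.1 hz, mem_ball_iff_norm.1 hu]
    have h2 : ‖z - u‖ ^ 2 ≤ 2 ^ 2 := by gcongr
    have h3 : -(2 * β / t) * t = -(2 * β) := by field_simp
    rw [h3]
    nlinarith
  · exact h u hu

/-- Contribution of disjoint unit balls to the norm of the image. -/
theorem sum_le_lintegral_berezinOp {ι : Type*} {q t β : ℝ} (hq : 0 < q) (ht : 0 < t) (hβ : 0 < β)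
    {α : ℝ} (W μ : Measure (Cn n)) {f : Cn n → ℂ} (F : Finset ι) (a : ι → Cn n)
    (hdisj : (F : Set ι).PairwiseDisjoint fun k => Metric.ball (a k) 1) (c : ι → ℝ≥0∞)
    (h : ∀ k ∈ F, ∀ u ∈ Metric.ball (a k) 1, c k ≤ fockAbs α f u) :
    ENNReal.ofReal (Real.exp (-(2 * β / t))) ^ q *
      ∑ k ∈ F, c k ^ q * μ (Metric.ball (a k) 1) ^ (q / t) * W (Metric.ball (a k) 1) ≤
      ∫⁻ z, berezinOp t α β μ f z ^ q ∂W := by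
  calc _ = ∑ k ∈ F, ∫⁻ _ in Metric.ball (a k) 1, (ENNReal.ofReal (Real.exp (-(2 * β / t))) * c k *
        μ (Metric.ball (a k) 1) ^ (1 / t)) ^ q ∂W := by
        rw [Finset.mul_sum]
        refine Finset.sum_congr rfl fun k _ => ?_
        rw [setLIntegral_const, ENNReal.mul_rpow_of_nonneg _ _ hq.le,
          ENNReal.mul_rpow_of_nonneg _ _ hq.le, ← ENNReal.rpow_mul, one_div_mul_eq_div]
        ring
    _ ≤ ∑ k ∈ F, ∫⁻ z in Metric.ball (a k) 1, berezinOp t α β μ f z ^ q ∂W := by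
        refine Finset.sum_le_sum fun k hk => ?_
        refine setLIntegral_mono' measurableSet_ball fun z hz => ?_
        gcongr
        exact le_berezinOp_of_le ht hβ μ (h k hk) hz
    _ = ∫⁻ z in ⋃ k ∈ F, Metric.ball (a k) 1, berezinOp t α β μ f z ^ q ∂W := by
        rw [lintegral_biUnion_finset hdisj fun k _ => measurableSet_ball]
    _ ≤ _ := setLIntegral_le_lintegral _ _

theorem fockAbs_coe_mul_fockKer_ge {α : ℝ} (hα : 0 < α) (c : ℝ≥0) {a u : Cn n}
    (hu : u ∈ Metric.ball a 1) : c * ENNReal.ofReal (Real.exp (-(α / 2))) ≤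
      fockAbs α (fun u => ((c : ℝ) : ℂ) * fockKer α a u) u := by
  rw [fockAbs_coe_mul_fockKer]
  gcongr
  have h1 : ‖u - a‖ ^ 2 ≤ 1 ^ 2 := by
    gcongr
    exact (mem_ball_iff_norm.1 hu).le
  nlinarith

theorem latticeSum_singleton (α D : ℝ) (b : Cn n) (c : (Fin n → ℤ × ℤ) → ℝ≥0) :
    latticeSum α D b {0} c = fun u => ((c 0 : ℝ) : ℂ) * fockKer α b u := by
  have : latt D (0 : Fin n → ℤ × ℤ) = 0 := by
    ext i; simp [latt, Complex.ext_iff]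
  ext u
  simp [latticeSum, this]

namespace IsFockRegular

variable {w : Cn n → ℝ}

/-- The multiples of the kernels have norm comparable to `w(B_1(a))^{1/p}`. -/
theorem exists_fockNorm_fockKer_le (hW : IsFockRegular (weightMeasure w)) {p α : ℝ}
    (hp : 0 < p) (hα : 0 < α) : ∃ C : ℝ≥0, ∀ (a : Cn n),
      fockNorm p α w (fockKer α a) ≤ C * weightMeasure w (Metric.ball a 1) ^ (1 / p) := by
  obtain ⟨C, hC⟩ := hW.exists_lintegral_latticeSum_le hp hα one_pos
  refine ⟨C ^ (1 / p), fun a => ?_⟩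
  have hp' : 0 ≤ 1 / p := by positivity
  have h := hC a {0} 1
  have e : latt 1 (0 : Fin n → ℤ × ℤ) = 0 := by
    ext i; simp [latt, Complex.ext_iff]
  rw [latticeSum_singleton] at h
  simp only [Pi.one_apply, NNReal.coe_one, Complex.ofReal_one, one_mul, Finset.sum_singleton, e,
    add_zero, ENNReal.coe_one, ENNReal.one_rpow, mul_one] at h
  rw [fockNorm_eq hp, ENNReal.coe_rpow_of_nonneg _ hp', ← ENNReal.mul_rpow_of_nonneg _ _ hp']
  gcongr

theorem fockKer_mem_fockSpace (hW : IsFockRegular (weightMeasure w)) {p α : ℝ}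
    (hp : 0 < p) (hα : 0 < α) (a : Cn n) : fockKer α a ∈ fockSpace p α w := by
  have := hW.latticeSum_mem_fockSpace hp hα one_pos a {0} 1
  rw [latticeSum_singleton] at this
  simpa using this

/-- The left side is what the lower bounds for the image produce, the right side is G times the size
of the test function. As 0 < W(B_1) < ∞, either sign of 1/p - 1/q is allowed. -/
theorem rpow_mul_measure_eq_Gfun (hW : IsFockRegular (weightMeasure w)) (p q t : ℝ)
    (μ : Measure (Cn n)) (a : Cn n) :
    μ (Metric.ball a 1) ^ (1 / t) * weightMeasure w (Metric.ball a 1) ^ (1 / q) =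
      Gfun p q t w μ a * weightMeasure w (Metric.ball a 1) ^ (1 / p) := by
  have h0 : weightMeasure w (Metric.ball a 1) ≠ 0 := (hW.measure_ball_pos a).ne'
  have ht : weightMeasure w (Metric.ball a 1) ≠ ∞ := (hW.measure_ball_lt_top a).ne
  rw [Gfun, div_eq_mul_inv (_ ^ (1 / t)), mul_assoc, ← ENNReal.rpow_neg, ← ENNReal.rpow_add _ _ h0 ht]
  congr 2
  ring

/-- Test on the kernel at a: its norm is O(W(B)^{1/p}) with B = B_1(a), while on B its image is at
least a constant times μ(B)^{1/t}. -/
theorem exists_Gfun_le (hW : IsFockRegular (weightMeasure w)) {p q t α β : ℝ} (hp : 0 < p)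
    (hq : 0 < q) (ht : 0 < t) (hα : 0 < α) (hβ : 0 < β) : ∃ C : ℝ≥0, 0 < C ∧
      ∀ (μ : Measure (Cn n)) (a : Cn n), Gfun p q t w μ a ≤ C * berezinOpNorm p q t α β w μ := by
  obtain ⟨C, hC⟩ := hW.exists_fockNorm_fockKer_le hp hα
  set c := ENNReal.ofReal (Real.exp (-(2 * β / t))) * ENNReal.ofReal (Real.exp (-(α / 2))) with hc
  have hc0 : c ≠ 0 := by simp [hc, Real.exp_pos]
  have hct : c ≠ ∞ := by finiteness
  refine ⟨c⁻¹.toNNReal * C + 1, by positivity, fun μ a => ?_⟩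
  set W := weightMeasure w (Metric.ball a 1)
  have h0 : W ≠ 0 := (hW.measure_ball_pos a).ne'
  have hWt : W ≠ ∞ := (hW.measure_ball_lt_top a).ne
  have h1 := sum_le_lintegral_berezinOp hq ht hβ (weightMeasure w) μ (α := α) (f := fockKer α a)
    {()} (fun _ => a) (by simp) (fun _ => ENNReal.ofReal (Real.exp (-(α / 2))))
    (fun _ _ u hu => by simpa using fockAbs_coe_mul_fockKer_ge hα 1 hu)
  have h2 : c * (μ (Metric.ball a 1) ^ (1 / t) * W ^ (1 / q)) ≤
      berezinNorm q t α β w μ (fockKer α a) := by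
    rw [berezinNorm_eq hq, one_div q, ENNReal.le_rpow_inv_iff hq]
    refine le_trans (le_of_eq ?_) h1
    simp only [Finset.sum_singleton, hc, ENNReal.mul_rpow_of_nonneg _ _ hq.le]
    rw [ENNReal.rpow_inv_rpow hq.ne', ← ENNReal.rpow_mul, one_div_mul_eq_div]
    ring
  have h3 : c * Gfun p q t w μ a * W ^ (1 / p) ≤
      berezinOpNorm p q t α β w μ * C * W ^ (1 / p) := by
    rw [mul_assoc, ← hW.rpow_mul_measure_eq_Gfun]
    refine h2.trans ((hW.berezinNorm_le_opNorm_mul hp hq ht μ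
      (hW.fockKer_mem_fockSpace hp hα a)).trans ?_)
    rw [mul_assoc]
    gcongr
    exact hC a
  have h4 : c * Gfun p q t w μ a ≤ berezinOpNorm p q t α β w μ * C := by
    refine (ENNReal.mul_le_mul_iff_left ?_ ?_).1 h3
    · simp [h0, hWt]
    · exact ENNReal.rpow_ne_top_of_nonneg (by positivity) hWt
  rw [mul_comm, ← ENNReal.le_div_iff_mul_le (Or.inl hc0) (Or.inl hct), div_eq_mul_inv] at h4
  rw [ENNReal.coe_add, ENNReal.coe_mul, ENNReal.coe_toNNReal (ENNReal.inv_ne_top.2 hc0)]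
  refine h4.trans ?_
  rw [add_mul]
  refine le_trans (le_of_eq ?_) le_self_add
  ring

end IsFockRegular

/-! ### Necessity for `q < p` -/

theorem latt_natCast (N : ℕ) (k : Fin n → ℤ × ℤ) :
    latt (N : ℝ) k = latt 1 fun i => ((N : ℤ) * (k i).1, (N : ℤ) * (k i).2) := by
  ext i
  simp [latt]

/-- The lattice Nℤ²ⁿ is contained in ℤ²ⁿ, so one constant serves all N. This allows N to be chosen
depending on that constant. -/
theorem exists_tsum_expKer_natCast_le (n : ℕ) : ∃ C : ℝ≥0, ∀ N : ℕ, 0 < N → ∀ z : Cn n,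
    ∑' k, expKer 1 z (latt (N : ℝ) k) ≤ C := by
  obtain ⟨C, hC⟩ := exists_tsum_expKer_le n one_pos one_pos
  refine ⟨C, fun N hN z => le_trans ?_ (hC z)⟩
  simp_rw [latt_natCast]
  refine ENNReal.tsum_comp_le_tsum_of_injective (f := fun (k : Fin n → ℤ × ℤ) (i : Fin n) =>
    ((N : ℤ) * (k i).1, (N : ℤ) * (k i).2)) (fun k j h => ?_) (fun k => expKer 1 z (latt 1 k))
  have hN' : (N : ℤ) ≠ 0 := by exact_mod_cast hN.ne'
  funext i
  have hi := congrFun h i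
  simp only [Prod.mk.injEq, mul_eq_mul_left_iff, hN', or_false] at hi
  exact Prod.ext hi.1 hi.2

/-- The triangle inequality in additive form: the k-th bump is at most the whole sum plus the other
bumps, with no subtraction in [0, ∞]. -/
theorem enorm_latticeSum_ge {α D : ℝ} (b : Cn n) (F : Finset (Fin n → ℤ × ℤ))
    (c : (Fin n → ℤ × ℤ) → ℝ≥0) {k : Fin n → ℤ × ℤ} (hk : k ∈ F) (u : Cn n) :
    c k * ENNReal.ofReal (Real.exp (-(α / 2) * ‖u - (b + latt D k)‖ ^ 2)) ≤
      fockAbs α (latticeSum α D b F c) u +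
        ∑ j ∈ F.erase k, c j * ENNReal.ofReal (Real.exp (-(α / 2) * ‖u - (b + latt D j)‖ ^ 2)) := by
  have e : latticeSum α D b F c u = ((c k : ℝ) : ℂ) * fockKer α (b + latt D k) u +
      latticeSum α D b (F.erase k) c u := (Finset.add_sum_erase F _ hk).symm
  have h2 := fockAbs_sum_le α (F.erase k)
    (fun j u => ((c j : ℝ) : ℂ) * fockKer α (b + latt D j) u) u
  simp only [fockAbs_coe_mul_fockKer] at h2
  refine le_trans ?_ (add_le_add_right h2 _)
  rw [← fockAbs_coe_mul_fockKer]
  simp only [fockAbs]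
  rw [← ENNReal.ofReal_add (by positivity) (by positivity), ← add_mul]
  refine ENNReal.ofReal_le_ofReal ?_
  gcongr
  have e2 : ((c k : ℝ) : ℂ) * fockKer α (b + latt D k) u =
    latticeSum α D b F c u - latticeSum α D b (F.erase k) c u := by rw [e]; ring
  rw [e2]
  exact norm_sub_le _ _

/-- For slowly varying coefficients and a sparse lattice the sum is bounded below near the lattice
points by the coefficient of that point. -/
theorem exists_le_fockAbs_latticeSum {α ε : ℝ} (hα : 0 < α) (hε : 0 ≤ ε) : ∃ N : ℕ, 2 ≤ N ∧
    ∀ (b : Cn n) (F : Finset (Fin n → ℤ × ℤ)) (c : (Fin n → ℤ × ℤ) → ℝ≥0),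
      (∀ j ∈ F, ∀ k ∈ F, expKer ε (latt (N : ℝ) k) (latt N j) * c j ≤ c k) →
      ∀ k ∈ F, ∀ u ∈ Metric.ball (b + latt (N : ℝ) k) 1,
        ENNReal.ofReal (Real.exp (-(α / 2)) / 2) * c k ≤ fockAbs α (latticeSum α N b F c) u := by
  obtain ⟨S, hS⟩ := exists_tsum_expKer_natCast_le n
  -- The rate is spent in three parts: ε compares c_j with c_k, one unit yields the small factor
  -- e^{-N} from the separation, one unit gives summability over j.
  set γ := ε + 1 + 1 with hγ
  have hγ0 : 0 ≤ γ := by positivity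
  obtain ⟨Cg, hCg⟩ := exists_gaussian_le (n := n) (half_pos hα) γ
  set E := Real.exp (γ * 1)
  -- N makes the other bumps contribute at most half of the main one; N ≥ 2 will make the unit balls
  -- disjoint.
  obtain ⟨N, hN2, hN⟩ : ∃ N : ℕ, 2 ≤ N ∧
      (Cg : ℝ) * E * S * Real.exp (-(N : ℝ)) ≤ Real.exp (-(α / 2)) / 2 := by
    have h1 : Tendsto (fun N : ℕ => (Cg : ℝ) * E * S * Real.exp (-(N : ℝ))) atTop
        (𝓝 ((Cg : ℝ) * E * S * 0)) :=
      ((Real.tendsto_exp_neg_atTop_nhds_zero).comp tendsto_natCast_atTop_atTop).const_mul _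
    rw [mul_zero] at h1
    have h2 := (h1.eventually (ge_mem_nhds
      (by positivity : (0 : ℝ) < Real.exp (-(α / 2)) / 2))).and (eventually_ge_atTop 2)
    obtain ⟨N, hN⟩ := h2.exists
    exact ⟨N, hN.2, hN.1⟩
  have hN0 : 0 < N := by omega
  refine ⟨N, hN2, fun b F c hc k hk u hu => ?_⟩
  set A := ENNReal.ofReal (Real.exp (-(α / 2)) / 2)
  have h1 := enorm_latticeSum_ge (α := α) (D := (N : ℝ)) b F c hk u
  have h2 : ∑ j ∈ F.erase k, c j *
      ENNReal.ofReal (Real.exp (-(α / 2) * ‖u - (b + latt (N : ℝ) j)‖ ^ 2)) ≤ A * c k := by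
    calc _ ≤ ∑ j ∈ F.erase k, (Cg * ENNReal.ofReal E * ENNReal.ofReal (Real.exp (-(N : ℝ))) * c k) *
          expKer 1 (latt (N : ℝ) k) (latt (N : ℝ) j) := by
          refine Finset.sum_le_sum fun j hj => ?_
          have hjk := Finset.mem_erase.1 hj
          have e1 : expKer γ u (b + latt (N : ℝ) j) ≤
              ENNReal.ofReal E * expKer γ (latt (N : ℝ) k) (latt (N : ℝ) j) := by
            rw [expKer_comm γ u]
            refine (expKer_shift hγ0 _ (mem_ball_iff_norm.1 hu).le).trans (le_of_eq ?_)
            rw [expKer_comm γ (latt (N : ℝ) k)]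
            simp [expKer, E]
          have e2 : expKer 1 (latt (N : ℝ) k) (latt (N : ℝ) j) ≤
              ENNReal.ofReal (Real.exp (-(N : ℝ))) := by
            refine ENNReal.ofReal_le_ofReal (Real.exp_le_exp.2 ?_)
            have := le_norm_latt_sub_latt (n := n) (Nat.cast_pos.2 hN0 : (0 : ℝ) < N) hjk.1.symm
            linarith
          calc _ ≤ c j * (Cg * (ENNReal.ofReal E *
                expKer γ (latt (N : ℝ) k) (latt (N : ℝ) j))) := by
                gcongr
                exact (hCg _ _).trans (by gcongr)
            _ = Cg * ENNReal.ofReal E * expKer 1 (latt (N : ℝ) k) (latt (N : ℝ) j) *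
                (expKer ε (latt (N : ℝ) k) (latt N j) * c j) *
                expKer 1 (latt (N : ℝ) k) (latt (N : ℝ) j) := by
                rw [hγ, expKer_add, expKer_add]
                ring
            _ ≤ Cg * ENNReal.ofReal E * ENNReal.ofReal (Real.exp (-(N : ℝ))) * c k *
                expKer 1 (latt (N : ℝ) k) (latt (N : ℝ) j) := by
                gcongr
                exact hc j hjk.2 k hk
      _ = (Cg * ENNReal.ofReal E * ENNReal.ofReal (Real.exp (-(N : ℝ))) * c k) *
          ∑ j ∈ F.erase k, expKer 1 (latt (N : ℝ) k) (latt (N : ℝ) j) := by rw [Finset.mul_sum]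
      _ ≤ (Cg * ENNReal.ofReal E * ENNReal.ofReal (Real.exp (-(N : ℝ))) * c k) * S := by
          gcongr
          exact (ENNReal.sum_le_tsum _).trans (hS N hN0 _)
      _ = ENNReal.ofReal (Cg * E * S * Real.exp (-(N : ℝ))) * c k := by
          rw [ENNReal.ofReal_mul (by positivity), ENNReal.ofReal_mul (by positivity),
            ENNReal.ofReal_mul (by positivity), ENNReal.ofReal_coe_nnreal,
            ENNReal.ofReal_coe_nnreal]
          ring
      _ ≤ _ := mul_le_mul' (ENNReal.ofReal_le_ofReal hN) le_rfl
  -- On the unit ball the main bump is at least e^{-α/2} c_k = 2A c_k; one copy of A c_k absorbs the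
  -- other bumps.
  have h3 : A * c k + A * c k ≤
      c k * ENNReal.ofReal (Real.exp (-(α / 2) * ‖u - (b + latt (N : ℝ) k)‖ ^ 2)) := by
    rw [← add_mul, ← ENNReal.ofReal_add (by positivity) (by positivity), add_halves, mul_comm]
    gcongr
    have h1 : ‖u - (b + latt (N : ℝ) k)‖ ^ 2 ≤ 1 ^ 2 := by
      gcongr
      exact (mem_ball_iff_norm.1 hu).le
    nlinarith
  have h4 := h3.trans (h1.trans (add_le_add_right h2 _))
  exact (ENNReal.add_le_add_iff_right (by finiteness)).1 h4

theorem sFinite_of_measure_ball_lt_top {μ : Measure (Cn n)} (h : ∀ z, μ (Metric.ball z 1) < ∞) :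
    SFinite μ := by
  have : IsLocallyFiniteMeasure μ :=
    ⟨fun z => ⟨Metric.ball z 1, Metric.ball_mem_nhds z one_pos, h z⟩⟩
  infer_instance

theorem measurable_measure_ball (μ : Measure (Cn n)) (h : ∀ z, μ (Metric.ball z 1) < ∞) :
    Measurable fun z => μ (Metric.ball z 1) := by
  have := sFinite_of_measure_ball_lt_top h
  have hs : MeasurableSet {x : Cn n × Cn n | dist x.2 x.1 < 1} :=
    (isOpen_lt (by fun_prop) continuous_const).measurableSet
  exact measurable_measure_prodMk_left hs

namespace IsFockRegular

variable {w : Cn n → ℝ}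

/-- Regularization of coefficients: a slowly varying majorant with comparable weighted sum. -/
theorem exists_slowly_varying (hW : IsFockRegular (weightMeasure w)) {p : ℝ} (hp : 0 < p) :
    ∃ ε : ℝ, 0 ≤ ε ∧ ∀ D > (0 : ℝ), ∃ C : ℝ≥0, ∀ (b : Cn n) (F : Finset (Fin n → ℤ × ℤ))
      (d : (Fin n → ℤ × ℤ) → ℝ≥0), ∃ c : (Fin n → ℤ × ℤ) → ℝ≥0,
        (∀ j ∈ F, ∀ k ∈ F, expKer ε (latt D k) (latt D j) * c j ≤ c k) ∧
        (∀ k ∈ F, d k ≤ c k) ∧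
        ∑ k ∈ F, weightMeasure w (Metric.ball (b + latt D k) 1) * (c k : ℝ≥0∞) ^ p ≤
          C * ∑ k ∈ F, weightMeasure w (Metric.ball (b + latt D k) 1) * (d k : ℝ≥0∞) ^ p := by
  obtain ⟨γ₀, hγ₀, C₀, -, hgr, -⟩ := hW.exists_growth
  have hm : 0 < min 1 p := lt_min one_pos hp
  have hγ1 : 0 < γ₀ + 1 := by positivity
  -- After the p-th power the rate is γ₀ + 1: γ₀ moves the weight from k to j, and 1 remains for
  -- summation. It does not depend on D, so a mesh may be chosen after ε.
  set ε := (γ₀ + 1) / min 1 p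
  have hε : 0 < ε := div_pos hγ1 hm
  refine ⟨ε, hε.le, fun D hD => ?_⟩
  obtain ⟨Cs, hCs⟩ := exists_tsum_expKer_mul_rpow_le n hD hε hp
  rw [div_mul_cancel₀ _ hm.ne'] at hCs
  obtain ⟨S, hS⟩ := exists_tsum_expKer_le n hD one_pos
  refine ⟨Cs * C₀ * S, fun b F d => ?_⟩
  have hfin : ∀ k, ∑ j ∈ F, expKer ε (latt D k) (latt D j) * d j ≠ ∞ := fun k =>
    (ENNReal.sum_lt_top.2 fun j _ =>
      ENNReal.mul_lt_top (expKer_ne_top _ _ _).lt_top ENNReal.coe_lt_top).ne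
  -- Convolution of d with e^{-ε|·|}: the triangle inequality gives slow variation, and the diagonal
  -- term gives d ≤ c.
  set c : (Fin n → ℤ × ℤ) → ℝ≥0 := fun k =>
    (∑ j ∈ F, expKer ε (latt D k) (latt D j) * d j).toNNReal
  have hc : ∀ k, (c k : ℝ≥0∞) = ∑ j ∈ F, expKer ε (latt D k) (latt D j) * d j := fun k =>
    ENNReal.coe_toNNReal (hfin k)
  set W : (Fin n → ℤ × ℤ) → ℝ≥0∞ := fun k => weightMeasure w (Metric.ball (b + latt D k) 1)
  refine ⟨c, fun j _ k _ => ?_, fun k hk => ?_, ?_⟩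
  · rw [hc, hc, Finset.mul_sum]
    refine Finset.sum_le_sum fun i _ => ?_
    rw [← mul_assoc]
    gcongr
    exact expKer_mul_expKer_le hε.le _ _ _
  · rw [← ENNReal.coe_le_coe, hc]
    refine le_trans (le_of_eq ?_)
      (Finset.single_le_sum (f := fun j => expKer ε (latt D k) (latt D j) * (d j : ℝ≥0∞))
        (fun _ _ => zero_le) hk)
    simp [expKer]
  set x := (F : Set (Fin n → ℤ × ℤ)).indicator (fun k => (d k : ℝ≥0∞))
  have h1 : ∀ k, (c k : ℝ≥0∞) ^ p ≤
      Cs * ∑ j ∈ F, expKer (γ₀ + 1) (latt D k) (latt D j) * (d j : ℝ≥0∞) ^ p := by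
    intro k
    have := hCs 0 (latt D k) x
    simp only [zero_add] at this
    rw [hc, sum_rpow_eq_tsum hp]
    refine le_trans (le_of_eq ?_) this
    congr 1
    simpa using sum_rpow_eq_tsum one_pos F (fun j => (d j : ℝ≥0∞))
      (fun j => expKer ε (latt D k) (latt D j))
  have h2 : ∀ j k, W k * expKer (γ₀ + 1) (latt D k) (latt D j) ≤
      expKer 1 (latt D j) (latt D k) * (C₀ * W j) := by
    intro j k
    have := hgr (b + latt D k) (b + latt D j)
    have e : expKer γ₀ (b + latt D k) (b + latt D j) = expKer γ₀ (latt D k) (latt D j) := by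
      simp [expKer]
    rw [e] at this
    rw [expKer_add, expKer_comm 1 (latt D j)]
    calc _ = expKer 1 (latt D k) (latt D j) * (expKer γ₀ (latt D k) (latt D j) * W k) := by ring
      _ ≤ _ := mul_le_mul' le_rfl this
  calc _ ≤ ∑ k ∈ F, W k *
        (Cs * ∑ j ∈ F, expKer (γ₀ + 1) (latt D k) (latt D j) * (d j : ℝ≥0∞) ^ p) := by
        gcongr with k hk
        exact h1 k
    _ = Cs * ∑ j ∈ F, (∑ k ∈ F, W k * expKer (γ₀ + 1) (latt D k) (latt D j)) *
          (d j : ℝ≥0∞) ^ p := by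
        simp_rw [Finset.mul_sum, Finset.sum_mul, Finset.mul_sum]
        rw [Finset.sum_comm]
        refine Finset.sum_congr rfl fun j _ => Finset.sum_congr rfl fun k _ => ?_
        ring
    _ ≤ Cs * ∑ j ∈ F, (S * (C₀ * W j)) * (d j : ℝ≥0∞) ^ p := by
        gcongr with j hj
        calc _ ≤ ∑ k ∈ F, expKer 1 (latt D j) (latt D k) * (C₀ * W j) :=
              Finset.sum_le_sum fun k _ => h2 j k
          _ = (∑ k ∈ F, expKer 1 (latt D j) (latt D k)) * (C₀ * W j) := by rw [Finset.sum_mul]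
          _ ≤ _ := by
              gcongr
              exact (ENNReal.sum_le_tsum _).trans (hS _)
    _ = _ := by
        rw [Finset.mul_sum, Finset.mul_sum]
        refine Finset.sum_congr rfl fun j _ => ?_
        push_cast
        ring

/-- The values of `G_μ` over all shifts of a sparse lattice. -/
theorem exists_tsum_Gfun_le (hW : IsFockRegular (weightMeasure w)) {p q t α β : ℝ}
    (hq : 0 < q) (hqp : q < p) (ht : 0 < t) (hα : 0 < α) (hβ : 0 < β) :
    ∃ D : ℝ, 0 < D ∧ ∃ C : ℝ≥0, ∀ (μ : Measure (Cn n)), berezinOpNorm p q t α β w μ ≠ ∞ →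
      ∀ b : Cn n, ∑' k, Gfun p q t w μ (b + latt D k) ^ (p * q / (p - q)) ≤
        C * berezinOpNorm p q t α β w μ ^ (p * q / (p - q)) := by
  have hp : 0 < p := hq.trans hqp
  have hpq : 0 < p - q := sub_pos.2 hqp
  set κ := p * q / (p - q) with hκdef
  have hκ : 0 < κ := by positivity
  obtain ⟨CG, -, hCG⟩ := hW.exists_Gfun_le hp hq ht hα hβ
  obtain ⟨ε, hε, hslow⟩ := hW.exists_slowly_varying hp
  obtain ⟨N, hN2, hlow⟩ := exists_le_fockAbs_latticeSum (n := n) hα hε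
  have hN0 : (0 : ℝ) < N := by exact_mod_cast (by omega : 0 < N)
  obtain ⟨C₁, hC₁⟩ := hslow N hN0
  obtain ⟨C₂, hC₂⟩ := hW.exists_lintegral_latticeSum_le hp hα hN0
  set A := ENNReal.ofReal (Real.exp (-(α / 2)) / 2) with hA
  set B := ENNReal.ofReal (Real.exp (-(2 * β / t))) with hB
  have hA0 : A ≠ 0 := by simp [hA, Real.exp_pos]
  have hB0 : B ≠ 0 := by simp [hB, Real.exp_pos]
  have hAB0 : (B * A) ^ q ≠ 0 := by
    simp [hA0, hB0, hq.le]
  have hABt : (B * A) ^ q ≠ ∞ := ENNReal.rpow_ne_top_of_nonneg hq.le (by finiteness)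
  set T : ℝ≥0∞ := ((B * A) ^ q)⁻¹ * (C₂ * C₁ : ℝ≥0∞) ^ (q / p) with hT
  have hqp0 : 0 < q / p := div_pos hq hp
  have hTt : T ≠ ∞ := ENNReal.mul_ne_top (ENNReal.inv_ne_top.2 hAB0)
    (ENNReal.rpow_ne_top_of_nonneg hqp0.le (by finiteness))
  have hpp : 0 < p / (p - q) := by positivity
  refine ⟨N, hN0, (T ^ (p / (p - q))).toNNReal, fun μ hμ b => ?_⟩
  rw [ENNReal.coe_toNNReal (ENNReal.rpow_ne_top_of_nonneg hpp.le hTt), ENNReal.tsum_eq_iSup_sum]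
  refine iSup_le fun F => ?_
  set M := berezinOpNorm p q t α β w μ
  set a : (Fin n → ℤ × ℤ) → Cn n := fun k => b + latt (N : ℝ) k
  set g : (Fin n → ℤ × ℤ) → ℝ≥0∞ := fun k => Gfun p q t w μ (a k)
  set W : (Fin n → ℤ × ℤ) → ℝ≥0∞ := fun k => weightMeasure w (Metric.ball (a k) 1)
  have hW0 : ∀ k, W k ≠ 0 := fun k => (hW.measure_ball_pos _).ne'
  have hWt : ∀ k, W k ≠ ∞ := fun k => (hW.measure_ball_lt_top _).ne
  have hgt : ∀ k, g k ≠ ∞ := fun k =>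
    ((hCG μ (a k)).trans_lt (ENNReal.mul_lt_top ENNReal.coe_lt_top hμ.lt_top)).ne
  have hgκ : ∀ k, g k ^ κ ≠ ∞ := fun k => ENNReal.rpow_ne_top_of_nonneg hκ.le (hgt k)
  set X := ∑ k ∈ F, g k ^ κ with hX
  -- Finite because F is finite and G is bounded by the operator norm; needed to divide by X^{q/p}
  -- below.
  have hXt : X ≠ ∞ := (ENNReal.sum_lt_top.2 fun k _ => (hgκ k).lt_top).ne
  have hdt : ∀ k, (g k ^ κ / W k) ^ (1 / p) ≠ ∞ := fun k =>
    ENNReal.rpow_ne_top_of_nonneg (by positivity) (ENNReal.div_ne_top (hgκ k) (hW0 k))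
  -- The extremal choice in Hölder's inequality: both W d^p and d^q μ^{q/t} W equal g^κ, since κq/p
  -- + q = κ. Thus X appears on both sides.
  set d : (Fin n → ℤ × ℤ) → ℝ≥0 := fun k => ((g k ^ κ / W k) ^ (1 / p)).toNNReal
  have hd : ∀ k, (d k : ℝ≥0∞) = (g k ^ κ / W k) ^ (1 / p) := fun k => ENNReal.coe_toNNReal (hdt k)
  obtain ⟨c, hc1, hc2, hc3⟩ := hC₁ b F d
  set f := latticeSum α N b F c
  have hdW : ∀ k, W k * (d k : ℝ≥0∞) ^ p = g k ^ κ := fun k => by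
    rw [hd, ← ENNReal.rpow_mul, one_div_mul_cancel hp.ne', ENNReal.rpow_one,
      ENNReal.mul_div_cancel (hW0 k) (hWt k)]
  have hnorm : ∫⁻ u, fockAbs α f u ^ p ∂weightMeasure w ≤ C₂ * C₁ * X := by
    refine (hC₂ b F c).trans ?_
    rw [mul_assoc]
    refine mul_le_mul' le_rfl (hc3.trans (le_of_eq ?_))
    rw [hX]
    congr 1
    exact Finset.sum_congr rfl fun k _ => hdW k
  have hdisj : (F : Set (Fin n → ℤ × ℤ)).PairwiseDisjoint fun k => Metric.ball (a k) 1 := by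
    intro k _ j _ hkj
    refine Metric.ball_disjoint_ball ?_
    have h1 := le_norm_latt_sub_latt (n := n) hN0 hkj
    have h2 : (2 : ℝ) ≤ N := by exact_mod_cast hN2
    simp only [a, dist_eq_norm, add_sub_add_left_eq_sub]
    linarith
  have hlower := sum_le_lintegral_berezinOp hq ht hβ (weightMeasure w) μ F a hdisj
    (fun k => A * c k) (f := f) (α := α) (fun k hk u hu => hlow b F c hc1 k hk u hu)
  have hterm : ∀ k, (d k : ℝ≥0∞) ^ q * μ (Metric.ball (a k) 1) ^ (q / t) * W k = g k ^ κ := by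
    intro k
    have e1 := hW.rpow_mul_measure_eq_Gfun p q t μ (a k)
    have e2 : μ (Metric.ball (a k) 1) ^ (q / t) * W k = g k ^ q * W k ^ (q / p) := by
      have := congrArg (· ^ q) e1
      simp only [ENNReal.mul_rpow_of_nonneg _ _ hq.le, ← ENNReal.rpow_mul, one_div_mul_eq_div,
        div_self hq.ne', ENNReal.rpow_one] at this
      exact this
    rw [mul_assoc, e2, hd, ← ENNReal.rpow_mul, one_div_mul_eq_div, div_eq_mul_inv,
      ENNReal.mul_rpow_of_nonneg _ _ hqp0.le, ENNReal.inv_rpow]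
    calc _ = (g k ^ κ) ^ (q / p) * g k ^ q * ((W k ^ (q / p))⁻¹ * W k ^ (q / p)) := by ring
      _ = _ := by
        rw [ENNReal.inv_mul_cancel, mul_one, ← ENNReal.rpow_mul,
          ← ENNReal.rpow_add_of_nonneg _ _ (by positivity) hq.le]
        · congr 1
          rw [hκdef]
          field_simp
          ring
        · simp [hW0 k, hWt k]
        · exact ENNReal.rpow_ne_top_of_nonneg hqp0.le (hWt k)
  have h1 : (B * A) ^ q * X ≤ M ^ q * (C₂ * C₁ * X) ^ (q / p) := by
    calc (B * A) ^ q * X = B ^ q * ∑ k ∈ F, (A * d k) ^ q *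
          μ (Metric.ball (a k) 1) ^ (q / t) * W k := by
          rw [ENNReal.mul_rpow_of_nonneg _ _ hq.le, mul_assoc, hX, Finset.mul_sum]
          congr 1
          refine Finset.sum_congr rfl fun k _ => ?_
          rw [← hterm, ENNReal.mul_rpow_of_nonneg _ _ hq.le]
          ring
      _ ≤ B ^ q * ∑ k ∈ F, (A * c k) ^ q * μ (Metric.ball (a k) 1) ^ (q / t) * W k := by
          gcongr with k hk
          exact hc2 k hk
      _ ≤ _ := hlower
      _ = berezinNorm q t α β w μ f ^ q := by
          rw [berezinNorm_eq hq, ← ENNReal.rpow_mul, one_div_mul_cancel hq.ne', ENNReal.rpow_one]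
      _ ≤ (M * fockNorm p α w f) ^ q := by
          gcongr
          exact hW.berezinNorm_le_opNorm_mul hp hq ht μ
            (hW.latticeSum_mem_fockSpace hp hα hN0 b F c)
      _ = M ^ q * (∫⁻ u, fockAbs α f u ^ p ∂weightMeasure w) ^ (q / p) := by
          rw [fockNorm_eq hp, ENNReal.mul_rpow_of_nonneg _ _ hq.le, ← ENNReal.rpow_mul,
            one_div_mul_eq_div]
      _ ≤ _ := by gcongr
  have h2 : X ≤ T * M ^ q * X ^ (q / p) := by
    rw [mul_comm, ← ENNReal.le_div_iff_mul_le (Or.inl hAB0) (Or.inl hABt)] at h1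
    refine h1.trans (le_of_eq ?_)
    rw [hT, ENNReal.mul_rpow_of_nonneg _ _ hqp0.le, ENNReal.div_eq_inv_mul]
    ring
  by_cases hX0 : X = 0
  · rw [hX0]; exact zero_le
  have h3 : X ^ (1 - q / p) ≤ T * M ^ q := by
    have hX1 : X ^ (q / p) ≠ 0 := by simp [hX0, hXt]
    have hX2 : X ^ (q / p) ≠ ∞ := ENNReal.rpow_ne_top_of_nonneg hqp0.le hXt
    rw [ENNReal.rpow_sub _ _ hX0 hXt, ENNReal.rpow_one]
    exact ENNReal.div_le_of_le_mul h2
  calc X = (X ^ (1 - q / p)) ^ (p / (p - q)) := by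
        rw [← ENNReal.rpow_mul, show (1 - q / p) * (p / (p - q)) = 1 by field_simp,
          ENNReal.rpow_one]
    _ ≤ (T * M ^ q) ^ (p / (p - q)) := by gcongr
    _ = _ := by
        rw [ENNReal.mul_rpow_of_nonneg _ _ hpp.le, ← ENNReal.rpow_mul, hκdef]
        congr 2
        ring

theorem measurable_Gfun (hW : IsFockRegular (weightMeasure w)) (p q t : ℝ) {μ : Measure (Cn n)}
    (h : ∀ z, μ (Metric.ball z 1) < ∞) : Measurable (Gfun p q t w μ) :=
  ((measurable_measure_ball μ h).pow_const _).div
    ((measurable_measure_ball _ hW.measure_ball_lt_top).pow_const _)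

/-- The denominator of G is never infinite, as 0 < W(B_1) < ∞. Thus boundedness of the operator
forces μ to be locally finite. -/
theorem measure_ball_lt_top_of_Gfun_lt_top (hW : IsFockRegular (weightMeasure w)) {p q t : ℝ}
    (ht : 0 < t) {μ : Measure (Cn n)} {z : Cn n} (h : Gfun p q t w μ z < ∞) :
    μ (Metric.ball z 1) < ∞ := by
  by_contra hc
  rw [not_lt, top_le_iff] at hc
  rw [Gfun, hc, ENNReal.top_rpow_of_pos (by positivity), ENNReal.top_div_of_ne_top] at h
  · exact lt_irrefl _ h
  · exact ENNReal.rpow_ne_top_of_ne_zero (hW.measure_ball_pos z).ne'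
      (hW.measure_ball_lt_top z).ne

/-- The integral of G^κ is the integral over one cell of the sums over the shifted lattices, which
are bounded uniformly in the shift. -/
theorem exists_eLpNorm_Gfun_le (hW : IsFockRegular (weightMeasure w)) {p q t α β : ℝ}
    (hq : 0 < q) (hqp : q < p) (ht : 0 < t) (hα : 0 < α) (hβ : 0 < β) :
    ∃ C : ℝ≥0, 0 < C ∧ ∀ (μ : Measure (Cn n)),
      eLpNorm (Gfun p q t w μ) (ENNReal.ofReal (p * q / (p - q))) volume ≤
        C * berezinOpNorm p q t α β w μ := by
  have hp : 0 < p := hq.trans hqp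
  have hpq : 0 < p - q := sub_pos.2 hqp
  obtain ⟨CG, -, hCG⟩ := hW.exists_Gfun_le hp hq ht hα hβ
  obtain ⟨D, hD, C, hC⟩ := hW.exists_tsum_Gfun_le hq hqp ht hα hβ
  set κ := p * q / (p - q) with hκdef
  have hκ : 0 < κ := by positivity
  set V := volume (cell (n := n) D 0) with hV
  have hVt : V ≠ ∞ := volume_cell_ne_top hD 0
  -- A nonzero constant gives C · ∞ = ∞, as the case of infinite operator norm requires.
  refine ⟨(C * V.toNNReal) ^ (1 / κ) + 1,
    add_pos_of_nonneg_of_pos zero_le one_pos, fun μ => ?_⟩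
  by_cases hμ : berezinOpNorm p q t α β w μ = ∞
  · rw [hμ, ENNReal.mul_top (ENNReal.coe_ne_zero.2
      (add_pos_of_nonneg_of_pos zero_le one_pos).ne')]
    exact le_top
  have hfin : ∀ z, μ (Metric.ball z 1) < ∞ := fun z =>
    hW.measure_ball_lt_top_of_Gfun_lt_top ht
      ((hCG μ z).trans_lt (ENNReal.mul_lt_top ENNReal.coe_lt_top (Ne.lt_top hμ)))
  have hm := hW.measurable_Gfun p q t hfin
  have hκ' : 0 ≤ 1 / κ := by positivity
  rw [eLpNorm_ennreal hκ]
  calc _ ≤ (C * V * berezinOpNorm p q t α β w μ ^ κ) ^ (1 / κ) := by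
        gcongr
        rw [lintegral_eq_tsum_cell D]
        rw [tsum_congr fun k => setLIntegral_cell hD k _]
        have hmk : ∀ k, AEMeasurable (fun z => Gfun p q t w μ (z + latt D k) ^ κ)
            (volume.restrict (cell D 0)) := fun k =>
          ((hm.comp (measurable_id.add_const _)).pow_const κ).aemeasurable
        rw [← lintegral_tsum hmk]
        refine (lintegral_mono fun z => hC μ hμ z).trans (le_of_eq ?_)
        rw [setLIntegral_const]
        ring
    _ = ((C * V.toNNReal) ^ (1 / κ) : ℝ≥0) * berezinOpNorm p q t α β w μ := by
        rw [ENNReal.mul_rpow_of_nonneg _ _ hκ', ← ENNReal.rpow_mul, mul_one_div_cancel hκ.ne',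
          ENNReal.rpow_one, ENNReal.coe_rpow_of_nonneg _ hκ', ENNReal.coe_mul,
          ENNReal.coe_toNNReal hVt]
    _ ≤ _ := by
        gcongr
        exact le_self_add

end IsFockRegular

/-! ### Normal families -/

/-- The Schwarz lemma: f maps the unit ball at u into a disc of radius 2B about f(u). This supplies
equicontinuity. -/
theorem dist_le_of_norm_le {f : Cn n → ℂ} (hf : Differentiable ℂ f) {u v : Cn n} {B : ℝ}
    (hB : ∀ x ∈ Metric.ball u 1, ‖f x‖ ≤ B) (hv : v ∈ Metric.ball u 1) :
    dist (f v) (f u) ≤ 2 * B * dist v u := by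
  have := Complex.dist_le_div_mul_dist_of_mapsTo_ball (f := f) (c := u) (R₁ := 1) (R₂ := 2 * B)
    hf.differentiableOn (fun x hx => ?_) hv
  · simpa using this
  · rw [mem_closedBall_iff_norm]
    refine (norm_sub_le _ _).trans ?_
    linarith [hB x hx, hB u (Metric.mem_ball_self one_pos)]

/-- A locally bounded sequence of entire functions has a pointwise convergent subsequence. -/
theorem exists_subseq_tendsto {f : ℕ → Cn n → ℂ} (hf : ∀ j, Differentiable ℂ (f j))
    (hB : ∀ R : ℝ, ∃ B : ℝ, ∀ j u, ‖u‖ ≤ R → ‖f j u‖ ≤ B) :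
    ∃ φ : ℕ → ℕ, StrictMono φ ∧ ∃ g : Cn n → ℂ,
      ∀ u, Tendsto (fun j => f (φ j) u) atTop (𝓝 (g u)) := by
  choose B hB using hB
  set d := TopologicalSpace.denseSeq (Cn n)
  -- The values on a dense sequence lie in a product of compact discs, which gives a subsequence
  -- converging there; equicontinuity extends the convergence to all points.
  have hcomp : IsCompact (Set.pi Set.univ fun i => Metric.closedBall (0 : ℂ) (B ‖d i‖)) :=
    isCompact_univ_pi fun i => isCompact_closedBall _ _
  obtain ⟨y, -, φ, hφ, hy⟩ := hcomp.tendsto_subseq (x := fun j i => f j (d i))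
    (fun j i _ => by simpa using hB _ j (d i) le_rfl)
  rw [tendsto_pi_nhds] at hy
  refine ⟨φ, hφ, ?_⟩
  have hcauchy : ∀ u, ∃ l, Tendsto (fun j => f (φ j) u) atTop (𝓝 l) := by
    intro u
    refine cauchySeq_tendsto_of_complete (Metric.cauchySeq_iff'.2 fun ε hε => ?_)
    set L := max (B (‖u‖ + 1)) 1
    have hL : 0 < L := lt_max_of_lt_right one_pos
    have hLip : ∀ j, ∀ v ∈ Metric.ball u 1, dist (f j v) (f j u) ≤ 2 * L * dist v u := by
      intro j v hv
      refine dist_le_of_norm_le (hf j) (fun x hx => ?_) hv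
      refine (hB _ j x ?_).trans (le_max_left _ _)
      have := norm_le_norm_add_norm_sub' x u
      linarith [mem_ball_iff_norm.1 hx]
    obtain ⟨i, hi⟩ := (TopologicalSpace.denseRange_denseSeq (Cn n)).exists_dist_lt u
      (by positivity : 0 < min 1 (ε / (8 * L)))
    rw [dist_comm] at hi
    have hi1 : d i ∈ Metric.ball u 1 := hi.trans_le (min_le_left _ _)
    have hi2 : 2 * L * dist (d i) u ≤ ε / 4 := by
      have := (hi.trans_le (min_le_right _ _)).le
      rw [le_div_iff₀ (by positivity)] at this
      linarith
    obtain ⟨N, hN⟩ := Metric.cauchySeq_iff'.1 (hy i).cauchySeq (ε / 4) (by positivity)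
    refine ⟨N, fun j hj => ?_⟩
    have h1 := hLip (φ j) _ hi1
    have h2 := hLip (φ N) _ hi1
    have h3 := hN j hj
    simp only [Function.comp_apply] at h3
    calc dist (f (φ j) u) (f (φ N) u)
        ≤ dist (f (φ j) u) (f (φ j) (d i)) + dist (f (φ j) (d i)) (f (φ N) (d i)) +
          dist (f (φ N) (d i)) (f (φ N) u) := dist_triangle4 _ _ _ _
      _ < ε := by rw [dist_comm (f (φ j) u)]; linarith
  choose g hg using hcauchy
  exact ⟨g, hg⟩

/-! ### Elementary inequalities in `[0, ∞]` -/

/-- Either b ≤ δa and the power grows by a factor near 1, or a ≤ b/δ and b carries everything. A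
coefficient near 1 lets the main terms cancel in differences for every exponent s. -/
theorem exists_add_rpow_le {s : ℝ} (hs : 0 < s) {ε : ℝ≥0} (hε : 0 < ε) : ∃ C : ℝ≥0,
    ∀ a b : ℝ≥0∞, (a + b) ^ s ≤ (1 + ε) * a ^ s + C * b ^ s := by
  obtain ⟨δ, hδ, hδε⟩ : ∃ δ : ℝ≥0, 0 < δ ∧ (1 + δ) ^ s ≤ 1 + ε := by
    have h1 : Tendsto (fun δ : ℝ≥0 => (1 + δ) ^ s) (𝓝[>] 0) (𝓝 ((1 + 0) ^ s)) := by
      refine Tendsto.mono_left ?_ nhdsWithin_le_nhds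
      have : Continuous fun δ : ℝ≥0 => (1 + δ) ^ s :=
        (NNReal.continuous_rpow_const hs.le).comp (by fun_prop)
      exact this.tendsto 0
    have h2 : ((1 : ℝ≥0) + 0) ^ s < 1 + ε := by simpa using hε
    obtain ⟨δ, h3, h4⟩ := ((h1.eventually (gt_mem_nhds h2)).and self_mem_nhdsWithin).exists
    exact ⟨δ, h4, h3.le⟩
  refine ⟨(δ⁻¹ + 1) ^ s, fun a b => ?_⟩
  have hδ0 : (δ : ℝ≥0∞) ≠ 0 := by exact_mod_cast hδ.ne'
  rcases le_total b (δ * a) with h | h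
  · calc (a + b) ^ s ≤ ((1 + δ : ℝ≥0) * a) ^ s := by
          gcongr
          push_cast
          rw [add_mul, one_mul]
          gcongr
      _ = ((1 + δ) ^ s : ℝ≥0) * a ^ s := by
          rw [ENNReal.mul_rpow_of_nonneg _ _ hs.le, ENNReal.coe_rpow_of_nonneg _ hs.le]
      _ ≤ (1 + ε : ℝ≥0) * a ^ s := by gcongr
      _ ≤ _ := by push_cast; exact le_self_add
  · calc (a + b) ^ s ≤ ((δ⁻¹ + 1 : ℝ≥0) * b) ^ s := by
          gcongr
          push_cast
          rw [add_mul, one_mul, ENNReal.coe_inv hδ.ne', ← ENNReal.div_eq_inv_mul]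
          gcongr
          rwa [ENNReal.le_div_iff_mul_le (Or.inl hδ0) (Or.inl ENNReal.coe_ne_top), mul_comm]
      _ = ((δ⁻¹ + 1) ^ s : ℝ≥0) * b ^ s := by
          rw [ENNReal.mul_rpow_of_nonneg _ _ hs.le, ENNReal.coe_rpow_of_nonneg _ hs.le]
      _ ≤ _ := le_add_self

/-- For finite values one truncated difference vanishes. If exactly one value is ∞ the right side is
∞; if both are, the left side is 0 since `toReal` sends ∞ to 0. -/
theorem enorm_toReal_sub_toReal_le (a b : ℝ≥0∞) :
    ‖a.toReal - b.toReal‖ₑ ≤ (a - b) + (b - a) := by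
  rcases eq_or_ne a ∞ with rfl | ha
  · rcases eq_or_ne b ∞ with rfl | hb
    · simp
    · simp [ENNReal.top_sub hb]
  rcases eq_or_ne b ∞ with rfl | hb
  · simp [ENNReal.top_sub ha]
  rcases le_total a b with h | h
  · rw [← neg_sub, enorm_neg, ← ENNReal.toReal_sub_of_le h hb, Real.enorm_toReal
      (ENNReal.sub_ne_top hb)]
    exact le_add_self
  · rw [← ENNReal.toReal_sub_of_le h ha, Real.enorm_toReal (ENNReal.sub_ne_top ha)]
    exact le_self_add

theorem add_rpow_le_two_rpow (x y : ℝ≥0∞) {q : ℝ} (hq : 0 < q) :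
    (x + y) ^ q ≤ 2 ^ q * (x ^ q + y ^ q) := by
  have h : x + y ≤ 2 * max x y := by
    rw [two_mul]
    exact add_le_add (le_max_left _ _) (le_max_right _ _)
  calc (x + y) ^ q ≤ (2 * max x y) ^ q := by gcongr
    _ = 2 ^ q * max x y ^ q := ENNReal.mul_rpow_of_nonneg _ _ hq.le
    _ ≤ _ := by
      gcongr
      rcases le_total x y with h | h
      · rw [max_eq_right h]; exact le_add_self
      · rw [max_eq_left h]; exact le_self_add

theorem exists_mul_rpow_le {c η : ℝ≥0∞} (hc : c ≠ ∞) (hη : 0 < η) {q : ℝ} (hq : 0 < q) :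
    ∃ ε : ℝ≥0, 0 < ε ∧ c * (ε : ℝ≥0∞) ^ q ≤ η := by
  have h1 : Tendsto (fun ε : ℝ≥0 => c * (ε : ℝ≥0∞) ^ q) (𝓝[>] 0) (𝓝 (c * ((0 : ℝ≥0) : ℝ≥0∞) ^ q)) := by
    refine Tendsto.mono_left ?_ nhdsWithin_le_nhds
    have : Continuous fun ε : ℝ≥0 => c * (ε : ℝ≥0∞) ^ q :=
      (ENNReal.continuous_const_mul hc).comp
        (ENNReal.continuous_rpow_const.comp ENNReal.continuous_coe)
    exact this.tendsto 0
  have h2 : c * ((0 : ℝ≥0) : ℝ≥0∞) ^ q < η := by simpa [hq] using hη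
  obtain ⟨ε, h3, h4⟩ := ((h1.eventually (gt_mem_nhds h2)).and self_mem_nhdsWithin).exists
  exact ⟨ε, h4, h3.le⟩

theorem liminf_rpow {s : ℝ} (hs : 0 < s) (u : ℕ → ℝ≥0∞) :
    liminf u atTop ^ s = liminf (fun j => u j ^ s) atTop :=
  (ENNReal.orderIsoRpow s hs).liminf_apply

/-! ### Measurability and Fatou's lemma for the operator -/

theorem measurable_fockAbs_of_measurable {α : ℝ} {f : Cn n → ℂ} (hf : Measurable f) :
    Measurable (fockAbs α f) := by
  unfold fockAbs
  refine ENNReal.measurable_ofReal.comp (hf.norm.mul ?_)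
  exact (by fun_prop : Continuous fun u : Cn n => Real.exp (-(α / 2) * ‖u‖ ^ 2)).measurable

/-- The integrand of the operator. -/
def berezinInt (t α β : ℝ) (f : Cn n → ℂ) (z u : Cn n) : ℝ≥0∞ :=
  ENNReal.ofReal (Real.exp (-(β / 2) * ‖z - u‖ ^ 2)) * fockAbs α f u ^ t

theorem berezinOp_eq_lintegral {t : ℝ} (ht : 0 < t) (α β : ℝ) (μ : Measure (Cn n)) (f : Cn n → ℂ)
    (z : Cn n) : berezinOp t α β μ f z = (∫⁻ u, berezinInt t α β f z u ∂μ) ^ (1 / t) :=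
  berezinOp_eq ht α β μ f z

theorem measurable_berezinInt {t α β : ℝ} {f : Cn n → ℂ} (hf : Measurable f) :
    Measurable fun x : Cn n × Cn n => berezinInt t α β f x.1 x.2 := by
  refine Measurable.mul ?_ (((measurable_fockAbs_of_measurable hf).comp measurable_snd).pow_const _)
  exact ENNReal.measurable_ofReal.comp (by fun_prop : Continuous fun x : Cn n × Cn n =>
    Real.exp (-(β / 2) * ‖x.1 - x.2‖ ^ 2)).measurable

theorem measurable_berezinInt_right {t α β : ℝ} {f : Cn n → ℂ} (hf : Measurable f) (z : Cn n) :
    Measurable fun u => berezinInt t α β f z u := by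
  refine Measurable.mul ?_ ((measurable_fockAbs_of_measurable hf).pow_const _)
  exact ENNReal.measurable_ofReal.comp (by fun_prop : Continuous fun u : Cn n =>
    Real.exp (-(β / 2) * ‖z - u‖ ^ 2)).measurable

theorem measurable_lintegral_berezinInt {t α β : ℝ} (μ : Measure (Cn n)) [SFinite μ] {f : Cn n → ℂ}
    (hf : Measurable f) : Measurable fun z => ∫⁻ u, berezinInt t α β f z u ∂μ :=
  (measurable_berezinInt hf).lintegral_prod_right'

theorem measurable_berezinOp {t α β : ℝ} (ht : 0 < t) (μ : Measure (Cn n)) [SFinite μ]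
    {f : Cn n → ℂ} (hf : Measurable f) : Measurable (berezinOp t α β μ f) := by
  have : berezinOp t α β μ f = fun z => (∫⁻ u, berezinInt t α β f z u ∂μ) ^ (1 / t) :=
    funext (berezinOp_eq_lintegral ht α β μ f)
  rw [this]
  exact (measurable_lintegral_berezinInt μ hf).pow_const _

theorem tendsto_berezinInt {t α β : ℝ} {f : ℕ → Cn n → ℂ} {g : Cn n → ℂ}
    (h : ∀ u, Tendsto (fun j => f j u) atTop (𝓝 (g u))) (z u : Cn n) :
    Tendsto (fun j => berezinInt t α β (f j) z u) atTop (𝓝 (berezinInt t α β g z u)) := by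
  unfold berezinInt fockAbs
  refine ENNReal.Tendsto.const_mul ?_ (Or.inr ENNReal.ofReal_ne_top)
  refine (ENNReal.continuous_rpow_const.tendsto _).comp ?_
  exact ENNReal.tendsto_ofReal ((h u).norm.mul_const _)

theorem berezinOp_le_liminf {t α β : ℝ} (ht : 0 < t) (μ : Measure (Cn n))
    {f : ℕ → Cn n → ℂ} {g : Cn n → ℂ} (hf : ∀ j, Measurable (f j))
    (h : ∀ u, Tendsto (fun j => f j u) atTop (𝓝 (g u))) (z : Cn n) :
    berezinOp t α β μ g z ≤ liminf (fun j => berezinOp t α β μ (f j) z) atTop := by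
  have h1 : ∫⁻ u, berezinInt t α β g z u ∂μ ≤
      liminf (fun j => ∫⁻ u, berezinInt t α β (f j) z u ∂μ) atTop := by
    refine le_trans (le_of_eq ?_) (lintegral_liminf_le fun j =>
      measurable_berezinInt_right (hf j) z)
    exact lintegral_congr fun u => (tendsto_berezinInt h z u).liminf_eq.symm
  have ht' : 0 < 1 / t := by positivity
  simp_rw [berezinOp_eq_lintegral ht]
  exact (ENNReal.rpow_le_rpow h1 ht'.le).trans_eq (liminf_rpow ht' _)

/-- Fatou's lemma, in μ and then in W. It bounds the image of a pointwise limit without membership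
of the limit in the Fock space. -/
theorem lintegral_berezinOp_le_of_tendsto {q t α β : ℝ} (hq : 0 < q) (ht : 0 < t)
    (W μ : Measure (Cn n)) [SFinite μ] {f : ℕ → Cn n → ℂ} {g : Cn n → ℂ}
    (hf : ∀ j, Measurable (f j)) (h : ∀ u, Tendsto (fun j => f j u) atTop (𝓝 (g u))) {N : ℝ≥0∞}
    (hN : ∀ j, ∫⁻ z, berezinOp t α β μ (f j) z ^ q ∂W ≤ N) :
    ∫⁻ z, berezinOp t α β μ g z ^ q ∂W ≤ N := by
  calc _ ≤ ∫⁻ z, liminf (fun j => berezinOp t α β μ (f j) z ^ q) atTop ∂W := by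
        refine lintegral_mono fun z => ?_
        exact (ENNReal.rpow_le_rpow (berezinOp_le_liminf ht μ hf h z) hq.le).trans_eq
          (liminf_rpow hq _)
    _ ≤ liminf (fun j => ∫⁻ z, berezinOp t α β μ (f j) z ^ q ∂W) atTop :=
        lintegral_liminf_le fun j => (measurable_berezinOp ht μ (hf j)).pow_const q
    _ ≤ liminf (fun _ : ℕ => N) atTop := liminf_le_liminf (Eventually.of_forall hN)
    _ = N := liminf_const N

namespace IsFockRegular

variable {w : Cn n → ℝ}

/-- Convergence for the part of the measure in a compact set. -/
theorem tendsto_lintegral_sub_restrict (hW : IsFockRegular (weightMeasure w)) {q t α β : ℝ}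
    (hq : 0 < q) (ht : 0 < t) (hα : 0 < α) (hβ : 0 < β) (μ : Measure (Cn n))
    [IsFiniteMeasureOnCompacts μ] {f : ℕ → Cn n → ℂ} {g : Cn n → ℂ} (hf : ∀ j, Measurable (f j))
    (hg : Measurable g) (h : ∀ u, Tendsto (fun j => f j u) atTop (𝓝 (g u)))
    (hB : ∀ R : ℝ, ∃ B : ℝ, ∀ j u, ‖u‖ ≤ R → ‖f j u‖ ≤ B) (R : ℝ) :
    Tendsto (fun j => ∫⁻ z,
      ((berezinOp t α β (μ.restrict (Metric.closedBall 0 R)) (f j) z -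
        berezinOp t α β (μ.restrict (Metric.closedBall 0 R)) g z) +
      (berezinOp t α β (μ.restrict (Metric.closedBall 0 R)) g z -
        berezinOp t α β (μ.restrict (Metric.closedBall 0 R)) (f j) z)) ^ q ∂weightMeasure w)
      atTop (𝓝 0) := by
  set K := Metric.closedBall (0 : Cn n) R
  set ν := μ.restrict K
  have hK : MeasurableSet K := Metric.isClosed_closedBall.measurableSet
  have hνfin : ν Set.univ < ∞ := by
    rw [Measure.restrict_apply_univ]
    exact (isCompact_closedBall _ _).measure_lt_top
  obtain ⟨B', hB'⟩ := hB R
  set B := max B' 0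
  have hB0 : 0 ≤ B := le_max_right _ _
  have hfB : ∀ j, ∀ u ∈ K, fockAbs α (f j) u ≤ ENNReal.ofReal B := by
    intro j u hu
    refine ENNReal.ofReal_le_ofReal ?_
    have h1 : ‖f j u‖ ≤ B := (hB' j u (by simpa [K] using hu)).trans (le_max_left _ _)
    have h2 : Real.exp (-(α / 2) * ‖u‖ ^ 2) ≤ 1 := by
      refine Real.exp_le_one_iff.2 ?_
      nlinarith [sq_nonneg ‖u‖]
    calc _ ≤ B * 1 := by gcongr
      _ = B := mul_one B
  obtain ⟨γ₀, hγ₀, C₀, -, -, hint⟩ := hW.exists_growth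
  have hqt : 0 < q / t := div_pos hq ht
  -- The majorant D below is a power of e^{-γ|z|}; with this rate D^q decays like e^{-γ₀|z|}, which
  -- is integrable against W.
  set γ := γ₀ / (q / t)
  have hγ : 0 < γ := div_pos hγ₀ hqt
  obtain ⟨Cg, hCg⟩ := exists_gaussian_le (n := n) (half_pos hβ) γ
  set b : ℝ≥0∞ := Cg * ENNReal.ofReal (Real.exp (γ * R)) * ENNReal.ofReal B ^ t * ν Set.univ
  have hbt : b ≠ ∞ := by
    have : ENNReal.ofReal B ^ t ≠ ∞ := ENNReal.rpow_ne_top_of_nonneg ht.le ENNReal.ofReal_ne_top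
    finiteness
  set D : Cn n → ℝ≥0∞ := fun z => (b * expKer γ z 0) ^ (1 / t)
  have hDt : ∀ z, D z ≠ ∞ := fun z =>
    ENNReal.rpow_ne_top_of_nonneg (by positivity) (ENNReal.mul_ne_top hbt (expKer_ne_top _ _ _))
  have hfD : ∀ j z, berezinOp t α β ν (f j) z ≤ D z := by
    intro j z
    rw [berezinOp_eq_lintegral ht]
    refine ENNReal.rpow_le_rpow ?_ (by positivity)
    calc _ ≤ ∫⁻ _ in K, Cg * (ENNReal.ofReal (Real.exp (γ * R)) * expKer γ z 0) *
          ENNReal.ofReal B ^ t ∂μ := by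
          refine setLIntegral_mono' hK fun u hu => ?_
          unfold berezinInt
          gcongr
          · refine (hCg z u).trans ?_
            gcongr
            exact expKer_shift hγ.le z (by simpa [K] using hu)
          · exact hfB j u hu
      _ = _ := by
          rw [lintegral_const]
          ring
  have hgD : ∀ z, berezinOp t α β ν g z ≤ D z := fun z =>
    (berezinOp_le_liminf ht ν hf h z).trans
      ((liminf_le_liminf (Eventually.of_forall fun j => hfD j z)).trans_eq (liminf_const _))
  have hν : SFinite ν := inferInstance
  -- Dominated convergence in u, with a constant majorant on the finite measure ν; a second
  -- application, in z, uses D.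
  have hlim : ∀ z, Tendsto (fun j => berezinOp t α β ν (f j) z) atTop
      (𝓝 (berezinOp t α β ν g z)) := by
    intro z
    simp_rw [berezinOp_eq_lintegral ht]
    refine (ENNReal.continuous_rpow_const.tendsto _).comp ?_
    refine tendsto_lintegral_of_dominated_convergence (fun _ => ENNReal.ofReal B ^ t)
      (fun j => measurable_berezinInt_right (hf j) z) (fun j => ?_) ?_ ?_
    · refine (ae_restrict_iff' hK).2 (ae_of_all _ fun u hu => ?_)
      unfold berezinInt
      calc _ ≤ 1 * ENNReal.ofReal B ^ t := by
            gcongr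
            · refine ENNReal.ofReal_le_one.2 (Real.exp_le_one_iff.2 ?_)
              nlinarith [sq_nonneg ‖z - u‖]
            · exact hfB j u hu
        _ = _ := one_mul _
    · rw [lintegral_const]
      exact ENNReal.mul_ne_top (ENNReal.rpow_ne_top_of_nonneg ht.le ENNReal.ofReal_ne_top) hνfin.ne
    · exact ae_of_all _ fun u => tendsto_berezinInt h z u
  have hmf := fun j => measurable_berezinOp (α := α) (β := β) ht ν (hf j)
  have hmg := measurable_berezinOp (α := α) (β := β) ht ν hg
  have hz : ∀ z, Tendsto (fun j => ((berezinOp t α β ν (f j) z - berezinOp t α β ν g z) +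
      (berezinOp t α β ν g z - berezinOp t α β ν (f j) z)) ^ q) atTop (𝓝 0) := by
    intro z
    have hgt : berezinOp t α β ν g z ≠ ∞ := ((hgD z).trans_lt (hDt z).lt_top).ne
    have h1 := ENNReal.Tendsto.sub (hlim z) (tendsto_const_nhds (x := berezinOp t α β ν g z))
      (Or.inl hgt)
    have h2 := ENNReal.Tendsto.sub (tendsto_const_nhds (x := berezinOp t α β ν g z)) (hlim z)
      (Or.inl hgt)
    have h3 := (ENNReal.continuous_rpow_const (y := q)).tendsto _ |>.comp (h1.add h2)
    simpa [hq, Function.comp_def] using h3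
  have hdom : ∫⁻ z, (D z + D z) ^ q ∂weightMeasure w ≠ ∞ := by
    have e : ∀ z, (D z + D z) ^ q = (2 ^ q * b ^ (q / t)) * expKer γ₀ z 0 := by
      intro z
      rw [← two_mul, ENNReal.mul_rpow_of_nonneg _ _ hq.le, ← ENNReal.rpow_mul, one_div_mul_eq_div,
        ENNReal.mul_rpow_of_nonneg _ _ hqt.le, expKer_rpow _ hqt.le, div_mul_cancel₀ _ hqt.ne']
      ring
    simp_rw [e]
    have hc : (2 : ℝ≥0∞) ^ q * b ^ (q / t) ≠ ∞ := ENNReal.mul_ne_top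
      (ENNReal.rpow_ne_top_of_nonneg hq.le (by simp)) (ENNReal.rpow_ne_top_of_nonneg hqt.le hbt)
    rw [lintegral_const_mul' _ _ hc]
    refine ENNReal.mul_ne_top hc ((hint 0).trans_lt ?_).ne
    exact ENNReal.mul_lt_top ENNReal.coe_lt_top (hW.measure_ball_lt_top 0)
  have := tendsto_lintegral_of_dominated_convergence (μ := weightMeasure w)
    (fun z => (D z + D z) ^ q)
    (fun j => (((hmf j).sub hmg).add (hmg.sub (hmf j))).pow_const q)
    (fun j => ae_of_all _ fun z => ENNReal.rpow_le_rpow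
      (add_le_add (tsub_le_self.trans (hfD j z)) (tsub_le_self.trans (hgD z))) hq.le) hdom
    (ae_of_all _ hz)
  simpa using this

/-- The operator is continuous along bounded pointwise convergent sequences if the parts of the
measure far away contribute uniformly little. -/
theorem tendsto_lintegral_toReal_sub (hW : IsFockRegular (weightMeasure w)) {q t α β : ℝ}
    (hq : 0 < q) (ht : 0 < t) (hα : 0 < α) (hβ : 0 < β) (μ : Measure (Cn n))
    [IsFiniteMeasureOnCompacts μ] {f : ℕ → Cn n → ℂ} {g : Cn n → ℂ} (hf : ∀ j, Measurable (f j))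
    (hg : Measurable g) (h : ∀ u, Tendsto (fun j => f j u) atTop (𝓝 (g u)))
    (hB : ∀ R : ℝ, ∃ B : ℝ, ∀ j u, ‖u‖ ≤ R → ‖f j u‖ ≤ B) {N : ℝ≥0∞} (hNt : N ≠ ∞)
    (hN : ∀ j, ∫⁻ z, berezinOp t α β μ (f j) z ^ q ∂weightMeasure w ≤ N)
    (htail : ∀ η : ℝ≥0∞, 0 < η → ∃ R : ℝ, ∀ j,
      ∫⁻ z, berezinOp t α β (μ.restrict (Metric.closedBall 0 R)ᶜ) (f j) z ^ q
        ∂weightMeasure w ≤ η) :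
    Tendsto (fun j => ∫⁻ z, ‖(berezinOp t α β μ (f j) z).toReal -
      (berezinOp t α β μ g z).toReal‖ₑ ^ q ∂weightMeasure w) atTop (𝓝 0) := by
  rw [ENNReal.tendsto_nhds_zero]
  intro η hη
  have hμ : SFinite μ := inferInstance
  have hs : 0 < 1 / t := by positivity
  set c : ℝ≥0∞ := 2 ^ q * 2 ^ q * 2 ^ q with hc
  have h2t : (2 : ℝ≥0∞) ^ q ≠ ∞ := ENNReal.rpow_ne_top_of_nonneg hq.le (by simp)
  have hct : c ≠ ∞ := by finiteness
  -- Order of the choices: ε from the norm bound N, then C from ε, then δ from C, and only then the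
  -- radius R.
  obtain ⟨ε, hε, hεη⟩ := exists_mul_rpow_le (c := c * (N + N)) (η := η / 3) (by finiteness)
    (ENNReal.div_pos hη.ne' (by simp)) hq
  obtain ⟨C, hC⟩ := exists_add_rpow_le hs hε
  have hCt : (C : ℝ≥0∞) ^ q ≠ ∞ := ENNReal.rpow_ne_top_of_nonneg hq.le ENNReal.coe_ne_top
  obtain ⟨δ, hδ, hδη⟩ := exists_mul_rpow_le (c := c * C ^ q * 2) (η := η / 3) (by finiteness)
    (ENNReal.div_pos hη.ne' (by simp)) one_pos
  rw [ENNReal.rpow_one] at hδη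
  obtain ⟨R, htail⟩ := htail δ (by exact_mod_cast hδ)
  set K := Metric.closedBall (0 : Cn n) R
  have hK : MeasurableSet K := Metric.isClosed_closedBall.measurableSet
  have htg := lintegral_berezinOp_le_of_tendsto hq ht (weightMeasure w) (μ.restrict Kᶜ) hf h htail
  have hNg := lintegral_berezinOp_le_of_tendsto hq ht (weightMeasure w) μ hf h hN
  set I : ℕ → Cn n → ℝ≥0∞ := fun j z =>
    (berezinOp t α β (μ.restrict K) (f j) z - berezinOp t α β (μ.restrict K) g z) +
      (berezinOp t α β (μ.restrict K) g z - berezinOp t α β (μ.restrict K) (f j) z)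
  have hmI : ∀ j, Measurable (I j) := fun j =>
    have h1 := measurable_berezinOp (α := α) (β := β) ht (μ.restrict K) (hf j)
    have h2 := measurable_berezinOp (α := α) (β := β) ht (μ.restrict K) hg
    (h1.sub h2).add (h2.sub h1)
  have hI : Tendsto (fun j => c * ∫⁻ z, I j z ^ q ∂weightMeasure w) atTop (𝓝 (c * 0)) :=
    ENNReal.Tendsto.const_mul
      (hW.tendsto_lintegral_sub_restrict hq ht hα hβ μ hf hg h hB R) (Or.inr hct)
  rw [mul_zero, ENNReal.tendsto_nhds_zero] at hI
  have hsplit : ∀ (φ : Cn n → ℂ) z, berezinOp t α β μ φ z ≤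
      (1 + ε) * berezinOp t α β (μ.restrict K) φ z + C * berezinOp t α β (μ.restrict Kᶜ) φ z := by
    intro φ z
    rw [berezinOp_eq_lintegral ht, berezinOp_eq_lintegral ht, berezinOp_eq_lintegral ht,
      ← lintegral_add_compl _ hK]
    exact hC _ _
  have hmono : ∀ (φ : Cn n → ℂ) z, berezinOp t α β (μ.restrict K) φ z ≤ berezinOp t α β μ φ z := by
    intro φ z
    rw [berezinOp_eq_lintegral ht, berezinOp_eq_lintegral ht]
    exact ENNReal.rpow_le_rpow (setLIntegral_le_lintegral _ _) hs.le
  -- The difference is reduced to the compact part, at the cost of ε times the whole and C times the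
  -- tail of φ only.
  have hdiff : ∀ (φ ψ : Cn n → ℂ) z, berezinOp t α β μ φ z - berezinOp t α β μ ψ z ≤
      (berezinOp t α β (μ.restrict K) φ z - berezinOp t α β (μ.restrict K) ψ z) +
        ε * berezinOp t α β μ φ z + C * berezinOp t α β (μ.restrict Kᶜ) φ z := by
    intro φ ψ z
    rw [tsub_le_iff_right]
    refine (hsplit φ z).trans ?_
    rw [add_mul, one_mul]
    calc _ ≤ ((berezinOp t α β (μ.restrict K) φ z - berezinOp t α β (μ.restrict K) ψ z) +
          berezinOp t α β μ ψ z + ε * berezinOp t α β μ φ z) +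
          C * berezinOp t α β (μ.restrict Kᶜ) φ z := by
          gcongr
          · exact le_tsub_add.trans (add_le_add_right (hmono ψ z) _)
          · exact hmono φ z
      _ = _ := by ring
  set P : (Cn n → ℂ) → Cn n → ℝ≥0∞ := fun φ z => berezinOp t α β μ φ z
  set Q : (Cn n → ℂ) → Cn n → ℝ≥0∞ := fun φ z => berezinOp t α β (μ.restrict Kᶜ) φ z
  have hpt : ∀ j z, ‖(P (f j) z).toReal - (P g z).toReal‖ₑ ^ q ≤
      c * (I j z ^ q + (ε : ℝ≥0∞) ^ q * (P (f j) z ^ q + P g z ^ q) +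
        (C : ℝ≥0∞) ^ q * (Q (f j) z ^ q + Q g z ^ q)) := by
    intro j z
    have h1 : ‖(P (f j) z).toReal - (P g z).toReal‖ₑ ≤
        I j z + (ε * (P (f j) z + P g z) + C * (Q (f j) z + Q g z)) := by
      refine (enorm_toReal_sub_toReal_le _ _).trans
        ((add_le_add (hdiff (f j) g z) (hdiff g (f j) z)).trans (le_of_eq ?_))
      simp only [I, P, Q]
      ring
    have h2 : 1 ≤ (2 : ℝ≥0∞) ^ q := ENNReal.one_le_rpow (by norm_num) hq
    calc _ ≤ (I j z + (ε * (P (f j) z + P g z) + C * (Q (f j) z + Q g z))) ^ q := by gcongr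
      _ ≤ 2 ^ q * (I j z ^ q + 2 ^ q * ((ε * (P (f j) z + P g z)) ^ q +
            (C * (Q (f j) z + Q g z)) ^ q)) := by
          refine (add_rpow_le_two_rpow _ _ hq).trans ?_
          gcongr
          exact add_rpow_le_two_rpow _ _ hq
      _ ≤ 2 ^ q * (2 ^ q * 2 ^ q * I j z ^ q + 2 ^ q * ((ε : ℝ≥0∞) ^ q * (2 ^ q *
            (P (f j) z ^ q + P g z ^ q)) + (C : ℝ≥0∞) ^ q * (2 ^ q *
            (Q (f j) z ^ q + Q g z ^ q)))) := by
          rw [ENNReal.mul_rpow_of_nonneg _ _ hq.le, ENNReal.mul_rpow_of_nonneg _ _ hq.le]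
          gcongr
          · calc I j z ^ q = 1 * 1 * I j z ^ q := by ring
              _ ≤ _ := by gcongr
          · exact add_rpow_le_two_rpow _ _ hq
          · exact add_rpow_le_two_rpow _ _ hq
      _ = _ := by rw [hc]; ring
  have hmP : ∀ φ : Cn n → ℂ, Measurable φ → Measurable (P φ) := fun φ hφ =>
    measurable_berezinOp ht μ hφ
  have hmQ : ∀ φ : Cn n → ℂ, Measurable φ → Measurable (Q φ) := fun φ hφ =>
    measurable_berezinOp ht _ hφ
  filter_upwards [hI (η / 3) (ENNReal.div_pos hη.ne' (by simp))] with j hj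
  have hεt : (ε : ℝ≥0∞) ^ q ≠ ∞ := ENNReal.rpow_ne_top_of_nonneg hq.le ENNReal.coe_ne_top
  calc _ ≤ ∫⁻ z, c * (I j z ^ q + (ε : ℝ≥0∞) ^ q * (P (f j) z ^ q + P g z ^ q) +
        (C : ℝ≥0∞) ^ q * (Q (f j) z ^ q + Q g z ^ q)) ∂weightMeasure w := lintegral_mono (hpt j)
    _ = c * (∫⁻ z, I j z ^ q ∂weightMeasure w +
        (ε : ℝ≥0∞) ^ q * (∫⁻ z, P (f j) z ^ q ∂weightMeasure w + ∫⁻ z, P g z ^ q ∂weightMeasure w) +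
        (C : ℝ≥0∞) ^ q * (∫⁻ z, Q (f j) z ^ q ∂weightMeasure w +
          ∫⁻ z, Q g z ^ q ∂weightMeasure w)) := by
        have m1 := (hmI j).pow_const q
        have m2 := (hmP _ (hf j)).pow_const q
        have m3 := (hmP _ hg).pow_const q
        have m4 := (hmQ _ (hf j)).pow_const q
        have m5 := (hmQ _ hg).pow_const q
        have m6 : Measurable fun z => Q (f j) z ^ q + Q g z ^ q := m4.add m5
        rw [lintegral_const_mul' _ _ hct, lintegral_add_right _ (m6.const_mul _),
          lintegral_add_left m1, lintegral_const_mul' _ _ hεt, lintegral_const_mul' _ _ hCt,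
          lintegral_add_left m2, lintegral_add_left m4]
    _ ≤ c * (∫⁻ z, I j z ^ q ∂weightMeasure w + (ε : ℝ≥0∞) ^ q * (N + N) +
        (C : ℝ≥0∞) ^ q * (δ + δ)) := by
        gcongr
        · exact hN j
        · exact htail j
    _ = c * ∫⁻ z, I j z ^ q ∂weightMeasure w + c * (N + N) * (ε : ℝ≥0∞) ^ q +
        c * (C : ℝ≥0∞) ^ q * 2 * δ := by ring
    _ ≤ η / 3 + η / 3 + η / 3 := by gcongr
    _ = η := ENNReal.add_thirds η

end IsFockRegular

/-! ### The metric of `L^q` -/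

/-- Points of the closure are replaced by points of S at distance less than 1/(j+1), so subsequences
need to be found only within S. -/
theorem isCompact_closure_of_exists_subseq {X : Type*} [PseudoEMetricSpace X] {S : Set X}
    (h : ∀ x : ℕ → X, (∀ j, x j ∈ S) →
      ∃ y, ∃ φ : ℕ → ℕ, StrictMono φ ∧ Tendsto (x ∘ φ) atTop (𝓝 y)) :
    IsCompact (closure S) := by
  rw [isCompact_iff_isSeqCompact]
  intro x hx
  have h1 : ∀ j : ℕ, ∃ s ∈ S, edist (x j) s < ((j : ℝ≥0∞) + 1)⁻¹ := fun j =>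
    EMetric.mem_closure_iff.1 (hx j) _ (ENNReal.inv_pos.2 (by finiteness))
  choose s hs hxs using h1
  obtain ⟨y, φ, hφ, hy⟩ := h s hs
  refine ⟨y, mem_closure_of_tendsto hy (Eventually.of_forall fun j => hs _), φ, hφ, ?_⟩
  rw [tendsto_iff_edist_tendsto_0] at hy ⊢
  have h2 : Tendsto (fun j => ((φ j : ℝ≥0∞) + 1)⁻¹) atTop (𝓝 0) := by
    have h3 : Tendsto (fun j : ℕ => ((j : ℝ≥0∞) + 1)⁻¹) atTop (𝓝 0) := by
      refine tendsto_of_tendsto_of_tendsto_of_le_of_le tendsto_const_nhds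
        ENNReal.tendsto_inv_nat_nhds_zero (fun _ => zero_le) fun j => ?_
      exact ENNReal.inv_le_inv.2 le_self_add
    exact h3.comp hφ.tendsto_atTop
  refine tendsto_of_tendsto_of_tendsto_of_le_of_le tendsto_const_nhds
    (by simpa using h2.add hy) (fun _ => zero_le) fun j => ?_
  exact (edist_triangle _ _ _).trans (add_le_add (hxs _).le le_rfl)

section Lq

variable {X : Type*} [MeasurableSpace X] {ν : Measure X} {q : ℝ}

theorem eLpNorm_real (hq : 0 < q) (ν : Measure X) (g : X → ℝ) :
    eLpNorm g (ENNReal.ofReal q) ν = (∫⁻ z, ‖g z‖ₑ ^ q ∂ν) ^ (1 / q) := by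
  rw [eLpNorm_eq_lintegral_rpow_enorm_toReal (by simpa using hq) ENNReal.ofReal_ne_top,
    ENNReal.toReal_ofReal hq.le]

theorem lqMetric_edist (hq : 0 < q) (x y : Lp ℝ (ENNReal.ofReal q) ν) :
    (lqMetric q hq ν).edist x y = (∫⁻ z, ‖x z - y z‖ₑ ^ q ∂ν) ^ (min 1 q / q) := by
  change eLpNorm (⇑x - ⇑y) (ENNReal.ofReal q) ν ^ min 1 q = _
  rw [eLpNorm_real hq, ← ENNReal.rpow_mul, one_div_mul_eq_div]
  rfl

theorem tendsto_lqMetric (hq : 0 < q) {x : ℕ → Lp ℝ (ENNReal.ofReal q) ν}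
    {y : Lp ℝ (ENNReal.ofReal q) ν}
    (h : Tendsto (fun j => ∫⁻ z, ‖x j z - y z‖ₑ ^ q ∂ν) atTop (𝓝 0)) :
    letI := lqMetric q hq ν
    Tendsto x atTop (𝓝 y) := by
  let _ := lqMetric q hq ν
  have hm : 0 < min 1 q / q := div_pos (lt_min one_pos hq) hq
  rw [tendsto_iff_edist_tendsto_0]
  change Tendsto (fun j => (lqMetric q hq ν).edist (x j) y) atTop (𝓝 0)
  simp_rw [lqMetric_edist]
  have h2 := (ENNReal.continuous_rpow_const (y := min 1 q / q)).tendsto 0 |>.comp h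
  rwa [ENNReal.zero_rpow_of_pos hm] at h2

theorem lintegral_enorm_rpow_lt_top (hq : 0 < q) (x : Lp ℝ (ENNReal.ofReal q) ν) :
    ∫⁻ z, ‖x z‖ₑ ^ q ∂ν < ∞ := by
  have := Lp.eLpNorm_lt_top x
  rw [eLpNorm_real hq] at this
  exact (ENNReal.rpow_lt_top_iff_of_pos (by positivity)).1 this

theorem memLp_ennreal_iff (hq : 0 < q) {u : X → ℝ≥0∞} (hu : Measurable u) :
    MemLp u (ENNReal.ofReal q) ν ↔ ∫⁻ z, u z ^ q ∂ν < ∞ := by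
  rw [MemLp, eLpNorm_ennreal hq, ENNReal.rpow_lt_top_iff_of_pos (by positivity)]
  exact and_iff_right hu.aestronglyMeasurable

theorem lintegral_lt_top_of_memLp (hq : 0 < q) {u : X → ℝ≥0∞} (h : MemLp u (ENNReal.ofReal q) ν) :
    ∫⁻ z, u z ^ q ∂ν < ∞ := by
  have := h.2
  rwa [eLpNorm_ennreal hq, ENNReal.rpow_lt_top_iff_of_pos (by positivity)] at this

theorem memLp_toReal (hq : 0 < q) {u : X → ℝ≥0∞} (h : MemLp u (ENNReal.ofReal q) ν) :
    MemLp (fun z => (u z).toReal) (ENNReal.ofReal q) ν := by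
  refine ⟨h.1.aemeasurable.ennreal_toReal.aestronglyMeasurable, ?_⟩
  rw [eLpNorm_real hq, ENNReal.rpow_lt_top_iff_of_pos (by positivity)]
  refine (lintegral_mono fun z => ?_).trans_lt (lintegral_lt_top_of_memLp hq h)
  gcongr
  rw [Real.enorm_eq_ofReal ENNReal.toReal_nonneg]
  exact ENNReal.ofReal_toReal_le

/-- Finiteness of the L^q norm excludes the value ∞ almost everywhere, so `toReal` loses nothing. -/
theorem ae_enorm_toReal (hq : 0 < q) {u : X → ℝ≥0∞} (h : MemLp u (ENNReal.ofReal q) ν) :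
    ∀ᵐ z ∂ν, ‖(u z).toReal‖ₑ = u z := by
  filter_upwards [ae_lt_top' (h.1.aemeasurable.pow_const q) (lintegral_lt_top_of_memLp hq h).ne]
    with z hz
  exact Real.enorm_toReal ((ENNReal.rpow_lt_top_iff_of_pos hq).1 hz).ne

end Lq

theorem tendsto_setLIntegral_compl_closedBall (ν : Measure (Cn n)) {F : Cn n → ℝ≥0∞}
    (hF : ∫⁻ z, F z ∂ν ≠ ∞) :
    Tendsto (fun R : ℝ => ∫⁻ z in (Metric.closedBall 0 R)ᶜ, F z ∂ν) atTop (𝓝 0) := by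
  have hm : ∀ R : ℝ, MeasurableSet (Metric.closedBall (0 : Cn n) R)ᶜ := fun R =>
    Metric.isClosed_closedBall.measurableSet.compl
  simp_rw [← withDensity_apply F (hm _)]
  have h1 := tendsto_measure_iInter_atTop (μ := ν.withDensity F)
    (s := fun R : ℝ => (Metric.closedBall (0 : Cn n) R)ᶜ) (fun R => (hm R).nullMeasurableSet)
    (fun a b hab => Set.compl_subset_compl.2 (Metric.closedBall_subset_closedBall hab))
    ⟨0, ((measure_mono (Set.subset_univ _)).trans_lt
      (by rw [withDensity_apply _ MeasurableSet.univ, Measure.restrict_univ]; exact hF.lt_top)).ne⟩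
  have h2 : ⋂ R : ℝ, (Metric.closedBall (0 : Cn n) R)ᶜ = ∅ := by
    rw [← Set.compl_iUnion, Set.compl_empty_iff, Set.eq_univ_iff_forall]
    exact fun z => Set.mem_iUnion.2 ⟨‖z‖, by simp⟩
  rwa [h2, measure_empty] at h1

namespace IsFockRegular

variable {w : Cn n → ℝ}

theorem exists_measure_ball_le {W : Measure (Cn n)} (hW : IsFockRegular W) (R : ℝ) : ∃ K : ℝ≥0∞,
    K ≠ ∞ ∧ ∀ z, ‖z‖ ≤ R → W (Metric.ball 0 1) ≤ K * W (Metric.ball z 1) := by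
  obtain ⟨C, A, hA, h⟩ := hW.growth
  refine ⟨C * ENNReal.ofReal (Real.exp (A * R)), by finiteness, fun z hz => (h 0 z).trans ?_⟩
  gcongr
  simpa using hz

/-- A bounded subset of the Fock space is locally uniformly bounded. -/
theorem exists_norm_le (hW : IsFockRegular (weightMeasure w)) {p α : ℝ} (hp : 0 < p) (hα : 0 < α)
    (M : ℝ≥0) (R : ℝ) : ∃ B : ℝ, ∀ f : Cn n → ℂ, Differentiable ℂ f → fockNorm p α w f ≤ M →
      ∀ u, ‖u‖ ≤ R → ‖f u‖ ≤ B := by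
  obtain ⟨C, hC⟩ := hW.pointwise α hα p hp
  obtain ⟨K, hK, hKz⟩ := hW.exists_measure_ball_le R
  set W := weightMeasure w
  have h0 : W (Metric.ball 0 1) ≠ 0 := (hW.measure_ball_pos 0).ne'
  set b : ℝ≥0∞ := (K * (C * (M : ℝ≥0∞) ^ p) / W (Metric.ball 0 1)) ^ (1 / p)
  have hb : b ≠ ∞ := by
    refine ENNReal.rpow_ne_top_of_nonneg (by positivity) (ENNReal.div_ne_top ?_ h0)
    have : (M : ℝ≥0∞) ^ p ≠ ∞ := ENNReal.rpow_ne_top_of_nonneg hp.le ENNReal.coe_ne_top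
    finiteness
  refine ⟨b.toReal * Real.exp (α / 2 * R ^ 2), fun f hf hfM u hu => ?_⟩
  have h1 : ∫⁻ z, fockAbs α f z ^ p ∂W ≤ (M : ℝ≥0∞) ^ p := by
    rw [fockNorm_eq hp, one_div, ENNReal.rpow_inv_le_iff hp] at hfM
    exact hfM
  have h2 : fockAbs α f u ≤ b := by
    simp only [b]
    rw [one_div, ENNReal.le_rpow_inv_iff hp, ENNReal.le_div_iff_mul_le (Or.inl h0)
      (Or.inl (hW.measure_ball_lt_top 0).ne)]
    calc fockAbs α f u ^ p * W (Metric.ball 0 1)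
        ≤ K * (fockAbs α f u ^ p * W (Metric.ball u 1)) := by
          rw [mul_left_comm]
          gcongr
          exact hKz u hu
      _ ≤ K * (C * (M : ℝ≥0∞) ^ p) := by
          refine mul_le_mul' le_rfl ((hC f hf u).trans (mul_le_mul' le_rfl ?_))
          exact (setLIntegral_le_lintegral _ _).trans h1
  have h3 : ‖f u‖ * Real.exp (-(α / 2) * ‖u‖ ^ 2) ≤ b.toReal :=
    (ENNReal.ofReal_le_iff_le_toReal hb).1 h2
  calc ‖f u‖ = ‖f u‖ * Real.exp (-(α / 2) * ‖u‖ ^ 2) * Real.exp (α / 2 * ‖u‖ ^ 2) := by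
        rw [mul_assoc, ← Real.exp_add]; simp
    _ ≤ _ := by gcongr

/-- Compactness of the operator from boundedness and uniform smallness of the contribution of
the parts of the measure far away. -/
theorem berezinCompact_of_tail (hW : IsFockRegular (weightMeasure w)) {p q t α β : ℝ}
    (hp : 0 < p) (hq : 0 < q) (ht : 0 < t) (hα : 0 < α) (hβ : 0 < β) (μ : Measure (Cn n))
    [IsFiniteMeasureOnCompacts μ] (hbd : berezinOpNorm p q t α β w μ ≠ ∞)
    (htail : ∀ (M : ℝ≥0) (η : ℝ≥0∞), 0 < η → ∃ R : ℝ, ∀ f ∈ fockSpace p α w, fockNorm p α w f ≤ M →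
      berezinNorm q t α β w (μ.restrict (Metric.closedBall 0 R)ᶜ) f ≤ η) :
    BerezinCompact p q hq t α β w μ := by
  have hμ : SFinite μ := inferInstance
  set W := weightMeasure w with hWdef
  have hnorm : ∀ (M : ℝ≥0), ∀ f ∈ fockSpace p α w, fockNorm p α w f ≤ M →
      ∫⁻ z, berezinOp t α β μ f z ^ q ∂W ≤ (berezinOpNorm p q t α β w μ * M) ^ q := by
    intro M f hf hfM
    have := (hW.berezinNorm_le_opNorm_mul (β := β) hp hq ht μ hf).trans (mul_le_mul' le_rfl hfM)
    rwa [berezinNorm_eq hq, one_div, ENNReal.rpow_inv_le_iff hq] at this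
  have hnt : ∀ M : ℝ≥0, (berezinOpNorm p q t α β w μ * M) ^ q < ∞ := fun M =>
    ENNReal.rpow_lt_top_of_nonneg hq.le (ENNReal.mul_ne_top hbd ENNReal.coe_ne_top)
  have hmeas : ∀ f ∈ fockSpace p α w, Measurable (berezinOp t α β μ f) := fun f hf =>
    measurable_berezinOp ht μ hf.1.continuous.measurable
  refine ⟨fun f hf => ?_, fun A hA ⟨M, hM⟩ => ?_⟩
  · rw [memLp_ennreal_iff hq (hmeas f hf)]
    refine (hnorm (fockNorm p α w f).toNNReal f hf ?_).trans_lt (hnt _)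
    rw [ENNReal.coe_toNNReal hf.2.ne]
  let _ := lqMetric q hq W
  refine isCompact_closure_of_exists_subseq fun x hx => ?_
  choose f hfA hxf using hx
  have hdiff : ∀ j, Differentiable ℂ (f j) := fun j => (hA (hfA j)).1
  have hloc : ∀ R : ℝ, ∃ B : ℝ, ∀ j u, ‖u‖ ≤ R → ‖f j u‖ ≤ B := fun R => by
    obtain ⟨B, hB⟩ := hW.exists_norm_le hp hα M R
    exact ⟨B, fun j u hu => hB _ (hdiff j) (hM _ (hfA j)) u hu⟩
  obtain ⟨φ, hφ, g, hg⟩ := exists_subseq_tendsto hdiff hloc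
  have hmf : ∀ j, Measurable (f (φ j)) := fun j => (hdiff _).continuous.measurable
  -- Measurability of the limit is enough: its image is the limit point in L^q, and relative
  -- compactness does not ask for g in the Fock space.
  have hmg : Measurable g := measurable_of_tendsto_metrizable hmf (tendsto_pi_nhds.2 hg)
  have hN : ∀ j, ∫⁻ z, berezinOp t α β μ (f (φ j)) z ^ q ∂W ≤
      (berezinOpNorm p q t α β w μ * M) ^ q := fun j => hnorm M _ (hA (hfA _)) (hM _ (hfA _))
  have hNg := lintegral_berezinOp_le_of_tendsto hq ht W μ hmf hg hN
  have hy := memLp_toReal hq ((memLp_ennreal_iff (ν := W) hq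
    (measurable_berezinOp (α := α) (β := β) ht μ hmg)).2 (hNg.trans_lt (hnt M)))
  refine ⟨hy.toLp _, φ, hφ, tendsto_lqMetric hq ?_⟩
  refine (hW.tendsto_lintegral_toReal_sub hq ht hα hβ μ hmf hmg hg
    (fun R => (hloc R).imp fun B hB j => hB _) (hnt M).ne hN fun η hη => ?_).congr fun j => ?_
  · obtain ⟨R, hR⟩ := htail M (η ^ (1 / q)) (by
      rcases eq_or_ne η ∞ with rfl | h
      · simp [hq]
      · exact ENNReal.rpow_pos hη h)
    refine ⟨R, fun j => ?_⟩
    have := hR _ (hA (hfA (φ j))) (hM _ (hfA _))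
    rw [berezinNorm_eq hq] at this
    exact (ENNReal.rpow_le_rpow_iff (by positivity)).1 this
  · refine lintegral_congr_ae ?_
    filter_upwards [hxf (φ j), hy.coeFn_toLp] with z h1 h2
    rw [Function.comp_apply, h1, h2]

end IsFockRegular

/-! ### Sufficient conditions for compactness -/

/-- For |z| ≤ R the unit ball at z lies in the removed ball of radius R + 1. Thus a tail of μ is
governed by a tail of G. -/
theorem Gfun_restrict_le (p q : ℝ) {t : ℝ} (ht : 0 < t) (w : Cn n → ℝ) (μ : Measure (Cn n))
    (R : ℝ) (z : Cn n) : Gfun p q t w (μ.restrict (Metric.closedBall 0 (R + 1))ᶜ) z ≤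
      (Metric.closedBall 0 R)ᶜ.indicator (Gfun p q t w μ) z := by
  by_cases hz : z ∈ (Metric.closedBall (0 : Cn n) R)ᶜ
  · rw [Set.indicator_of_mem hz]
    unfold Gfun
    gcongr
    exact Measure.restrict_le_self
  · have hsub : Metric.ball z 1 ⊆ Metric.closedBall 0 (R + 1) := fun u hu => by
      have := norm_le_norm_add_norm_sub' u z
      simp only [Set.mem_compl_iff, not_not, mem_closedBall_zero_iff] at hz ⊢
      linarith [mem_ball_iff_norm.1 hu]
    have h0 : μ.restrict (Metric.closedBall 0 (R + 1))ᶜ (Metric.ball z 1) = 0 := by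
      rw [Measure.restrict_apply Metric.isOpen_ball.measurableSet,
        Set.disjoint_iff_inter_eq_empty.1 (Set.disjoint_compl_right_iff_subset.2 hsub),
        measure_empty]
    rw [Gfun, h0, ENNReal.zero_rpow_of_pos (by positivity), ENNReal.zero_div]
    exact zero_le

namespace IsFockRegular

variable {w : Cn n → ℝ}

/-- Far out G ≤ 1 by the limit. On a ball μ is finite and w(B_1(z)) is bounded below, which suffices
as 1/p - 1/q ≥ 0. -/
theorem iSup_Gfun_ne_top_of_tendsto (hW : IsFockRegular (weightMeasure w)) {p q t : ℝ} (hp : 0 < p)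
    (hpq : p ≤ q) (ht : 0 < t) (μ : Measure (Cn n)) [IsFiniteMeasureOnCompacts μ]
    (h : Tendsto (Gfun p q t w μ) (cocompact (Cn n)) (𝓝 0)) : (⨆ z, Gfun p q t w μ z) ≠ ∞ := by
  have h1 := ENNReal.tendsto_nhds_zero.1 h 1 one_pos
  rw [Metric.cobounded_eq_cocompact.symm, ← comap_norm_atTop, (atTop_basis.comap _).eventually_iff]
    at h1
  obtain ⟨R, -, hR⟩ := h1
  obtain ⟨K, hK, hKz⟩ := hW.exists_measure_ball_le R
  have he : 0 ≤ 1 / p - 1 / q := sub_nonneg.2 (one_div_le_one_div_of_le hp hpq)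
  set W0 := weightMeasure w (Metric.ball 0 1)
  have h0 : W0 ≠ 0 := (hW.measure_ball_pos 0).ne'
  have h0t : W0 ≠ ∞ := (hW.measure_ball_lt_top 0).ne
  set b := μ (Metric.closedBall 0 (R + 1)) ^ (1 / t) / (W0 / K) ^ (1 / p - 1 / q)
  have hb : b ≠ ∞ := by
    refine ENNReal.div_ne_top (ENNReal.rpow_ne_top_of_nonneg (by positivity)
      (isCompact_closedBall _ _).measure_lt_top.ne) ?_
    exact (ENNReal.rpow_pos_of_nonneg (ENNReal.div_pos h0 hK) he).ne'
  refine ((iSup_le fun z => ?_).trans_lt (max_lt ENNReal.one_lt_top hb.lt_top)).ne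
  rcases le_total ‖z‖ R with hz | hz
  · refine le_max_of_le_right ?_
    unfold Gfun
    refine ENNReal.div_le_div (ENNReal.rpow_le_rpow (measure_mono fun u hu => ?_) (by positivity))
      (ENNReal.rpow_le_rpow (ENNReal.div_le_of_le_mul' (hKz z hz)) he)
    rw [mem_closedBall_zero_iff]
    have := norm_le_norm_add_norm_sub' u z
    linarith [mem_ball_iff_norm.1 hu]
  · exact le_max_of_le_left (hR hz)

/-- The norm bound by sup G has a constant independent of the measure; applied to μ outside a large
ball it gives the small tail. -/
theorem berezinCompact_of_tendsto (hW : IsFockRegular (weightMeasure w)) {p q t α β : ℝ}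
    (hp : 0 < p) (hq : 0 < q) (hpq : p ≤ q) (ht : 0 < t) (hα : 0 < α) (hβ : 0 < β)
    (μ : Measure (Cn n)) [IsFiniteMeasureOnCompacts μ]
    (h : Tendsto (Gfun p q t w μ) (cocompact (Cn n)) (𝓝 0)) :
    BerezinCompact p q hq t α β w μ := by
  obtain ⟨C, -, hC⟩ := hW.exists_berezinNorm_le_iSup hp hpq ht hα hβ
  refine hW.berezinCompact_of_tail hp hq ht hα hβ μ ?_ fun M η hη => ?_
  · refine ((iSup₂_le fun f hf => (hC μ f hf.1.1).trans (mul_le_mul' le_rfl hf.2)).trans_lt ?_).ne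
    rw [mul_one]
    exact ENNReal.mul_lt_top ENNReal.coe_lt_top
      (hW.iSup_Gfun_ne_top_of_tendsto hp hpq ht μ h).lt_top
  · obtain ⟨ε, hε, hεη⟩ := exists_mul_rpow_le (c := C * M) (by finiteness) hη one_pos
    rw [ENNReal.rpow_one] at hεη
    have h1 := ENNReal.tendsto_nhds_zero.1 h ε (by exact_mod_cast hε)
    rw [Metric.cobounded_eq_cocompact.symm, ← comap_norm_atTop,
      (atTop_basis.comap _).eventually_iff] at h1
    obtain ⟨R, -, hR⟩ := h1
    refine ⟨R + 1, fun f hf hfM => (hC _ f hf.1).trans ?_⟩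
    calc _ ≤ C * (ε : ℝ≥0∞) * M := by
          refine mul_le_mul' (mul_le_mul' le_rfl (iSup_le fun z => ?_)) hfM
          refine (Gfun_restrict_le p q ht w μ R z).trans ?_
          by_cases hz : z ∈ (Metric.closedBall (0 : Cn n) R)ᶜ
          · rw [Set.indicator_of_mem hz]
            refine hR ?_
            simp only [Set.mem_compl_iff, mem_closedBall_zero_iff, not_le] at hz
            exact hz.le
          · rw [Set.indicator_of_notMem hz]
            exact zero_le
      _ = C * M * ε := by ring
      _ ≤ η := hεη

/-- As for p ≤ q, with the tail of the integral of G^κ in place of a supremum. Local finiteness of μ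
is a consequence of boundedness here. -/
theorem berezinCompact_of_memLp (hW : IsFockRegular (weightMeasure w)) {p q t α β : ℝ}
    (hq : 0 < q) (hqp : q < p) (ht : 0 < t) (hα : 0 < α) (hβ : 0 < β)
    (μ : Measure (Cn n))
    (h : eLpNorm (Gfun p q t w μ) (ENNReal.ofReal (p * q / (p - q))) volume ≠ ∞) :
    BerezinCompact p q hq t α β w μ := by
  have hp : 0 < p := hq.trans hqp
  have hpq : 0 < p - q := sub_pos.2 hqp
  obtain ⟨C, -, hC⟩ := hW.exists_berezinNorm_le_eLpNorm hq hqp ht hα hβ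
  obtain ⟨CG, -, hCG⟩ := hW.exists_Gfun_le hp hq ht hα hβ
  have hbd : berezinOpNorm p q t α β w μ ≠ ∞ := by
    refine ((iSup₂_le fun f hf => (hC μ f hf.1.1).trans (mul_le_mul' le_rfl hf.2)).trans_lt ?_).ne
    rw [mul_one]
    exact ENNReal.mul_lt_top ENNReal.coe_lt_top h.lt_top
  have hfin : ∀ z, μ (Metric.ball z 1) < ∞ := fun z =>
    hW.measure_ball_lt_top_of_Gfun_lt_top ht
      ((hCG μ z).trans_lt (ENNReal.mul_lt_top ENNReal.coe_lt_top hbd.lt_top))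
  have : IsLocallyFiniteMeasure μ :=
    ⟨fun z => ⟨Metric.ball z 1, Metric.ball_mem_nhds z one_pos, hfin z⟩⟩
  refine hW.berezinCompact_of_tail hp hq ht hα hβ μ hbd fun M η hη => ?_
  set κ := p * q / (p - q) with hκdef
  have hκ : 0 < κ := by positivity
  rw [eLpNorm_ennreal hκ] at h
  have hint : ∫⁻ z, Gfun p q t w μ z ^ κ ≠ ∞ := fun e => h (by simp [e, hκ])
  obtain ⟨ε, hε, hεη⟩ := exists_mul_rpow_le (c := C * M) (by finiteness) hη one_pos
  rw [ENNReal.rpow_one] at hεη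
  obtain ⟨R, hR⟩ := (ENNReal.tendsto_nhds_zero.1 (tendsto_setLIntegral_compl_closedBall _ hint)
    ((ε : ℝ≥0∞) ^ κ) (ENNReal.rpow_pos (by exact_mod_cast hε) ENNReal.coe_ne_top)).exists
  refine ⟨R + 1, fun f hf hfM => (hC _ f hf.1).trans ?_⟩
  calc _ ≤ C * (ε : ℝ≥0∞) * M := by
        refine mul_le_mul' (mul_le_mul' le_rfl ?_) hfM
        rw [eLpNorm_ennreal hκ, one_div, ENNReal.rpow_inv_le_iff hκ]
        refine le_trans ?_ hR
        rw [← lintegral_indicator Metric.isClosed_closedBall.measurableSet.compl]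
        refine lintegral_mono fun z => ?_
        refine (ENNReal.rpow_le_rpow (Gfun_restrict_le p q ht w μ R z) hκ.le).trans (le_of_eq ?_)
        by_cases hz : z ∈ (Metric.closedBall (0 : Cn n) R)ᶜ
        · rw [Set.indicator_of_mem hz, Set.indicator_of_mem hz]
        · rw [Set.indicator_of_notMem hz, Set.indicator_of_notMem hz, ENNReal.zero_rpow_of_pos hκ]
    _ = C * M * ε := by ring
    _ ≤ η := hεη

end IsFockRegular

/-! ### Consequences of compactness -/

namespace BerezinCompact

variable {w : Cn n → ℝ} {p q t α β : ℝ} {hq : 0 < q} {μ : Measure (Cn n)}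

/-- The image of a bounded set under a compact operator is covered by finitely many small balls. -/
theorem exists_finite_net (h : BerezinCompact p q hq t α β w μ) (M : ℝ≥0) {δ : ℝ≥0} (hδ : 0 < δ) :
    ∃ T : Set (Lp ℝ (ENNReal.ofReal q) (weightMeasure w)), T.Finite ∧
      ∀ f ∈ fockSpace p α w, fockNorm p α w f ≤ M → ∃ y ∈ T, ∀ s : Set (Cn n),
        ∫⁻ z in s, berezinOp t α β μ f z ^ q ∂weightMeasure w ≤
          2 ^ q * (δ + ∫⁻ z in s, ‖y z‖ₑ ^ q ∂weightMeasure w) := by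
  set W := weightMeasure w
  have hm : 0 < min 1 q / q := div_pos (lt_min one_pos hq) hq
  -- The distance in L^q is the integral of |x - y|^q to the power min(1,q)/q, so this radius means
  -- that the integral is less than δ.
  have hδ' : (0 : ℝ≥0∞) < (δ : ℝ≥0∞) ^ (min 1 q / q) :=
    ENNReal.rpow_pos_of_nonneg (by exact_mod_cast hδ) hm.le
  have hc := h.2 {f ∈ fockSpace p α w | fockNorm p α w f ≤ M} (fun f hf => hf.1) ⟨M, fun f hf => hf.2⟩
  obtain ⟨T, hT, hcov⟩ := (@EMetric.totallyBounded_iff _ (lqMetric q hq W) _).1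
    (@IsCompact.totallyBounded _ (lqMetric q hq W).toUniformSpace _ hc) _ hδ'
  refine ⟨T, hT, fun f hf hfM => ?_⟩
  have hLp := h.1 f hf
  set x := (memLp_toReal hq hLp).toLp
  have hx := (memLp_toReal hq hLp).coeFn_toLp
  obtain ⟨y, hy, hxy⟩ := Set.mem_iUnion₂.1
    (hcov (@subset_closure _ (lqMetric q hq W).toUniformSpace.toTopologicalSpace _ _
      ⟨f, ⟨hf, hfM⟩, hx⟩))
  refine ⟨y, hy, fun s => ?_⟩
  change (lqMetric q hq W).edist x y < _ at hxy
  rw [lqMetric_edist, ENNReal.rpow_lt_rpow_iff hm] at hxy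
  have hmx : AEMeasurable (fun z => ‖x z - y z‖ₑ ^ q) (W.restrict s) :=
    (((Lp.aestronglyMeasurable x).sub (Lp.aestronglyMeasurable y)).enorm.pow_const q).restrict
  calc ∫⁻ z in s, berezinOp t α β μ f z ^ q ∂W
      ≤ ∫⁻ z in s, 2 ^ q * (‖x z - y z‖ₑ ^ q + ‖y z‖ₑ ^ q) ∂W := by
        refine lintegral_mono_ae (ae_restrict_of_ae ?_)
        filter_upwards [hx, ae_enorm_toReal hq hLp] with z h1 h2
        rw [← h2, ← h1]
        refine le_trans ?_ (add_rpow_le_two_rpow _ _ hq)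
        gcongr
        simpa using enorm_add_le (x z - y z) (y z)
    _ = 2 ^ q * (∫⁻ z in s, ‖x z - y z‖ₑ ^ q ∂W + ∫⁻ z in s, ‖y z‖ₑ ^ q ∂W) := by
        rw [lintegral_const_mul' _ _ (ENNReal.rpow_ne_top_of_nonneg hq.le (by simp)),
          lintegral_add_left' hmx]
    _ ≤ _ := by
        gcongr
        exact (setLIntegral_le_lintegral _ _).trans hxy.le

/-- The image of the unit ball lies near a finite set of L^q functions, hence is bounded. -/
theorem berezinOpNorm_ne_top (h : BerezinCompact p q hq t α β w μ) :
    berezinOpNorm p q t α β w μ ≠ ∞ := by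
  obtain ⟨T, hT, hnet⟩ := h.exists_finite_net 1 one_pos
  set N := ∑ y ∈ hT.toFinset, ∫⁻ z, ‖y z‖ₑ ^ q ∂weightMeasure w
  have hN : N ≠ ∞ := (ENNReal.sum_lt_top.2 fun y _ => lintegral_enorm_rpow_lt_top hq y).ne
  refine ((iSup₂_le fun f hf => ?_ :
    _ ≤ (2 ^ q * (((1 : ℝ≥0) : ℝ≥0∞) + N)) ^ (1 / q)).trans_lt ?_).ne
  · obtain ⟨y, hy, hfy⟩ := hnet f hf.1 (by simpa using hf.2)
    have h1 := hfy Set.univ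
    rw [Measure.restrict_univ] at h1
    rw [berezinNorm_eq hq]
    refine ENNReal.rpow_le_rpow (h1.trans ?_) (by positivity)
    gcongr
    exact Finset.single_le_sum (f := fun y : Lp ℝ (ENNReal.ofReal q) (weightMeasure w) =>
      ∫⁻ z, ‖y z‖ₑ ^ q ∂weightMeasure w) (fun _ _ => zero_le) (hT.mem_toFinset.2 hy)
  · refine ENNReal.rpow_lt_top_of_nonneg (by positivity) ?_
    have : (2 : ℝ≥0∞) ^ q ≠ ∞ := ENNReal.rpow_ne_top_of_nonneg hq.le (by simp)
    finiteness

/-- The kernels divided by W(B_1(a))^{1/p} form a bounded set, and their images have mass at least a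
constant times G(a)^q on B_1(a). A finite net has almost no mass there for large |a|, so G(a) is
small. -/
theorem tendsto_Gfun (h : BerezinCompact p q hq t α β w μ) (hW : IsFockRegular (weightMeasure w))
    (hp : 0 < p) (ht : 0 < t) (hα : 0 < α) (hβ : 0 < β) :
    Tendsto (Gfun p q t w μ) (cocompact (Cn n)) (𝓝 0) := by
  obtain ⟨M, hM⟩ := hW.exists_fockNorm_fockKer_le hp hα
  set k := ENNReal.ofReal (Real.exp (-(2 * β / t))) * ENNReal.ofReal (Real.exp (-(α / 2))) with hk
  have hk0 : k ≠ 0 := by simp [hk, Real.exp_pos]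
  have hkt : k ≠ ∞ := by finiteness
  rw [ENNReal.tendsto_nhds_zero]
  intro η hη
  have h2t : (2 : ℝ≥0∞) ^ q ≠ ∞ := ENNReal.rpow_ne_top_of_nonneg hq.le (by simp)
  obtain ⟨δ, hδ, hδη⟩ := exists_mul_rpow_le (c := 2 ^ q * 2) (η := (k * η) ^ q) (by finiteness)
    (ENNReal.rpow_pos_of_nonneg (ENNReal.mul_pos hk0 hη.ne') hq.le) one_pos
  rw [ENNReal.rpow_one] at hδη
  set W := weightMeasure w
  obtain ⟨T, hT, hnet⟩ := h.exists_finite_net M hδ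
  -- Finiteness of the net gives one radius beyond which every element has q-mass at most δ.
  obtain ⟨R, hR⟩ : ∃ R : ℝ, ∀ y ∈ T,
      ∫⁻ z in (Metric.closedBall 0 R)ᶜ, ‖y z‖ₑ ^ q ∂W ≤ δ := by
    have h1 : ∀ y ∈ T, ∀ᶠ R : ℝ in atTop,
        ∫⁻ z in (Metric.closedBall 0 R)ᶜ, ‖y z‖ₑ ^ q ∂W ≤ δ := fun y _ =>
      ENNReal.tendsto_nhds_zero.1 (tendsto_setLIntegral_compl_closedBall W
        (lintegral_enorm_rpow_lt_top hq y).ne) δ (by exact_mod_cast hδ)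
    exact ((eventually_all_finite hT).2 h1).exists
  filter_upwards [(isCompact_closedBall (0 : Cn n) (R + 1)).compl_mem_cocompact] with a ha
  set B := Metric.ball a 1
  have hBR : B ⊆ (Metric.closedBall 0 R)ᶜ := fun u hu => by
    simp only [Set.mem_compl_iff, mem_closedBall_zero_iff, not_le] at ha ⊢
    have h1 := norm_le_norm_add_norm_sub' a u
    have h2 := mem_ball_iff_norm.1 hu
    rw [norm_sub_rev] at h2
    linarith
  have h0 : W B ≠ 0 := (hW.measure_ball_pos a).ne'
  have hWt : W B ≠ ∞ := (hW.measure_ball_lt_top a).ne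
  set ω := (W B ^ (1 / p))⁻¹
  have hω0 : W B ^ (1 / p) ≠ 0 := (ENNReal.rpow_pos_of_nonneg h0.bot_lt (by positivity)).ne'
  have hωt : W B ^ (1 / p) ≠ ∞ := ENNReal.rpow_ne_top_of_nonneg (by positivity) hWt
  set c : ℂ := (ω.toReal : ℂ)
  have hc : ‖c‖ₑ = ω := by
    rw [← ofReal_norm, Complex.norm_real, ofReal_norm, Real.enorm_toReal (ENNReal.inv_ne_top.2 hω0)]
  obtain ⟨y, hy, hfy⟩ := hnet (c • fockKer α a)
    (smul_mem_fockSpace hp (hW.fockKer_mem_fockSpace hp hα a) c) (by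
      rw [fockNorm_smul hp, hc]
      calc _ ≤ ω * (M * W B ^ (1 / p)) := by
            gcongr
            exact hM a
        _ = M * (ω * W B ^ (1 / p)) := by ring
        _ = M := by rw [ENNReal.inv_mul_cancel hω0 hωt, mul_one])
  have hlow : ∀ z ∈ B, k * ω * μ B ^ (1 / t) ≤ berezinOp t α β μ (c • fockKer α a) z := by
    intro z hz
    refine le_trans (le_of_eq ?_) (le_berezinOp_of_le (α := α) ht hβ μ
      (c := ω * ENNReal.ofReal (Real.exp (-(α / 2)))) (fun u hu => ?_) hz)
    · rw [hk]; ring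
    · rw [fockAbs_smul, hc]
      gcongr
      simpa using fockAbs_coe_mul_fockKer_ge hα 1 hu
  have hG : (k * Gfun p q t w μ a) ^ q ≤ (k * η) ^ q := by
    calc (k * Gfun p q t w μ a) ^ q = (k * (ω * W B ^ (1 / p)) * Gfun p q t w μ a) ^ q := by
          rw [ENNReal.inv_mul_cancel hω0 hωt, mul_one]
      _ = (k * ω * (Gfun p q t w μ a * W B ^ (1 / p))) ^ q := by ring_nf
      _ = (k * ω * μ B ^ (1 / t)) ^ q * W B := by
          rw [← hW.rpow_mul_measure_eq_Gfun, ← mul_assoc, ENNReal.mul_rpow_of_nonneg _ _ hq.le,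
            ← ENNReal.rpow_mul, one_div_mul_cancel hq.ne', ENNReal.rpow_one]
      _ = ∫⁻ _ in B, (k * ω * μ B ^ (1 / t)) ^ q ∂W := by rw [setLIntegral_const]
      _ ≤ ∫⁻ z in B, berezinOp t α β μ (c • fockKer α a) z ^ q ∂W :=
          setLIntegral_mono' Metric.isOpen_ball.measurableSet fun z hz =>
            ENNReal.rpow_le_rpow (hlow z hz) hq.le
      _ ≤ 2 ^ q * (δ + ∫⁻ z in B, ‖y z‖ₑ ^ q ∂W) := hfy B
      _ ≤ 2 ^ q * (δ + δ) := by
          gcongr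
          exact (lintegral_mono_set hBR).trans (hR y hy)
      _ = 2 ^ q * 2 * δ := by ring
      _ ≤ _ := hδη
  exact (ENNReal.mul_le_mul_iff_right hk0 hkt).1 ((ENNReal.rpow_le_rpow_iff hq).1 hG)

end BerezinCompact

end

/-! ### The characterization of boundedness and compactness -/

theorem theorem1p1 {n : ℕ} (hn : 1 ≤ n) {p q t α β : ℝ} (hp : 0 < p) (hq : 0 < q) (ht : 0 < t)
    (hα : 0 < α) (hβ : 0 < β) {w : Cn n → ℝ} (hw : IsAInftyRestricted w) :
    (p ≤ q →
      (∀ μ : Measure (Cn n),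
        BerezinBounded p q t α β w μ ↔ ∃ M : ℝ≥0, ∀ z, Gfun p q t w μ z ≤ M) ∧
      (∃ C : ℝ≥0, 0 < C ∧ ∀ μ : Measure (Cn n),
        berezinOpNorm p q t α β w μ ≤ C * (⨆ z, Gfun p q t w μ z) ∧
        (⨆ z, Gfun p q t w μ z) ≤ C * berezinOpNorm p q t α β w μ) ∧
      (∀ μ : Measure (Cn n), IsFiniteMeasureOnCompacts μ →
        (BerezinCompact p q hq t α β w μ ↔
          Tendsto (Gfun p q t w μ) (cocompact (Cn n)) (𝓝 0)))) ∧
    (q < p →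
      (∀ μ : Measure (Cn n),
        List.TFAE [BerezinBounded p q t α β w μ,
          BerezinCompact p q hq t α β w μ,
          MemLp (Gfun p q t w μ) (ENNReal.ofReal (p * q / (p - q))) volume]) ∧
      (∃ C : ℝ≥0, 0 < C ∧ ∀ μ : Measure (Cn n),
        berezinOpNorm p q t α β w μ ≤
          C * eLpNorm (Gfun p q t w μ) (ENNReal.ofReal (p * q / (p - q))) volume ∧
        eLpNorm (Gfun p q t w μ) (ENNReal.ofReal (p * q / (p - q))) volume ≤
          C * berezinOpNorm p q t α β w μ)) := by
  have hW := hw.isFockRegular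
  obtain ⟨C₂, hC₂, hG⟩ := hW.exists_Gfun_le hp hq ht hα hβ
  refine ⟨fun hpq => ?_, fun hqp => ?_⟩
  · obtain ⟨C₁, hC₁, hS⟩ := hW.exists_berezinNorm_le_iSup hp hpq ht hα hβ
    have hle : ∀ μ : Measure (Cn n),
        berezinOpNorm p q t α β w μ ≤ C₁ * (⨆ z, Gfun p q t w μ z) := fun μ =>
      iSup₂_le fun f hf =>
        ((hS μ f hf.1.1).trans (mul_le_mul' le_rfl hf.2)).trans (mul_one _).le
    have hge : ∀ μ : Measure (Cn n),
        (⨆ z, Gfun p q t w μ z) ≤ C₂ * berezinOpNorm p q t α β w μ := fun μ => iSup_le (hG μ)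
    refine ⟨fun μ => ?_, ⟨max C₁ C₂, lt_max_of_lt_left hC₁, fun μ => ⟨(hle μ).trans ?_,
      (hge μ).trans ?_⟩⟩, fun μ hμ => ⟨fun h => h.tendsto_Gfun hW hp ht hα hβ, fun h => ?_⟩⟩
    · rw [hW.berezinBounded_iff hp hq ht]
      constructor
      · intro h
        have h1 : C₂ * berezinOpNorm p q t α β w μ ≠ ∞ := ENNReal.mul_ne_top ENNReal.coe_ne_top h
        refine ⟨(C₂ * berezinOpNorm p q t α β w μ).toNNReal, fun z => ?_⟩
        rw [ENNReal.coe_toNNReal h1]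
        exact hG μ z
      · rintro ⟨M, hM⟩
        exact ((hle μ).trans_lt (ENNReal.mul_lt_top ENNReal.coe_lt_top
          ((iSup_le hM).trans_lt ENNReal.coe_lt_top))).ne
    · gcongr
      exact le_max_left _ _
    · gcongr
      exact le_max_right _ _
    · exact hW.berezinCompact_of_tendsto hp hq hpq ht hα hβ μ h
  · obtain ⟨C₁, hC₁, hS⟩ := hW.exists_berezinNorm_le_eLpNorm hq hqp ht hα hβ
    obtain ⟨C₃, hC₃, hN⟩ := hW.exists_eLpNorm_Gfun_le hq hqp ht hα hβ
    refine ⟨fun μ => ?_, max C₁ C₃, lt_max_of_lt_left hC₁, fun μ => ⟨iSup₂_le fun f hf => ?_,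
      (hN μ).trans ?_⟩⟩
    · tfae_have 1 → 3 := fun h => by
        rw [hW.berezinBounded_iff hp hq ht] at h
        -- For arbitrary μ the measurability of G required by `MemLp` is obtained from finiteness of
        -- μ on unit balls, which the pointwise bound for G provides.
        have hfin : ∀ z, μ (Metric.ball z 1) < ∞ := fun z =>
          hW.measure_ball_lt_top_of_Gfun_lt_top ht
            ((hG μ z).trans_lt (ENNReal.mul_lt_top ENNReal.coe_lt_top h.lt_top))
        exact ⟨(hW.measurable_Gfun p q t hfin).aestronglyMeasurable,
          (hN μ).trans_lt (ENNReal.mul_lt_top ENNReal.coe_lt_top h.lt_top)⟩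
      tfae_have 3 → 2 := fun h => hW.berezinCompact_of_memLp hq hqp ht hα hβ μ h.2.ne
      tfae_have 2 → 1 := fun h => (hW.berezinBounded_iff hp hq ht μ).2 h.berezinOpNorm_ne_top
      tfae_finish
    · refine ((hS μ f hf.1.1).trans (mul_le_mul' le_rfl hf.2)).trans ?_
      rw [mul_one]
      gcongr
      exact le_max_left _ _
    · gcongr
      exact le_max_right _ _
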